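/- Let $k$ be an algebraically closed field of characteristic $0$, and let $S=k[x_1,x_2,x_3,x_4]$ act on $R=k[y_1,y_2,y_3,y_4]$ by letting $x_i$ act as $\partial/\partial y_i$. Let $g\in R_3$ be a cubic form, let $g^\perp=\{f\in S : f(g)=0\}$, and set $A=S/g^\perp$ and $A^{(2)}=S/(g^\perp)^2$. For a quotient $Q$ of $S$ write $h_Q(i)=\dim_k(\mathfrak M^i/\mathfrak M^{i+1})$ for all $i\ge 0$, where $\mathfrak M$ is the ideal of $Q$ generated by the classes of $x_1,\dots,x_4$ (the maximal ideal of the local algebra $Q$ in the cases $Q=A$ and $Q=A^{(2)}$ when $g\neq 0$); the vector $(n_0,\dots,n_e)$ denotes the function with values $n_0,\dots,n_e$ at $0,\dots,e$ and value $0$ afterwards. Assume that $h_A=(1,4,4,1)$. Let $\beta$ be the number of elements of degree $3$ in a minimal system of homogeneous generators of $g^\perp$. If $\beta\ge 1$, then exactly one of the following two cases holds: either $\beta=1$ and $h_{A^{(2)}}=(1,4,10,20,14,1)$, or $\beta=3$ and $h_{A^{(2)}}=(1,4,10,20,16,4)$. -/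

import Mathlib

open MvPolynomial

noncomputable section

/-- The operator `x^α` on polynomials in `y`: on monomials it is
`x^α (y^β) = α! * (β choose α) * y^(β - α)` if `α ≤ β`, and `0` otherwise. -/
def monomialAction {n : ℕ} (k : Type*) [Field k] (α : Fin n →₀ ℕ) :
    MvPolynomial (Fin n) k →ₗ[k] MvPolynomial (Fin n) k :=
  (basisMonomials (Fin n) k).constr k fun β =>
    if α ≤ β then
      monomial (β - α) ((∏ i, (α i).factorial * (β i).choose (α i) : ℕ) : k)
    else 0

theorem monomialAction_monomial {n : ℕ} {k : Type*} [Field k] (α β : Fin n →₀ ℕ) (c : k) :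
    monomialAction k α (monomial β c) =
      monomial (β - α) (c * ((∏ i, (β i).descFactorial (α i) : ℕ) : k)) := by
  have h1 : monomialAction k α (monomial β 1) =
      monomial (β - α) ((∏ i, (β i).descFactorial (α i) : ℕ) : k) := by
    have h := (basisMonomials (Fin n) k).constr_basis k (fun β : Fin n →₀ ℕ =>
      if α ≤ β then
        monomial (β - α) ((∏ i, (α i).factorial * (β i).choose (α i) : ℕ) : k)
      else 0) β
    rw [coe_basisMonomials] at h
    rw [monomialAction, h]
    simp only [Nat.descFactorial_eq_factorial_mul_choose]
    split_ifs with hle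
    · rfl
    · obtain ⟨i, hi⟩ : ∃ i, β i < α i := by
        by_contra! hcon
        exact hle hcon
      rw [Finset.prod_eq_zero (Finset.mem_univ i) (by simp [Nat.choose_eq_zero_of_lt hi])]
      simp
  have h2 : (monomial β c : MvPolynomial (Fin n) k) = c • monomial β 1 := by
    simp [smul_monomial]
  rw [h2, map_smul, h1, smul_monomial, smul_eq_mul]

theorem monomialAction_add {n : ℕ} {k : Type*} [Field k] (α α' : Fin n →₀ ℕ) :
    monomialAction k (α + α') = monomialAction k α * monomialAction k α' := by
  refine (basisMonomials (Fin n) k).ext fun β => ?_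
  rw [coe_basisMonomials, Module.End.mul_apply]
  simp only [monomialAction_monomial]
  have e : β - (α + α') = β - α' - α := by
    ext i; simp only [Finsupp.tsub_apply, Finsupp.add_apply]; omega
  rw [e, one_mul, one_mul, ← Nat.cast_mul, ← Finset.prod_mul_distrib]
  congr 2
  refine Finset.prod_congr rfl fun i _ => ?_
  have := Nat.descFactorial_mul_descFactorial (n := β i) (Nat.le_add_left (α' i) (α i))
  rw [Nat.add_sub_cancel] at this
  rw [Finsupp.add_apply, Finsupp.tsub_apply, ← this, mul_comm]

theorem monomialAction_zero {n : ℕ} {k : Type*} [Field k] :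
    monomialAction k (0 : Fin n →₀ ℕ) = 1 := by
  refine (basisMonomials (Fin n) k).ext fun β => ?_
  simp [coe_basisMonomials, monomialAction_monomial]

/-- The apolarity action of `S = k[x_1,…,x_n]` on `R = k[y_1,…,y_n]`: the `k`-linear extension in
both arguments of `monomialAction`, bundled as an algebra homomorphism `S → End_k R`. -/
def apolarAction {n : ℕ} (k : Type*) [Field k] :
    MvPolynomial (Fin n) k →ₐ[k] Module.End k (MvPolynomial (Fin n) k) :=
  AddMonoidAlgebra.lift k (Module.End k (MvPolynomial (Fin n) k)) (Fin n →₀ ℕ)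
    { toFun := fun α => monomialAction k α.toAdd
      map_one' := monomialAction_zero
      map_mul' := fun α α' => monomialAction_add α.toAdd α'.toAdd }

theorem apolarAction_monomial {n : ℕ} {k : Type*} [Field k] (α : Fin n →₀ ℕ) (c : k) :
    apolarAction k (monomial α c) = c • monomialAction k α :=
  AddMonoidAlgebra.lift_single _ _ _

/-- The variable `x_i` acts as the partial derivative with respect to `y_i`. -/
theorem apolarAction_X {n : ℕ} {k : Type*} [Field k] (i : Fin n) (g : MvPolynomial (Fin n) k) :
    apolarAction k (X i) g = pderiv i g := by
  have : apolarAction k (X i : MvPolynomial (Fin n) k) = (pderiv i).toLinearMap := by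
    refine (basisMonomials (Fin n) k).ext fun β => ?_
    rw [X, apolarAction_monomial, one_smul, coe_basisMonomials, monomialAction_monomial]
    change _ = pderiv i (monomial β (1 : k))
    rw [pderiv_monomial]
    congr 3
    rw [Finset.prod_eq_single i]
    · simp
    · intro j _ hj
      simp [Finsupp.single_eq_of_ne hj]
    · simp
  rw [this]
  rfl

/-- `g^⊥ = {f ∈ S | f(g) = 0}`. -/
def apolarIdeal {n : ℕ} {k : Type*} [Field k] (g : MvPolynomial (Fin n) k) :
    Ideal (MvPolynomial (Fin n) k) where
  carrier := {f | apolarAction k f g = 0}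
  add_mem' := by
    intro a b ha hb
    change apolarAction k (a + b) g = 0
    rw [map_add, LinearMap.add_apply, show apolarAction k a g = 0 from ha,
      show apolarAction k b g = 0 from hb, add_zero]
  zero_mem' := by simp
  smul_mem' := by
    intro c f hf
    change apolarAction k (c * f) g = 0
    rw [map_mul, Module.End.mul_apply, show apolarAction k f g = 0 from hf, map_zero]

/-- The Hilbert function `i ↦ dim_k (M^i / M^(i+1))` of a `k`-algebra `A` with respect to an
ideal `M` (the maximal ideal, when `A` is local). -/
def idealHilbertFunction (k : Type*) [Field k] {A : Type*} [CommRing A] [Algebra k A]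
    (M : Ideal A) (i : ℕ) : ℕ :=
  Module.finrank k (↥(M ^ i) ⧸ (M ^ (i + 1)).submoduleOf (M ^ i))

/-- The Hilbert function of `A = k[x_1,…,x_n]/I` at the origin: here `M` is the ideal generated by
the classes of `x_1,…,x_n`. It is the maximal ideal of `A` whenever `A` is local with all the `x_i`
nilpotent, as is the case for `I = g^⊥` and `I = (g^⊥)^2` with `g` a nonzero form of positive
degree. -/
def quotientHilbertFunction {n : ℕ} {k : Type*} [Field k] (I : Ideal (MvPolynomial (Fin n) k)) :
    ℕ → ℕ :=
  idealHilbertFunction k (A := MvPolynomial (Fin n) k ⧸ I)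
    (Ideal.span (Set.range fun i : Fin n => Ideal.Quotient.mk I (X i)))

/-- The function with values `l_0, …, l_e` at `0, …, e` and `0` afterwards. -/
def vectorFunction (l : List ℕ) : ℕ → ℕ := fun i => l.getD i 0

/-- `B` is a minimal system of homogeneous generators of the ideal `I`: it consists of homogeneous
polynomials, generates `I`, and no proper subset of `B` does so. -/
def IsMinimalHomogeneousGenerators {n : ℕ} {k : Type*} [Field k]
    (I : Ideal (MvPolynomial (Fin n) k)) (B : Set (MvPolynomial (Fin n) k)) : Prop :=
  Minimal (fun B' : Set (MvPolynomial (Fin n) k) =>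
    (∀ f ∈ B', ∃ d : ℕ, f.IsHomogeneous d) ∧ Ideal.span B' = I) B

/-- The number of elements of degree `d` in a system `B` of nonzero homogeneous polynomials. -/
def numGenerators {n : ℕ} {k : Type*} [Field k] (B : Set (MvPolynomial (Fin n) k)) (d : ℕ) : ℕ :=
  {f ∈ B | f.IsHomogeneous d}.ncard

end

/-! Write γ for the functional f ↦ f(g), S_d for `forms k d`, and N₂, N₃ for the parts of g^⊥ in
degrees 2 and 3. Since h_A = (1,4,4,1), the contractions γ(v·) by nonzero linear forms v are
nonzero, dim N₂ = 6 and dim N₃ = 19. Minimality of the generators gives β = 19 − dim S₁N₂. The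
square of g^⊥ is N₂N₂ in degree 4 and N₂N₃ in degree 5, and it contains all forms of degree at least
6 once S₆ ⊆ N₃N₃ + N₂S₄. Everything therefore reduces to `hasExpectedDimensions_of_finrank_le`: if
dim S₁N₂ ≤ 18, then the dimensions of S₁N₂, N₂N₂, N₂N₃ are 18, 21, 55 or 16, 19, 52, and the
inclusion in degree 6 holds.

If dim S₁N₂ ≤ 18, some functional G on S₃ that is not a multiple of γ kills S₁N₂. It has the form
G(uvw) = γ(M(u)vw) for a nonscalar endomorphism M of S₁ that is self-adjoint for the trilinear form
of γ (`exists_selfAdjoint`). Subtracting an eigenvalue and using the Fitting decomposition, one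
obtains either an orthogonal splitting of S₁ or a nonzero self-adjoint N with N² = 0
(`split_or_squareZero`). A splitting 2+2 makes g a sum of two binary cubics; a splitting 1+3 makes
it a cube plus a ternary cubic; a square-zero N leads to a linear form b whose products with a
hyperplane containing b are all null (`IsTangentFrame`).

In suitable coordinates each case has one of two outcomes. In the first, N₂ consists of the quadrics
through a scheme of length four spanning the space. An algebra map to its coordinate ring shows that
N₂S_d has codimension 4, and the 21 products of six basis quadrics satisfy exactly two independent
relations: this gives 16, 19, 52. In the second, the six quadrics satisfy no quadratic relation,
S₁N₂ is the space of cubics killed by γ that vanish at one point, and N₂N₃ is the hyperplane of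
quintics vanishing at that point: this gives 18, 21, 55.

In both outcomes some first derivative of g is the square of a linear form (`IsRankOne`). This alone
gives N₂N₃ = N₂S₃ and the inclusion in degree 6. -/

open MvPolynomial

noncomputable section

/-! ### Submodules cut out by a linear functional -/

section Functional

variable {k A : Type*} [Field k] [CommRing A] [Algebra k A]

/-- The elements `q` of `V ^ 2` with `γ (v * q) = 0` for all `v ∈ V`. -/
def quadAnn (γ : A →ₗ[k] k) (V : Submodule k A) : Submodule k A where
  carrier := {q | q ∈ V ^ 2 ∧ ∀ v ∈ V, γ (v * q) = 0}
  add_mem' := fun ha hb => ⟨add_mem ha.1 hb.1, fun v hv => by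
    rw [mul_add, map_add, ha.2 v hv, hb.2 v hv, add_zero]⟩
  zero_mem' := ⟨zero_mem _, by simp⟩
  smul_mem' := fun c q hq => ⟨Submodule.smul_mem _ c hq.1, fun v hv => by
    rw [mul_smul_comm, map_smul, hq.2 v hv, smul_zero]⟩

theorem mem_quadAnn {γ : A →ₗ[k] k} {V : Submodule k A} {q : A} :
    q ∈ quadAnn γ V ↔ q ∈ V ^ 2 ∧ ∀ v ∈ V, γ (v * q) = 0 := Iff.rfl

/-- The trilinear form `γ (u * v * w)` on `V` is nondegenerate. -/
def NondegenerateOn (γ : A →ₗ[k] k) (V : Submodule k A) : Prop :=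
  ∀ v ∈ V, (∀ p ∈ V ^ 2, γ (v * p) = 0) → v = 0

theorem finrank_map_of_injective {M N : Type*} [AddCommGroup M] [Module k M] [AddCommGroup N]
    [Module k N] (f : M →ₗ[k] N) (hf : Function.Injective f) (p : Submodule k M) :
    Module.finrank k ↥(p.map f) = Module.finrank k p :=
  (LinearEquiv.finrank_eq (p.equivMapOfInjective f hf)).symm

/-- Inclusions between products of spaces of forms are proved dually below: a functional that kills
the larger side is computed and seen to kill the smaller one. -/
theorem le_of_forall_functional {U W : Submodule k A}
    (h : ∀ Λ : A →ₗ[k] k, (∀ w ∈ W, Λ w = 0) → ∀ u ∈ U, Λ u = 0) : U ≤ W := by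
  intro u hu
  by_contra hc
  obtain ⟨f, hf, hW⟩ := Submodule.exists_le_ker_of_notMem hc
  exact hf (h f (fun w hw => hW hw) u hu)

theorem functional_eq_zero_on_mul {U W : Submodule k A} {Λ : A →ₗ[k] k}
    (h : ∀ u ∈ U, ∀ w ∈ W, Λ (u * w) = 0) : ∀ x ∈ U * W, Λ x = 0 := by
  intro x hx
  have : U * W ≤ LinearMap.ker Λ := Submodule.mul_le.2 fun u hu w hw => h u hu w hw
  exact this hx

/-- The functionals `γ (u * ·)` on `V ^ 2`. -/
def contraction (γ : A →ₗ[k] k) (V : Submodule k A) : V →ₗ[k] Module.Dual k ↥(V ^ 2) where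
  toFun v := γ ∘ₗ LinearMap.mulLeft k (v : A) ∘ₗ (V ^ 2).subtype
  map_add' a b := by ext; simp [add_mul]
  map_smul' c a := by ext; simp

theorem contraction_apply (γ : A →ₗ[k] k) (V : Submodule k A) (v : V) (p : ↥(V ^ 2)) :
    contraction γ V v p = γ (v * p) := rfl

theorem contraction_injective {γ : A →ₗ[k] k} {V : Submodule k A} (h : NondegenerateOn γ V) :
    Function.Injective (contraction γ V) := by
  rw [injective_iff_map_eq_zero]
  intro v hv
  have := h v v.2 fun p hp => by
    have := LinearMap.congr_fun hv ⟨p, hp⟩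
    rwa [contraction_apply] at this
  exact Subtype.ext this

theorem quadAnn_eq_map_dualCoannihilator (γ : A →ₗ[k] k) (V : Submodule k A) :
    quadAnn γ V = (LinearMap.range (contraction γ V)).dualCoannihilator.map (V ^ 2).subtype := by
  ext q
  simp only [mem_quadAnn, Submodule.mem_map, Submodule.mem_dualCoannihilator]
  constructor
  · rintro ⟨h1, h2⟩
    refine ⟨⟨q, h1⟩, ?_, rfl⟩
    rintro _ ⟨v, rfl⟩
    exact h2 v v.2
  · rintro ⟨p, hp, rfl⟩
    exact ⟨p.2, fun v hv => hp _ ⟨⟨v, hv⟩, rfl⟩⟩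

theorem finrank_quadAnn {γ : A →ₗ[k] k} {V : Submodule k A} [FiniteDimensional k V]
    [FiniteDimensional k ↥(V ^ 2)] (h : NondegenerateOn γ V) :
    Module.finrank k (quadAnn γ V) + Module.finrank k V = Module.finrank k ↥(V ^ 2) := by
  rw [quadAnn_eq_map_dualCoannihilator, finrank_map_of_injective _
    (V ^ 2).subtype_injective, ← LinearMap.finrank_range_of_inj (contraction_injective h),
    add_comm]
  exact Subspace.finrank_add_finrank_dualCoannihilator_eq _

/-- A nonscalar endomorphism that is self-adjoint for the trilinear form of `γ` exists as soon as
`V * quadAnn γ V` has codimension at least two in `V ^ 3`. -/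
theorem exists_selfAdjoint {γ : A →ₗ[k] k} {V : Submodule k A} [FiniteDimensional k V]
    [FiniteDimensional k ↥(V ^ 2)] [FiniteDimensional k ↥(V ^ 3)] (h : NondegenerateOn γ V)
    (hV : Module.finrank k ↥(V * quadAnn γ V) + 2 ≤ Module.finrank k ↥(V ^ 3)) :
    ∃ M : V →ₗ[k] V, (∀ u v w : V, γ (M u * v * w) = γ (u * M v * w)) ∧
      ¬ ∃ c : k, ∀ u, M u = c • u := by
  have hle : V * quadAnn γ V ≤ V ^ 3 := by
    rw [pow_succ' V 2]
    exact mul_le_mul' le_rfl (show quadAnn γ V ≤ V ^ 2 from fun q hq => hq.1)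
  have : FiniteDimensional k ↥(V * quadAnn γ V) := Submodule.finiteDimensional_of_le hle
  obtain ⟨p0, hp0, hp0'⟩ : ∃ p ∈ V ^ 3, p ∉ V * quadAnn γ V := by
    by_contra! hc
    have := Submodule.finrank_mono (show V ^ 3 ≤ V * quadAnn γ V from hc)
    omega
  -- Codimension at least two: `p0` and `p1` are independent modulo `V * quadAnn γ V`.
  obtain ⟨p1, hp1, hp1'⟩ : ∃ p ∈ V ^ 3, p ∉ V * quadAnn γ V ⊔ Submodule.span k {p0} := by
    by_contra! hc
    have h1 := Submodule.finrank_mono (show V ^ 3 ≤ V * quadAnn γ V ⊔ Submodule.span k {p0} from hc)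
    have h2 := Submodule.finrank_add_le_finrank_add_finrank (V * quadAnn γ V)
      (Submodule.span k {p0})
    have h3 : Module.finrank k ↥(Submodule.span k {p0}) ≤ 1 := by simpa using finrank_span_le_card (R := k) ({p0} : Set A)
    omega
  -- If `γ p0 = 0`, then `f0` cannot be a multiple of `γ` because `f0 p0 ≠ 0`. Otherwise `f1 p0 = 0`
  -- forces the factor to be zero, against `f1 p1 ≠ 0`.
  obtain ⟨G, hG, hGc⟩ : ∃ G : A →ₗ[k] k, (∀ x ∈ V * quadAnn γ V, G x = 0) ∧
      ¬ ∃ c : k, ∀ x ∈ V ^ 3, G x = c * γ x := by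
    obtain ⟨f1, hf1, hW1⟩ := Submodule.exists_le_ker_of_notMem hp1'
    obtain ⟨f0, hf0, hW0⟩ := Submodule.exists_le_ker_of_notMem hp0'
    have e1 : f1 p0 = 0 := hW1 (Submodule.mem_sup_right (Submodule.mem_span_singleton_self _))
    by_cases hγ : γ p0 = 0
    · refine ⟨f0, fun x hx => hW0 hx, ?_⟩
      rintro ⟨c, hc⟩
      exact hf0 (by rw [hc p0 hp0, hγ, mul_zero])
    · refine ⟨f1, fun x hx => hW1 (Submodule.mem_sup_left hx), ?_⟩
      rintro ⟨c, hc⟩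
      have h0 := hc p0 hp0
      rw [e1] at h0
      have hc0 : c = 0 := by
        rcases mul_eq_zero.1 h0.symm with h | h
        · exact h
        · exact absurd h hγ
      exact hf1 (by rw [hc p1 hp1, hc0, zero_mul])
  -- Double annihilator: `quadAnn γ V` is the common kernel of the functionals `γ (v * ·)`, and `G
  -- (u * ·)` vanishes on it, hence is one of them.
  have hrange : LinearMap.range (contraction G V) ≤ LinearMap.range (contraction γ V) := by
    rw [← Subspace.dualCoannihilator_dualAnnihilator_eq (W := LinearMap.range (contraction γ V))]
    rintro _ ⟨v, rfl⟩
    rw [Submodule.mem_dualAnnihilator]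
    intro q hq
    have : (q : A) ∈ quadAnn γ V := by
      rw [quadAnn_eq_map_dualCoannihilator]; exact ⟨q, hq, rfl⟩
    exact hG _ (Submodule.mul_mem_mul v.2 this)
  let e := LinearEquiv.ofInjective _ (contraction_injective h)
  let M : V →ₗ[k] V := e.symm.toLinearMap ∘ₗ
    (contraction G V).codRestrict _ (fun v => hrange ⟨v, rfl⟩)
  have hM : ∀ u : V, ∀ p ∈ V ^ 2, γ (M u * p) = G (u * p) := by
    intro u p hp
    have h1 : e (M u) = (contraction G V).codRestrict _ (fun v => hrange ⟨v, rfl⟩) u :=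
      e.apply_symm_apply _
    have h2 := congrArg Subtype.val h1
    exact LinearMap.congr_fun h2 ⟨p, hp⟩
  have hmem : ∀ v w : V, (v * w : A) ∈ V ^ 2 := fun v w => by
    rw [pow_two]; exact Submodule.mul_mem_mul v.2 w.2
  -- Both sides equal `G (u * v * w)`, so self-adjointness is just commutativity of the product.
  refine ⟨M, fun u v w => ?_, ?_⟩
  · rw [mul_assoc, hM u _ (hmem v w), mul_assoc, mul_left_comm (u : A) (M v : A), hM v _ (hmem u w),
      mul_left_comm (v : A)]
  · rintro ⟨c, hc⟩
    refine hGc ⟨c, ?_⟩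
    have key : V * V ^ 2 ≤ LinearMap.ker (G - c • γ) := by
      refine Submodule.mul_le.2 fun u hu p hp => ?_
      have := hM ⟨u, hu⟩ p hp
      rw [hc] at this
      simp only [SetLike.val_smul, smul_mul_assoc, map_smul, smul_eq_mul] at this
      simp [← this]
    intro x hx
    rw [pow_succ' V 2] at hx
    have := key hx
    simpa [sub_eq_zero] using this

/-- A nonscalar self-adjoint endomorphism either splits `V` into two orthogonal pieces, or yields
a nonzero self-adjoint endomorphism of square zero. -/
theorem split_or_squareZero [IsAlgClosed k] {γ : A →ₗ[k] k} {V : Submodule k A}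
    [FiniteDimensional k V] (M : V →ₗ[k] V)
    (hM : ∀ u v w : V, γ (M u * v * w) = γ (u * M v * w)) (hM' : ¬ ∃ c : k, ∀ u, M u = c • u) :
    (∃ V₁ V₂ : Submodule k V, V₁ ≠ ⊥ ∧ V₂ ≠ ⊥ ∧ IsCompl V₁ V₂ ∧
      ∀ u ∈ V₁, ∀ v ∈ V₂, ∀ w : V, γ (u * v * w) = 0) ∨
    ∃ N : V →ₗ[k] V, N ≠ 0 ∧ (∀ u, N (N u) = 0) ∧
      ∀ u v w : V, γ (N u * v * w) = γ (u * N v * w) := by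
  have hnt : Nontrivial V := by
    by_contra hc
    rw [not_nontrivial_iff_subsingleton] at hc
    exact hM' ⟨0, fun u => Subsingleton.elim _ _⟩
  obtain ⟨c, hc⟩ := Module.End.exists_eigenvalue (K := k) M
  -- Not injective because `c` is an eigenvalue, not zero because `M` is not scalar.
  let N : Module.End k V := M - algebraMap k _ c
  have hNapp : ∀ u, N u = M u - c • u := fun u => by simp [N, Module.algebraMap_end_apply]
  have hN : ∀ u v w : V, γ (N u * v * w) = γ (u * N v * w) := by
    intro u v w
    simp only [hNapp, AddSubgroupClass.coe_sub, SetLike.val_smul, sub_mul, mul_sub, map_sub,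
      hM u v w, smul_mul_assoc, mul_smul_comm]
  have hNpow : ∀ n, ∀ u v w : V, γ ((N ^ n) u * v * w) = γ (u * (N ^ n) v * w) := by
    intro n
    induction n with
    | zero => intro u v w; rfl
    | succ n ih =>
      intro u v w
      rw [pow_succ', Module.End.mul_apply, hN, ih, ← Module.End.mul_apply, ← pow_succ, pow_succ']
  obtain ⟨x, hx⟩ := hc.exists_hasEigenvector
  have hxN : N x = 0 := by rw [hNapp, hx.apply_eq_smul, sub_self]
  have hx0 : x ≠ 0 := hx.2
  have hN0 : N ≠ 0 := fun h0 => hM' ⟨c, fun u => by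
    have := hNapp u
    rw [h0, LinearMap.zero_apply] at this
    exact (sub_eq_zero.1 this.symm)⟩
  by_cases hnil : ∃ n, N ^ n = 0
  · right
    classical
    let n := Nat.find hnil
    have hn : N ^ n = 0 := Nat.find_spec hnil
    have hn' : ∀ m < n, N ^ m ≠ 0 := fun m hm => Nat.find_min hnil hm
    have h2 : 2 ≤ n := by
      by_contra hlt
      have : n = 0 ∨ n = 1 := by omega
      rcases this with h | h
      · rw [h, pow_zero] at hn; exact one_ne_zero hn
      · rw [h, pow_one] at hn; exact hN0 hn
    -- The last nonzero power squares to zero since 2(n − 1) ≥ n for n ≥ 2.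
    refine ⟨N ^ (n - 1), hn' _ (by omega), fun u => ?_, hNpow _⟩
    rw [← Module.End.mul_apply, ← pow_add, show n - 1 + (n - 1) = n + (n - 2) by omega, pow_add, hn,
      zero_mul, LinearMap.zero_apply]
  · left
    push Not at hnil
    -- Fitting decomposition. The exponent `n + 1` is positive, so the eigenvector lies in the
    -- kernel; the range is nonzero because `N` is not nilpotent.
    obtain ⟨n, hn⟩ := Filter.eventually_atTop.1 (LinearMap.eventually_isCompl_ker_pow_range_pow N)
    refine ⟨_, _, ?_, ?_, hn (n + 1) (by omega), ?_⟩
    · intro hbot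
      refine hx0 ((Submodule.mem_bot k).1 (hbot ▸ ?_))
      rw [LinearMap.mem_ker, pow_succ, Module.End.mul_apply, hxN, map_zero]
    · exact fun hb => hnil _ (LinearMap.range_eq_bot.1 hb)
    · rintro u hu _ ⟨v, rfl⟩ w
      rw [← hNpow, LinearMap.mem_ker.1 hu]
      simp

end Functional

/-! ### Forms in four variables -/

section Forms

/-- Quaternary forms of degree `d`. -/
abbrev forms (k : Type*) [Field k] (d : ℕ) : Submodule k (MvPolynomial (Fin 4) k) :=
  homogeneousSubmodule (Fin 4) k d

/-- The span of the variables indexed by `s`. -/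
def varSpan (k : Type*) [Field k] (s : Finset (Fin 4)) : Submodule k (MvPolynomial (Fin 4) k) :=
  Submodule.span k (X '' (s : Set (Fin 4)))

variable {k : Type*} [Field k]

theorem finrank_span_monomial (A : Finset (Fin 4 →₀ ℕ)) :
    Module.finrank k ↥(Submodule.span k
      ((fun e => monomial e (1 : k)) '' (A : Set (Fin 4 →₀ ℕ)))) = A.card := by
  have h : LinearIndependent k (fun e : A => monomial (e : Fin 4 →₀ ℕ) (1 : k)) := by
    have := (basisMonomials (Fin 4) k).linearIndependent
    rw [coe_basisMonomials] at this
    exact this.comp _ Subtype.val_injective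
  have hr : Set.range (fun e : A => monomial (e : Fin 4 →₀ ℕ) (1 : k)) =
      (fun e => monomial e (1 : k)) '' (A : Set (Fin 4 →₀ ℕ)) := by
    ext x
    simp
  rw [← hr, finrank_span_eq_card h, Fintype.card_coe]

/-- All dimensions of full spaces of forms, in four, three or two variables, come from this monomial
basis. -/
theorem varSpan_pow (s : Finset (Fin 4)) (d : ℕ) :
    varSpan k s ^ d = Submodule.span k
      ((fun e => monomial e (1 : k)) '' (s.finsuppAntidiag d : Set (Fin 4 →₀ ℕ))) := by
  classical
  induction d with
  | zero =>
    rw [pow_zero, Submodule.one_eq_span]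
    congr 1
    ext x
    simp [Finset.finsuppAntidiag_zero]
  | succ d ih =>
    rw [pow_succ', ih, varSpan, Submodule.span_mul_span]
    congr 1
    ext x
    simp only [Set.mem_mul, Set.mem_image, Finset.mem_coe, Finset.mem_finsuppAntidiag]
    constructor
    · rintro ⟨_, ⟨i, hi, rfl⟩, _, ⟨e, ⟨h1, h2⟩, rfl⟩, rfl⟩
      refine ⟨Finsupp.single i 1 + e, ⟨?_, ?_⟩, ?_⟩
      · simp only [Finsupp.coe_add, Pi.add_apply, Finset.sum_add_distrib, h1]
        rw [Finset.sum_eq_single i]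
        · simp [add_comm]
        · intro j _ hj; simp [Finsupp.single_eq_of_ne hj]
        · intro h; exact absurd hi h
      · refine Finsupp.support_add.trans (Finset.union_subset ?_ h2)
        exact Finsupp.support_single_subset.trans (by simpa using hi)
      · rw [X, monomial_mul, one_mul]
    · rintro ⟨e, ⟨h1, h2⟩, rfl⟩
      obtain ⟨i, hi, hei⟩ : ∃ i ∈ s, e i ≠ 0 := by
        by_contra! hc
        rw [Finset.sum_eq_zero hc] at h1
        omega
      have hle : Finsupp.single i 1 ≤ e := by
        rw [Finsupp.single_le_iff]; omega
      refine ⟨X i, ⟨i, hi, rfl⟩, _, ⟨e - Finsupp.single i 1, ⟨?_, ?_⟩, rfl⟩, ?_⟩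
      · have hsum : ∑ j ∈ s, (Finsupp.single i 1 : Fin 4 →₀ ℕ) j = 1 := by
          rw [Finset.sum_eq_single i]
          · simp
          · intro j _ hj; simp [Finsupp.single_eq_of_ne hj]
          · intro h; exact absurd hi h
        have hadd : ∑ j ∈ s, e j = ∑ j ∈ s, (e - Finsupp.single i 1 : Fin 4 →₀ ℕ) j +
            ∑ j ∈ s, (Finsupp.single i 1 : Fin 4 →₀ ℕ) j := by
          rw [← Finset.sum_add_distrib]
          exact Finset.sum_congr rfl fun j _ => by
            rw [← Finsupp.add_apply, tsub_add_cancel_of_le hle]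
        rw [hsum, h1] at hadd
        exact (Nat.succ_injective hadd).symm
      · exact Finsupp.support_tsub.trans h2
      · rw [X, monomial_mul, one_mul, add_tsub_cancel_of_le hle]

theorem finrank_varSpan_pow (s : Finset (Fin 4)) (d : ℕ) :
    Module.finrank k ↥(varSpan k s ^ d) = (s.card + d - 1).choose d := by
  rw [varSpan_pow, finrank_span_monomial, Finset.card_finsuppAntidiag_nat_eq_choose]

theorem finrank_varSpan (s : Finset (Fin 4)) :
    Module.finrank k ↥(varSpan k s) = s.card := by
  have := finrank_varSpan_pow (k := k) s 1
  rwa [pow_one, Nat.choose_one_right, Nat.add_sub_cancel] at this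

theorem forms_one_pow (n : ℕ) : forms k 1 ^ n = forms k n :=
  homogeneousSubmodule_one_pow _ n

theorem forms_one_eq_span : forms k 1 = Submodule.span k (Set.range X) :=
  homogeneousSubmodule_one_eq_span_X

theorem varSpan_univ : varSpan k Finset.univ = forms k 1 := by
  rw [forms_one_eq_span, varSpan, Finset.coe_univ, Set.image_univ]

theorem finrank_forms (d : ℕ) : Module.finrank k (forms k d) = (3 + d).choose d := by
  rw [← forms_one_pow, ← varSpan_univ, finrank_varSpan_pow, Finset.card_univ,
    Fintype.card_fin]
  congr 1
  omega

instance finiteDimensional_forms (d : ℕ) : FiniteDimensional k (forms k d) :=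
  Module.Finite.iff_fg.2 (homogeneousSubmodule_fg (Fin 4) k d)

theorem forms_mul (a b : ℕ) : forms k a * forms k b = forms k (a + b) := by
  rw [← forms_one_pow a, ← forms_one_pow b, ← pow_add, forms_one_pow]

theorem finiteDimensional_of_le_forms {W : Submodule k (MvPolynomial (Fin 4) k)} {d : ℕ}
    (h : W ≤ forms k d) : FiniteDimensional k W :=
  Submodule.finiteDimensional_of_le h

theorem X_mem_forms (i : Fin 4) : (X i : MvPolynomial (Fin 4) k) ∈ forms k 1 :=
  isHomogeneous_X k i

/-- The quadrics `q` with `γ (v * q) = 0` for all linear forms `v`. -/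
def nullQuadrics (γ : MvPolynomial (Fin 4) k →ₗ[k] k) : Submodule k (MvPolynomial (Fin 4) k) :=
  quadAnn γ (forms k 1)

theorem mem_nullQuadrics {γ : MvPolynomial (Fin 4) k →ₗ[k] k} {q : MvPolynomial (Fin 4) k} :
    q ∈ nullQuadrics γ ↔ q ∈ forms k 2 ∧ ∀ v ∈ forms k 1, γ (v * q) = 0 := by
  rw [nullQuadrics, mem_quadAnn, forms_one_pow]

/-- The cubics annihilated by `γ`. -/
def nullCubics (γ : MvPolynomial (Fin 4) k →ₗ[k] k) : Submodule k (MvPolynomial (Fin 4) k) :=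
  forms k 3 ⊓ LinearMap.ker γ

theorem nullQuadrics_le (γ : MvPolynomial (Fin 4) k →ₗ[k] k) : nullQuadrics γ ≤ forms k 2 :=
  fun _ hq => (mem_nullQuadrics.1 hq).1

theorem nullCubics_le (γ : MvPolynomial (Fin 4) k →ₗ[k] k) : nullCubics γ ≤ forms k 3 :=
  inf_le_left

theorem forms_one_mul_nullQuadrics_le (γ : MvPolynomial (Fin 4) k →ₗ[k] k) :
    forms k 1 * nullQuadrics γ ≤ nullCubics γ := by
  refine Submodule.mul_le.2 fun v hv q hq => ⟨?_, (mem_nullQuadrics.1 hq).2 v hv⟩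
  have := Submodule.mul_mem_mul hv (mem_nullQuadrics.1 hq).1
  rwa [forms_mul] at this

theorem finrank_nullQuadrics {γ : MvPolynomial (Fin 4) k →ₗ[k] k}
    (h : NondegenerateOn γ (forms k 1)) : Module.finrank k (nullQuadrics γ) = 6 := by
  have : FiniteDimensional k ↥(forms k 1 ^ 2) := by
    rw [forms_one_pow]; infer_instance
  have := finrank_quadAnn h
  rw [forms_one_pow, finrank_forms, finrank_forms] at this
  have e : (3 + 2).choose 2 = 10 := by decide
  have e' : (3 + 1).choose 1 = 4 := by decide
  rw [nullQuadrics]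
  omega

/-- The dimensions that determine the Hilbert function of the square of the apolar ideal. -/
def HasExpectedDimensions (γ : MvPolynomial (Fin 4) k →ₗ[k] k) : Prop :=
  (Module.finrank k ↥(forms k 1 * nullQuadrics γ) = 18 ∧
      Module.finrank k ↥(nullQuadrics γ * nullQuadrics γ) = 21 ∧
      Module.finrank k ↥(nullQuadrics γ * nullCubics γ) = 55 ∨
    Module.finrank k ↥(forms k 1 * nullQuadrics γ) = 16 ∧
      Module.finrank k ↥(nullQuadrics γ * nullQuadrics γ) = 19 ∧
      Module.finrank k ↥(nullQuadrics γ * nullCubics γ) = 52) ∧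
  forms k 6 ≤ nullCubics γ * nullCubics γ ⊔ nullQuadrics γ * forms k 4

/-! ### Linear changes of coordinates -/

/-- `a, b, c, d` is a basis of the space of linear forms. -/
def IsFrame (a b c d : MvPolynomial (Fin 4) k) : Prop :=
  Submodule.span k {a, b, c, d} = forms k 1

theorem mem_span_four {a b c d x : MvPolynomial (Fin 4) k} (p q r s : k)
    (h : x = p • a + q • b + r • c + s • d) : x ∈ Submodule.span k {a, b, c, d} := by
  subst h
  refine add_mem (add_mem (add_mem ?_ ?_) ?_) ?_ <;>
    exact Submodule.smul_mem _ _ (Submodule.subset_span (by simp))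

theorem IsFrame.mem {a b c d : MvPolynomial (Fin 4) k} (h : IsFrame a b c d) :
    a ∈ forms k 1 ∧ b ∈ forms k 1 ∧ c ∈ forms k 1 ∧ d ∈ forms k 1 := by
  rw [IsFrame] at h
  rw [← h]
  refine ⟨?_, ?_, ?_, ?_⟩ <;> exact Submodule.subset_span (by simp)

theorem IsFrame.of_mem {a b c d a' b' c' d' : MvPolynomial (Fin 4) k} (h : IsFrame a b c d)
    (h1 : a' ∈ forms k 1) (h2 : b' ∈ forms k 1) (h3 : c' ∈ forms k 1) (h4 : d' ∈ forms k 1)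
    (h1' : a ∈ Submodule.span k {a', b', c', d'}) (h2' : b ∈ Submodule.span k {a', b', c', d'})
    (h3' : c ∈ Submodule.span k {a', b', c', d'}) (h4' : d ∈ Submodule.span k {a', b', c', d'}) :
    IsFrame a' b' c' d' := by
  refine le_antisymm (Submodule.span_le.2 ?_) ?_
  · rintro x (rfl | rfl | rfl | rfl) <;> assumption
  · rw [← (show _ = _ from h)]
    refine Submodule.span_le.2 ?_
    rintro x (rfl | rfl | rfl | rfl) <;> assumption

theorem isFrame_X : IsFrame (X 0 : MvPolynomial (Fin 4) k) (X 1) (X 2) (X 3) := by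
  rw [IsFrame, forms_one_eq_span]
  congr 1
  ext x
  simp [Fin.exists_fin_succ, eq_comm]

theorem IsFrame.linearIndependent {a b c d : MvPolynomial (Fin 4) k} (h : IsFrame a b c d) :
    LinearIndependent k ![a, b, c, d] := by
  rw [linearIndependent_iff_card_le_finrank_span, Set.finrank]
  have : Set.range ![a, b, c, d] = {a, b, c, d} := by
    simp only [Matrix.range_cons, Matrix.range_empty, Set.union_empty, Set.singleton_union]
  rw [this, show Submodule.span k {a, b, c, d} = forms k 1 from h, finrank_forms]
  simp

/-- The substitution `X i ↦ i`-th member of a frame. -/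
def frameHom (a b c d : MvPolynomial (Fin 4) k) :
    MvPolynomial (Fin 4) k →ₐ[k] MvPolynomial (Fin 4) k :=
  aeval ![a, b, c, d]

theorem IsFrame.map_forms {a b c d : MvPolynomial (Fin 4) k} (h : IsFrame a b c d) (n : ℕ) :
    (forms k n).map (frameHom a b c d).toLinearMap = forms k n := by
  rw [← forms_one_pow, Submodule.map_pow]
  congr 1
  rw [← (show Submodule.span k {X 0, X 1, X 2, X 3} = forms k 1 from isFrame_X),
    Submodule.map_span, isFrame_X, ← (show Submodule.span k {a, b, c, d} = forms k 1 from h)]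
  congr 1
  simp [Set.image_insert_eq, frameHom]

/-- The kernels of the iterates stabilise, say at n. If f(x) = 0 and x = fⁿ(y), then y ∈ ker fⁿ⁺¹ =
ker fⁿ, so x = 0. Frame substitutions thus become automorphisms without inverting a matrix. -/
theorem injective_of_surjective_algHom {A : Type*} [CommRing A] [Algebra k A] [IsNoetherianRing A]
    (f : A →ₐ[k] A) (hf : Function.Surjective f) : Function.Injective f := by
  let K : ℕ →o Ideal A :=
    ⟨fun n => RingHom.ker (f ^ n), monotone_nat_of_le_succ fun n x hx => by
      rw [RingHom.mem_ker] at hx ⊢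
      rw [pow_succ', AlgHom.mul_apply, hx, map_zero]⟩
  obtain ⟨n, hn⟩ := monotone_stabilizes_iff_noetherian.2 ‹IsNoetherianRing A› K
  rw [injective_iff_map_eq_zero]
  intro x hx
  have hs : ∀ m, Function.Surjective (f ^ m : A →ₐ[k] A) := by
    intro m
    induction m with
    | zero => exact fun y => ⟨y, rfl⟩
    | succ m ih =>
      intro y
      obtain ⟨z, rfl⟩ := hf y
      obtain ⟨w, rfl⟩ := ih z
      exact ⟨w, by rw [pow_succ', AlgHom.mul_apply]⟩
  obtain ⟨y, rfl⟩ := hs n x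
  have hy : y ∈ K (n + 1) := by
    change y ∈ RingHom.ker (f ^ (n + 1))
    rw [RingHom.mem_ker, pow_succ', AlgHom.mul_apply, hx]
  rw [← hn (n + 1) (Nat.le_succ n)] at hy
  exact hy

theorem IsFrame.injective {a b c d : MvPolynomial (Fin 4) k} (h : IsFrame a b c d) :
    Function.Injective (frameHom a b c d) := by
  have hlin : ∀ i, ∃ y, frameHom a b c d y = X i := by
    intro i
    have : (X i : MvPolynomial (Fin 4) k) ∈ forms k 1 := X_mem_forms i
    rw [← h.map_forms 1] at this
    obtain ⟨y, -, hy⟩ := this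
    exact ⟨y, hy⟩
  choose y hy' using hlin
  have h1 : (frameHom a b c d).comp (aeval y) = AlgHom.id k _ :=
    algHom_ext fun i => by rw [AlgHom.comp_apply, aeval_X, hy']; rfl
  exact injective_of_surjective_algHom (frameHom a b c d) fun p => ⟨aeval y p, AlgHom.congr_fun h1 p⟩

theorem IsFrame.mem_iff {a b c d : MvPolynomial (Fin 4) k} (h : IsFrame a b c d) (n : ℕ)
    (p : MvPolynomial (Fin 4) k) : frameHom a b c d p ∈ forms k n ↔ p ∈ forms k n := by
  constructor
  · intro hp
    rw [← h.map_forms n] at hp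
    obtain ⟨q, hq, hqp⟩ := hp
    rwa [← h.injective hqp]
  · intro hp
    rw [← h.map_forms n]
    exact ⟨p, hp, rfl⟩

theorem IsFrame.map_nullQuadrics {a b c d : MvPolynomial (Fin 4) k} (h : IsFrame a b c d)
    (γ : MvPolynomial (Fin 4) k →ₗ[k] k) :
    (nullQuadrics (γ ∘ₗ (frameHom a b c d).toLinearMap)).map (frameHom a b c d).toLinearMap =
      nullQuadrics γ := by
  ext q
  rw [Submodule.mem_map]
  constructor
  · rintro ⟨p, hp, rfl⟩
    rw [mem_nullQuadrics] at hp ⊢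
    refine ⟨(h.mem_iff 2 p).2 hp.1, fun v hv => ?_⟩
    rw [← h.map_forms 1] at hv
    obtain ⟨u, hu, rfl⟩ := hv
    have := hp.2 u hu
    simpa using this
  · intro hq
    rw [mem_nullQuadrics] at hq
    obtain ⟨hq1, hq2⟩ := hq
    rw [← h.map_forms 2] at hq1
    obtain ⟨p, hp, rfl⟩ := hq1
    refine ⟨p, mem_nullQuadrics.2 ⟨hp, fun v hv => ?_⟩, rfl⟩
    have := hq2 _ ((h.mem_iff 1 v).2 hv)
    simpa using this

theorem IsFrame.mem_nullQuadrics_comp {a b c d : MvPolynomial (Fin 4) k} (h : IsFrame a b c d)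
    (γ : MvPolynomial (Fin 4) k →ₗ[k] k) {q : MvPolynomial (Fin 4) k}
    (hq : frameHom a b c d q ∈ nullQuadrics γ) :
    q ∈ nullQuadrics (γ ∘ₗ (frameHom a b c d).toLinearMap) := by
  rw [← h.map_nullQuadrics γ] at hq
  obtain ⟨p, hp, hpq⟩ := hq
  rwa [← h.injective hpq]

theorem IsFrame.map_nullCubics {a b c d : MvPolynomial (Fin 4) k} (h : IsFrame a b c d)
    (γ : MvPolynomial (Fin 4) k →ₗ[k] k) :
    (nullCubics (γ ∘ₗ (frameHom a b c d).toLinearMap)).map (frameHom a b c d).toLinearMap =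
      nullCubics γ := by
  ext q
  rw [Submodule.mem_map]
  constructor
  · rintro ⟨p, hp, rfl⟩
    exact ⟨(h.mem_iff 3 p).2 hp.1, hp.2⟩
  · rintro ⟨hq1, hq2⟩
    have hq1' : q ∈ forms k 3 := hq1
    rw [← h.map_forms 3] at hq1'
    obtain ⟨p, hp, rfl⟩ := hq1'
    exact ⟨p, ⟨hp, hq2⟩, rfl⟩

theorem IsFrame.nondegenerateOn_comp {a b c d : MvPolynomial (Fin 4) k} (h : IsFrame a b c d)
    {γ : MvPolynomial (Fin 4) k →ₗ[k] k} (hγ : NondegenerateOn γ (forms k 1)) :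
    NondegenerateOn (γ ∘ₗ (frameHom a b c d).toLinearMap) (forms k 1) := by
  intro v hv hv'
  refine h.injective ?_
  rw [map_zero]
  refine hγ _ ((h.mem_iff 1 v).2 hv) fun p hp => ?_
  rw [forms_one_pow] at hp hv'
  rw [← h.map_forms 2] at hp
  obtain ⟨p, hp, rfl⟩ := hp
  have := hv' p hp
  simpa using this

theorem IsFrame.finrank_map {a b c d : MvPolynomial (Fin 4) k} (h : IsFrame a b c d)
    (W : Submodule k (MvPolynomial (Fin 4) k)) :
    Module.finrank k ↥(W.map (frameHom a b c d).toLinearMap) = Module.finrank k W :=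
  finrank_map_of_injective (frameHom a b c d).toLinearMap h.injective W

theorem IsFrame.finrank_forms_mul_nullQuadrics {a b c d : MvPolynomial (Fin 4) k}
    (h : IsFrame a b c d) (γ : MvPolynomial (Fin 4) k →ₗ[k] k) :
    Module.finrank k ↥(forms k 1 * nullQuadrics (γ ∘ₗ (frameHom a b c d).toLinearMap)) =
      Module.finrank k ↥(forms k 1 * nullQuadrics γ) := by
  rw [← h.finrank_map, Submodule.map_mul, h.map_nullQuadrics, h.map_forms]

/-- The substitution is an automorphism that carries null quadrics and null cubics of the pulled
back functional to those of `γ`. Every case may therefore be checked in coordinates adapted to `γ`.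
-/
theorem IsFrame.hasExpectedDimensions {a b c d : MvPolynomial (Fin 4) k} (h : IsFrame a b c d)
    {γ : MvPolynomial (Fin 4) k →ₗ[k] k}
    (hγ : HasExpectedDimensions (γ ∘ₗ (frameHom a b c d).toLinearMap)) :
    HasExpectedDimensions γ := by
  obtain ⟨h1, h2⟩ := hγ
  rw [h.finrank_forms_mul_nullQuadrics, ← h.finrank_map (nullQuadrics _ * nullQuadrics _),
    ← h.finrank_map (nullQuadrics _ * nullCubics _), Submodule.map_mul, Submodule.map_mul, h.map_nullQuadrics, h.map_nullCubics] at h1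
  refine ⟨h1, ?_⟩
  have := Submodule.map_mono (f := (frameHom a b c d).toLinearMap) h2
  rwa [Submodule.map_sup, Submodule.map_mul, Submodule.map_mul, h.map_nullQuadrics,
    h.map_nullCubics, h.map_forms, h.map_forms] at this

end Forms

/-! ### Functionals for which γ(a·) is a multiple of evaluation at a point -/

section RankOne

variable {k : Type*} [Field k]

/-- Evaluation at the point `(1, 0, 0, 0)`. -/
def evalFirst (k : Type*) [Field k] : MvPolynomial (Fin 4) k →ₐ[k] k := aeval ![1, 0, 0, 0]

/-- The span of the last three variables. -/
abbrev lastVars (k : Type*) [Field k] : Submodule k (MvPolynomial (Fin 4) k) :=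
  varSpan k {1, 2, 3}

theorem evalFirst_X_zero : evalFirst k (X 0) = 1 := by simp [evalFirst]

theorem evalFirst_X_one : evalFirst k (X 1) = 0 := by simp [evalFirst]

theorem evalFirst_X_of_ne {i : Fin 4} (hi : i ≠ 0) : evalFirst k (X i) = 0 := by
  fin_cases i <;> simp [evalFirst] at hi ⊢

theorem X_mem_lastVars {i : Fin 4} (hi : i ≠ 0) : (X i : MvPolynomial (Fin 4) k) ∈ lastVars k := by
  refine Submodule.subset_span ⟨i, ?_, rfl⟩
  fin_cases i <;> simp at hi ⊢

theorem lastVars_le : lastVars k ≤ forms k 1 := by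
  refine Submodule.span_le.2 ?_
  rintro _ ⟨i, -, rfl⟩
  exact X_mem_forms i

theorem lastVars_induction {P : MvPolynomial (Fin 4) k → Prop} (h0 : P 0)
    (hX : ∀ i, i ≠ 0 → P (X i)) (hadd : ∀ x y, P x → P y → P (x + y))
    (hs : ∀ (c : k) x, P x → P (c • x)) {v : MvPolynomial (Fin 4) k} (hv : v ∈ lastVars k) :
    P v := by
  induction hv using Submodule.span_induction with
  | mem x hx =>
    obtain ⟨i, hi, rfl⟩ := hx
    refine hX i ?_
    rintro rfl
    simp at hi
  | zero => exact h0
  | add x y _ _ hx hy => exact hadd x y hx hy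
  | smul c x _ hx => exact hs c x hx

theorem evalFirst_eq_zero_of_mem_lastVars {v : MvPolynomial (Fin 4) k} (hv : v ∈ lastVars k) :
    evalFirst k v = 0 :=
  lastVars_induction (P := fun v => evalFirst k v = 0) (map_zero _)
    (fun _ hi => evalFirst_X_of_ne hi) (fun x y hx hy => by rw [map_add, hx, hy, add_zero])
    (fun c x hx => by rw [map_smul, hx, smul_zero]) hv

theorem mul_mem_forms {a b : ℕ} {p q : MvPolynomial (Fin 4) k} (hp : p ∈ forms k a)
    (hq : q ∈ forms k b) : p * q ∈ forms k (a + b) := by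
  rw [← forms_mul]; exact Submodule.mul_mem_mul hp hq

theorem X_pow_mem_forms (i : Fin 4) (n : ℕ) : (X i ^ n : MvPolynomial (Fin 4) k) ∈ forms k n := by
  rw [← forms_one_pow]; exact Submodule.pow_mem_pow _ (X_mem_forms i) n

/-- Together with `evalFirst_eq_zero_of_mem` this identifies the forms vanishing at (1,0,0,0) with
the products `lastVars k * forms k d`, the shape in which functionals can be evaluated on them. -/
theorem sub_evalFirst_mem (d : ℕ) {p : MvPolynomial (Fin 4) k} (hp : p ∈ forms k (d + 1)) :
    p - evalFirst k p • X 0 ^ (d + 1) ∈ lastVars k * forms k d := by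
  induction d generalizing p with
  | zero =>
    rw [show forms k 0 = 1 from homogeneousSubmodule_zero _, mul_one]
    rw [zero_add, forms_one_eq_span] at hp
    induction hp using Submodule.span_induction with
    | mem x hx =>
      obtain ⟨i, rfl⟩ := hx
      by_cases hi : i = 0
      · subst hi; simp [evalFirst_X_zero]
      · simpa [evalFirst_X_of_ne hi] using X_mem_lastVars hi
    | zero => simp
    | add x y _ _ hx hy =>
      rw [map_add, add_smul, add_sub_add_comm]; exact add_mem hx hy
    | smul c x _ hx =>
      rw [map_smul, smul_assoc, ← smul_sub]; exact Submodule.smul_mem _ _ hx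
  | succ d ih =>
    rw [show d + 1 + 1 = 1 + (d + 1) by ring, ← forms_mul] at hp
    induction hp using Submodule.mul_induction_on' with
    | mem_mul_mem v hv q hq =>
      have hv' : v - evalFirst k v • X 0 ∈ lastVars k := by
        rw [← varSpan_univ] at hv
        induction hv using Submodule.span_induction with
        | mem x hx =>
          obtain ⟨i, -, rfl⟩ := hx
          by_cases hi : i = 0
          · subst hi; simp [evalFirst_X_zero]
          · simpa [evalFirst_X_of_ne hi] using X_mem_lastVars hi
        | zero => simp
        | add x y _ _ hx hy =>
          rw [map_add, add_smul, add_sub_add_comm]; exact add_mem hx hy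
        | smul c x _ hx =>
          rw [map_smul, smul_assoc, ← smul_sub]; exact Submodule.smul_mem _ _ hx
      have h1 := Submodule.mul_mem_mul hv' hq
      have h2 := Submodule.mul_mem_mul (ih hq) (X_mem_forms (k := k) 0)
      rw [mul_assoc, forms_mul] at h2
      have h3 := add_mem h1 (Submodule.smul_mem _ (evalFirst k v) h2)
      convert h3 using 1
      rw [map_mul]
      simp only [smul_eq_C_mul, map_mul]
      ring
    | add x _ y _ hx hy =>
      rw [map_add, add_smul, add_sub_add_comm]; exact add_mem hx hy

theorem evalFirst_eq_zero_of_mem {d : ℕ} {p : MvPolynomial (Fin 4) k}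
    (hp : p ∈ lastVars k * forms k d) : evalFirst k p = 0 :=
  functional_eq_zero_on_mul (Λ := (evalFirst k).toLinearMap)
    (fun u hu w _ => by
      rw [AlgHom.toLinearMap_apply, map_mul, evalFirst_eq_zero_of_mem_lastVars hu, zero_mul]) p hp

theorem mem_lastVars_mul_forms {d : ℕ} {p : MvPolynomial (Fin 4) k} (hp : p ∈ forms k (d + 1))
    (h : evalFirst k p = 0) : p ∈ lastVars k * forms k d := by
  have := sub_evalFirst_mem d hp
  rwa [h, zero_smul, sub_zero] at this

theorem lastVars_mul_forms_le (d : ℕ) : lastVars k * forms k d ≤ forms k (d + 1) := by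
  rw [add_comm, ← forms_mul]
  exact mul_le_mul' lastVars_le le_rfl

theorem finrank_lastVars_mul_forms (d : ℕ) :
    Module.finrank k ↥(lastVars k * forms k d) + 1 = (3 + (d + 1)).choose (d + 1) := by
  let f : forms k (d + 1) →ₗ[k] k := (evalFirst k).toLinearMap ∘ₗ (forms k (d + 1)).subtype
  have hf : Function.Surjective f := by
    intro c
    refine ⟨⟨c • X 0 ^ (d + 1), Submodule.smul_mem _ _ (X_pow_mem_forms 0 _)⟩, ?_⟩
    simp [f, evalFirst_X_zero]
  have h1 := LinearMap.finrank_range_add_finrank_ker f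
  rw [LinearMap.range_eq_top.2 hf, finrank_top, Module.finrank_self, finrank_forms] at h1
  have h2 : (LinearMap.ker f).map (forms k (d + 1)).subtype = lastVars k * forms k d := by
    ext p
    constructor
    · rintro ⟨q, hq, rfl⟩
      exact mem_lastVars_mul_forms q.2 hq
    · intro hp
      exact ⟨⟨p, lastVars_mul_forms_le d hp⟩, evalFirst_eq_zero_of_mem hp, rfl⟩
  rw [← h2, finrank_map_of_injective _ (Submodule.subtype_injective _)]
  omega

theorem X_ne_smul_X {i j : Fin 4} (h : i ≠ j) (c : k) :
    (X i : MvPolynomial (Fin 4) k) ≠ c • X j := by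
  intro he
  have := congrArg (coeff (Finsupp.single i 1)) he
  rw [coeff_X, coeff_smul, coeff_X, if_pos rfl, if_neg] at this
  · simp at this
  · intro hs
    exact h (Finsupp.single_left_injective one_ne_zero hs).symm

/-- `a` is one of the first two variables, and `γ (a * v * w)` only depends on the first
coefficients of `v` and `w`. -/
structure IsRankOne (γ : MvPolynomial (Fin 4) k →ₗ[k] k) (a : MvPolynomial (Fin 4) k) : Prop where
  eq_X : a = X 0 ∨ a = X 1
  nondeg : NondegenerateOn γ (forms k 1)
  mem : ∀ i, i ≠ 0 → a * X i ∈ nullQuadrics γ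

namespace IsRankOne

variable {γ : MvPolynomial (Fin 4) k →ₗ[k] k} {a : MvPolynomial (Fin 4) k}

/-- A source of contradictions: by nondegeneracy proportional contractions come from proportional
linear forms, and `X_ne_smul_X` excludes these for distinct variables. -/
theorem eq_of_forall (h : IsRankOne γ a) {u v : MvPolynomial (Fin 4) k} (hu : u ∈ forms k 1)
    (hv : v ∈ forms k 1) (c : k) (H : ∀ p ∈ forms k 2, γ (u * p) = c * γ (v * p)) : u = c • v := by
  rw [← sub_eq_zero]
  refine h.nondeg _ (sub_mem hu (Submodule.smul_mem _ _ hv)) fun p hp => ?_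
  rw [forms_one_pow] at hp
  rw [sub_mul, map_sub, H p hp, smul_mul_assoc, map_smul, smul_eq_mul, sub_self]

theorem mem_forms (h : IsRankOne γ a) : a ∈ forms k 1 := by
  rcases h.eq_X with rfl | rfl <;> exact X_mem_forms _

theorem mul_mem (h : IsRankOne γ a) {v : MvPolynomial (Fin 4) k} (hv : v ∈ lastVars k) :
    a * v ∈ nullQuadrics γ :=
  lastVars_induction (P := fun v => a * v ∈ nullQuadrics γ) (by simp) h.mem
    (fun x y hx hy => by rw [mul_add]; exact add_mem hx hy)
    (fun c x hx => by rw [mul_smul_comm]; exact Submodule.smul_mem _ _ hx) hv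

/-- All products of `a` with the last three variables are null, so `γ (a * ·)` kills every quadric
vanishing at (1,0,0,0). -/
theorem apply_mul (h : IsRankOne γ a) {p : MvPolynomial (Fin 4) k} (hp : p ∈ forms k 2) :
    γ (a * p) = evalFirst k p * γ (a * X 0 ^ 2) := by
  have h1 := sub_evalFirst_mem 1 hp
  have h2 : ∀ x ∈ lastVars k * forms k 1, (γ ∘ₗ LinearMap.mulLeft k a) x = 0 :=
    functional_eq_zero_on_mul fun u hu w hw => by
      have := (mem_nullQuadrics.1 (h.mul_mem hu)).2 w hw
      rw [LinearMap.comp_apply, LinearMap.mulLeft_apply, ← this]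
      congr 1; ring
  have h3 := h2 _ h1
  rw [LinearMap.comp_apply, LinearMap.mulLeft_apply, mul_sub, map_sub, mul_smul_comm,
    map_smul, smul_eq_mul, sub_eq_zero] at h3
  exact h3

theorem apply_ne_zero (h : IsRankOne γ a) : γ (a * X 0 ^ 2) ≠ 0 := by
  intro h0
  have : a = 0 := by
    refine h.nondeg _ h.mem_forms fun p hp => ?_
    rw [forms_one_pow] at hp
    rw [h.apply_mul hp, h0, mul_zero]
  rcases h.eq_X with rfl | rfl <;> exact X_ne_zero _ this

/-- A null quadric is killed by `γ (a * ·)`, which is a nonzero multiple of evaluation at the point.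
-/
theorem evalFirst_eq_zero (h : IsRankOne γ a) {q : MvPolynomial (Fin 4) k}
    (hq : q ∈ nullQuadrics γ) : evalFirst k q = 0 := by
  have h1 := h.apply_mul (mem_nullQuadrics.1 hq).1
  rw [(mem_nullQuadrics.1 hq).2 a h.mem_forms] at h1
  exact (mul_eq_zero.1 h1.symm).resolve_right h.apply_ne_zero

theorem nullQuadrics_le (h : IsRankOne γ a) : nullQuadrics γ ≤ lastVars k * forms k 1 :=
  fun _ hq => mem_lastVars_mul_forms (mem_nullQuadrics.1 hq).1 (h.evalFirst_eq_zero hq)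

/-- A cubic on which `γ` takes the value one. -/
theorem exists_unit (h : IsRankOne γ a) : ∃ c : k, c ≠ 0 ∧ γ (c • (a * X 0 ^ 2)) = 1 :=
  ⟨(γ (a * X 0 ^ 2))⁻¹, inv_ne_zero h.apply_ne_zero, by
    rw [map_smul, smul_eq_mul, inv_mul_cancel₀ h.apply_ne_zero]⟩

theorem sub_mem_nullCubics {p s : MvPolynomial (Fin 4) k} (hp : p ∈ forms k 3)
    (hp1 : γ p = 1) (hs : s ∈ forms k 3) : s - γ s • p ∈ nullCubics γ := by
  refine ⟨sub_mem hs (Submodule.smul_mem _ _ hp), ?_⟩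
  change γ (s - γ s • p) = 0
  rw [map_sub, map_smul, hp1, smul_eq_mul, mul_one, sub_self]

/-- Null cubics form a hyperplane in the cubics, with complement spanned by p. A functional Λ
killing N₂N₃ therefore satisfies Λ(qs) = γ(s)Λ(qp), and it remains to see that Λ(qp) = 0 for q null.
-/
theorem nullQuadrics_mul_nullCubics (h : IsRankOne γ a) :
    nullQuadrics γ * nullCubics γ = nullQuadrics γ * forms k 3 := by
  refine le_antisymm (mul_le_mul' le_rfl (nullCubics_le γ)) (le_of_forall_functional ?_)
  intro Λ hΛ
  obtain ⟨c, hc, hp1⟩ := h.exists_unit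
  set p := c • (a * X 0 ^ 2) with hpdef
  have hp : p ∈ forms k 3 :=
    Submodule.smul_mem _ _ (mul_mem_forms h.mem_forms (X_pow_mem_forms 0 2))
  have hqs : ∀ q ∈ nullQuadrics γ, ∀ s ∈ forms k 3, Λ (q * s) = γ s * Λ (q * p) := by
    intro q hq s hs
    have := hΛ _ (Submodule.mul_mem_mul hq (sub_mem_nullCubics hp hp1 hs))
    rw [mul_sub, map_sub, mul_smul_comm, map_smul, smul_eq_mul, sub_eq_zero] at this
    exact this
  -- Exchanging `X i` and `X j` in `a * X i * X j * u` would make the contractions of these two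
  -- variables proportional.
  have haX : ∀ i, i ≠ 0 → Λ (a * X i * p) = 0 := by
    intro i hi
    by_contra hne
    obtain ⟨j, hj0, hji⟩ : ∃ j : Fin 4, j ≠ 0 ∧ j ≠ i := by
      exact (show ∀ i : Fin 4, ∃ j : Fin 4, j ≠ 0 ∧ j ≠ i by decide) i
    refine X_ne_smul_X hji (Λ (a * X j * p) / Λ (a * X i * p))
      (h.eq_of_forall (X_mem_forms _) (X_mem_forms _) _ fun u hu => ?_)
    have e1 := hqs _ (h.mem i hi) _ (mul_mem_forms (X_mem_forms j) hu)
    have e2 := hqs _ (h.mem j hj0) _ (mul_mem_forms (X_mem_forms i) hu)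
    have e3 : a * X i * (X j * u) = a * X j * (X i * u) := by ring
    rw [e3, e2] at e1
    field_simp
    rw [← e1]; ring
  have haK : ∀ v ∈ lastVars k, Λ (a * v * p) = 0 := fun v hv =>
    lastVars_induction (P := fun v => Λ (a * v * p) = 0) (by simp) haX
      (fun x y hx hy => by rw [mul_add, add_mul, map_add, hx, hy, add_zero])
      (fun b x hx => by
        rw [mul_smul_comm b a x, smul_mul_assoc b, map_smul, hx, smul_zero]) hv
  -- Here the choice of p as a multiple of `a * X 0 ^ 2` matters: q is a sum of products uw with u
  -- in `lastVars k`, and the factor `a` of p can be moved to u, where `a * u` is null.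
  have hqp : ∀ q ∈ nullQuadrics γ, Λ (q * p) = 0 := by
    intro q hq
    have h2 : ∀ x ∈ lastVars k * forms k 1, (Λ ∘ₗ LinearMap.mulRight k p) x = 0 :=
      functional_eq_zero_on_mul fun u hu w hw => by
        have h3 := hqs _ (h.mul_mem hu) _ (Submodule.smul_mem _ c
          (mul_mem_forms hw (X_pow_mem_forms 0 2)))
        rw [haK u hu, mul_zero] at h3
        rw [LinearMap.comp_apply, LinearMap.mulRight_apply, ← h3, hpdef]
        congr 1
        simp only [smul_eq_C_mul]
        ring
    exact h2 q (h.nullQuadrics_le hq)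
  exact functional_eq_zero_on_mul fun q hq s hs => by rw [hqs q hq s hs, hqp q hq, mul_zero]

/-- A functional Λ killing the right side is determined by one scalar ω = Λ(X₀³p): it is an explicit
symmetric bilinear expression in the values of γ and of evaluation at the point. Associativity of
the product forces ω = 0. -/
theorem forms_six_le (h : IsRankOne γ a) :
    forms k 6 ≤ nullCubics γ * nullCubics γ ⊔ nullQuadrics γ * forms k 4 := by
  refine le_of_forall_functional fun Λ hΛ => ?_
  obtain ⟨c, hc, hp1⟩ := h.exists_unit
  set p := c • (a * X 0 ^ 2) with hpdef
  have hp : p ∈ forms k 3 :=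
    Submodule.smul_mem _ _ (mul_mem_forms h.mem_forms (X_pow_mem_forms 0 2))
  set ω := Λ (X 0 ^ 3 * p) with hω
  -- If s vanishes at the point, moving `a` from p into s puts `s * p` into `nullQuadrics γ * forms
  -- k 4`.
  have hsp : ∀ s ∈ forms k 3, Λ (s * p) = evalFirst k s * ω := by
    intro s hs
    have h2 : ∀ x ∈ lastVars k * forms k 2, (Λ ∘ₗ LinearMap.mulRight k p) x = 0 :=
      functional_eq_zero_on_mul fun u hu w hw => by
        have h3 := hΛ _ (Submodule.mem_sup_right (Submodule.mul_mem_mul (h.mul_mem hu)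
          (Submodule.smul_mem _ c (mul_mem_forms hw (X_pow_mem_forms 0 2)))))
        rw [LinearMap.comp_apply, LinearMap.mulRight_apply, ← h3, hpdef]
        congr 1
        simp only [smul_eq_C_mul]
        ring
    have h3 := h2 _ (sub_evalFirst_mem 2 hs)
    rw [LinearMap.comp_apply, LinearMap.mulRight_apply, sub_mul, map_sub, smul_mul_assoc,
      map_smul, smul_eq_mul, sub_eq_zero] at h3
    exact h3
  -- Expand the product of the null cubics `s - γ s • p` and `t - γ t • p`.
  have hss : ∀ s ∈ forms k 3, ∀ t ∈ forms k 3, Λ (s * t) =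
      ω * (γ t * evalFirst k s + γ s * evalFirst k t - γ s * γ t * evalFirst k p) := by
    intro s hs t ht
    have h1 := hΛ _ (Submodule.mem_sup_left (Submodule.mul_mem_mul
      (sub_mem_nullCubics hp hp1 hs) (sub_mem_nullCubics hp hp1 ht)))
    have h2 : (s - γ s • p) * (t - γ t • p) =
        s * t - γ t • (s * p) - γ s • (t * p) + (γ s * γ t) • (p * p) := by
      simp only [smul_eq_C_mul, map_mul]; ring
    rw [h2] at h1
    simp only [map_add, map_sub, map_smul, smul_eq_mul, hsp s hs, hsp t ht, hsp p hp] at h1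
    linear_combination h1
  have hω0 : ω = 0 := by
    by_contra hne
    have hX1 : (1 : Fin 4) ≠ 0 := by decide
    have hX2 : (2 : Fin 4) ≠ 0 := by decide
    have ev : ∀ i : Fin 4, i ≠ 0 → ∀ u, evalFirst k (X i * u) = 0 := fun i hi u => by
      rw [map_mul, evalFirst_X_of_ne hi, zero_mul]
    rcases h.eq_X with ha | ha
    · have hevp : evalFirst k p ≠ 0 := by
        rw [hpdef, ha, map_smul, map_mul, map_pow, evalFirst_X_zero]
        simpa using hc
      obtain ⟨u', hu', hne'⟩ : ∃ u ∈ forms k 2, γ (X 2 * u) ≠ 0 := by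
        by_contra! hcon
        refine X_ne_zero (R := k) (2 : Fin 4) (h.nondeg _ (X_mem_forms 2) fun p hp => ?_)
        rw [forms_one_pow] at hp
        exact hcon p hp
      refine X_ne_smul_X (show (1 : Fin 4) ≠ 2 by decide) (γ (X 1 * u') / γ (X 2 * u'))
        (h.eq_of_forall (X_mem_forms _) (X_mem_forms _) _ fun u hu => ?_)
      -- With `a = X 0`, p does not vanish at the point. Two factorizations of `X 1 * X 2 * u * u'`
      -- make the contractions of `X 1` and `X 2` proportional.
      have e1 := hss _ (mul_mem_forms (X_mem_forms 1) hu) _ (mul_mem_forms (X_mem_forms 2) hu')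
      have e2 := hss _ (mul_mem_forms (X_mem_forms 2) hu) _ (mul_mem_forms (X_mem_forms 1) hu')
      have e3 : (X 1 * u * (X 2 * u') : MvPolynomial (Fin 4) k) = X 2 * u * (X 1 * u') := by ring
      rw [e3, e2, ev _ hX1, ev _ hX2, ev _ hX1, ev _ hX2] at e1
      have e4 : (ω * evalFirst k p) * (γ (X 1 * u) * γ (X 2 * u')) =
          (ω * evalFirst k p) * (γ (X 1 * u') * γ (X 2 * u)) := by linear_combination e1
      have e5 := mul_left_cancel₀ (mul_ne_zero hne hevp) e4
      field_simp
      linear_combination e5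
    · have hevp : evalFirst k p = 0 := by
        rw [hpdef, ha, map_smul, map_mul, evalFirst_X_one, zero_mul, smul_zero]
      -- With `a = X 1`, p vanishes at the point. Two factorizations of `X 2 * X 0 ^ 3 * u` make the
      -- contraction of `X 2` proportional to evaluation, that is, to the contraction of `a`.
      refine X_ne_smul_X (show (2 : Fin 4) ≠ 1 by decide) (γ (X 2 * X 0 ^ 2) * c)
        (h.eq_of_forall (X_mem_forms _) (X_mem_forms _) _ fun u hu => ?_)
      have e1 := hss _ (mul_mem_forms (X_mem_forms 2) hu) _ (X_pow_mem_forms 0 3)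
      have e2 := hss _ (mul_mem_forms (X_mem_forms 2) (X_pow_mem_forms 0 2)) _
        (mul_mem_forms (X_mem_forms 0) hu)
      have e3 : (X 2 * u * X 0 ^ 3 : MvPolynomial (Fin 4) k) = X 2 * X 0 ^ 2 * (X 0 * u) := by ring
      rw [e3, e2, hevp, ev _ hX2, ev _ hX2, map_mul (evalFirst k),
        map_pow (evalFirst k), evalFirst_X_zero] at e1
      have e4 : ω * (γ (X 2 * u)) = ω * (γ (X 2 * X 0 ^ 2) * evalFirst k u) := by
        linear_combination -e1
      rw [mul_left_cancel₀ hne e4, ← ha, h.apply_mul hu]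
      rw [map_smul, smul_eq_mul] at hp1
      linear_combination (-γ (X 2 * X 0 ^ 2) * evalFirst k u) * hp1
  intro x hx
  have : forms k 6 = forms k 3 * forms k 3 := (forms_mul 3 3).symm
  rw [this] at hx
  exact functional_eq_zero_on_mul (fun s hs t ht => by rw [hss s hs t ht, hω0, zero_mul]) x hx

theorem exists_apply_ne_zero (h : IsRankOne γ a) {v : MvPolynomial (Fin 4) k} (hv : v ∈ forms k 1)
    (hv0 : v ≠ 0) : ∃ u ∈ forms k 2, γ (v * u) ≠ 0 := by
  by_contra! hcon
  refine hv0 (h.nondeg _ hv fun p hp => ?_)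
  rw [forms_one_pow] at hp
  exact hcon p hp

/-- If `forms k 1 * nullQuadrics γ` has codimension two, then it is the common kernel of `γ` and
of evaluation at the point `(1, 0, 0, 0)`. -/
theorem functional_eq (h : IsRankOne γ a)
    (h18 : Module.finrank k ↥(forms k 1 * nullQuadrics γ) = 18) :
    ∃ s ∈ forms k 3, ∀ G : MvPolynomial (Fin 4) k →ₗ[k] k,
      (∀ x ∈ forms k 1 * nullQuadrics γ, G x = 0) → ∃ d : k, ∀ p ∈ forms k 3,
      G p = G s * γ p + d * evalFirst k p := by
  have hX2 : (2 : Fin 4) ≠ 0 := by decide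
  obtain ⟨u, hu, hne⟩ := h.exists_apply_ne_zero (X_mem_forms 2) (X_ne_zero _)
  set s : MvPolynomial (Fin 4) k := (γ (X 2 * u))⁻¹ • (X 2 * u) with hs
  have hs3 : s ∈ forms k 3 := Submodule.smul_mem _ _ (mul_mem_forms (X_mem_forms 2) hu)
  have hγs : γ s = 1 := by rw [hs, map_smul, smul_eq_mul, inv_mul_cancel₀ hne]
  have hes : evalFirst k s = 0 := by
    rw [hs, map_smul, map_mul (evalFirst k), evalFirst_X_of_ne hX2, zero_mul, smul_zero]
  have heX : evalFirst k (X 0 ^ 3) = 1 := by rw [map_pow, evalFirst_X_zero, one_pow]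
  let Φ : forms k 3 →ₗ[k] k × k :=
    (γ.prod (evalFirst k).toLinearMap) ∘ₗ (forms k 3).subtype
  have hΦ : Function.Surjective Φ := by
    rintro ⟨c, d⟩
    refine ⟨⟨(c - d * γ (X 0 ^ 3)) • s + d • X 0 ^ 3, add_mem (Submodule.smul_mem _ _ hs3)
      (Submodule.smul_mem _ _ (X_pow_mem_forms 0 3))⟩, ?_⟩
    simp [Φ, hγs, hes, evalFirst_X_zero]
  have h1 := LinearMap.finrank_range_add_finrank_ker Φ
  rw [LinearMap.range_eq_top.2 hΦ, finrank_top, Module.finrank_prod, Module.finrank_self,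
    finrank_forms] at h1
  have hle : forms k 1 * nullQuadrics γ ≤ (LinearMap.ker Φ).map (forms k 3).subtype := by
    intro x hx
    have hx' := forms_one_mul_nullQuadrics_le γ hx
    refine ⟨⟨x, hx'.1⟩, ?_, rfl⟩
    have : evalFirst k x = 0 := functional_eq_zero_on_mul (Λ := (evalFirst k).toLinearMap)
      (fun u _ w hw => by
        rw [AlgHom.toLinearMap_apply, map_mul, h.evalFirst_eq_zero hw, mul_zero]) x hx
    exact Prod.ext hx'.2 this
  have hfin : FiniteDimensional k ↥((LinearMap.ker Φ).map (forms k 3).subtype) :=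
    finiteDimensional_of_le_forms (d := 3) (Submodule.map_subtype_le _ _)
  -- The common kernel has dimension 20 − 2 = 18, so the inclusion is an equality.
  have heq := Submodule.eq_of_le_of_finrank_eq hle (by
    rw [h18, finrank_map_of_injective _ (Submodule.subtype_injective _)]
    have : (3 + 3).choose 3 = 20 := by decide
    omega)
  refine ⟨s, hs3, fun G hG => ⟨G (X 0 ^ 3) - G s * γ (X 0 ^ 3), fun p hp => ?_⟩⟩
  have hmem : p - ((γ p - evalFirst k p * γ (X 0 ^ 3)) • s + evalFirst k p • X 0 ^ 3) ∈
      forms k 1 * nullQuadrics γ := by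
    rw [heq]
    refine ⟨⟨_, sub_mem hp (add_mem (Submodule.smul_mem _ _ hs3)
      (Submodule.smul_mem _ _ (X_pow_mem_forms 0 3)))⟩, ?_, rfl⟩
    change Φ _ = 0
    refine Prod.ext ?_ ?_
    · simp [Φ, hγs]
    · simp [Φ, hes, evalFirst_X_zero]
  have := hG _ hmem
  simp only [map_sub, map_add, map_smul, smul_eq_mul] at this
  linear_combination this

/-- The product is the whole hyperplane of quintics vanishing at (1,0,0,0), of dimension 56 − 1. It
is enough to fill the quartics in `lastVars k * forms k 3`. For a functional Λ killing S₂N₂, each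
Λ(u·) is a combination of γ and evaluation by `functional_eq`, and comparing different u makes the
coefficients vanish for u in `lastVars k`. -/
theorem finrank_nullQuadrics_mul_forms (h : IsRankOne γ a)
    (h18 : Module.finrank k ↥(forms k 1 * nullQuadrics γ) = 18) :
    Module.finrank k ↥(nullQuadrics γ * forms k 3) = 55 := by
  have hX : ∀ i : Fin 4, (X i : MvPolynomial (Fin 4) k) ∈ forms k 1 := X_mem_forms
  obtain ⟨s, hs, hG⟩ := h.functional_eq h18
  have key : lastVars k * forms k 3 ≤ forms k 2 * nullQuadrics γ := by
    refine le_of_forall_functional fun Λ hΛ => ?_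
    have hd : ∀ u ∈ forms k 1, ∃ d : k, ∀ p ∈ forms k 3,
        Λ (u * p) = Λ (u * s) * γ p + d * evalFirst k p := by
      intro u hu
      refine hG (Λ ∘ₗ LinearMap.mulLeft k u) fun x hx => ?_
      refine hΛ _ ?_
      have := Submodule.mul_mem_mul hu hx
      rwa [← mul_assoc, forms_mul] at this
    have hsym : ∀ u ∈ lastVars k, ∀ v ∈ lastVars k, ∀ w ∈ forms k 2,
        Λ (u * s) * γ (v * w) = Λ (v * s) * γ (u * w) := by
      intro u hu v hv w hw
      obtain ⟨d, hd1⟩ := hd u (lastVars_le hu)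
      obtain ⟨d', hd2⟩ := hd v (lastVars_le hv)
      have e1 := hd1 _ (mul_mem_forms (lastVars_le hv) hw)
      have e2 := hd2 _ (mul_mem_forms (lastVars_le hu) hw)
      rw [map_mul (evalFirst k), evalFirst_eq_zero_of_mem_lastVars hv, zero_mul, mul_zero,
        add_zero] at e1
      rw [map_mul (evalFirst k), evalFirst_eq_zero_of_mem_lastVars hu, zero_mul, mul_zero,
        add_zero] at e2
      rw [← e1, ← e2]; congr 1; ring
    have hXs : ∀ i, i ≠ 0 → Λ (X i * s) = 0 := by
      intro i hi
      by_contra hne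
      obtain ⟨j, hj0, hji⟩ : ∃ j : Fin 4, j ≠ 0 ∧ j ≠ i := by
        exact (show ∀ i : Fin 4, ∃ j : Fin 4, j ≠ 0 ∧ j ≠ i by decide) i
      refine X_ne_smul_X hji (Λ (X j * s) / Λ (X i * s))
        (h.eq_of_forall (hX _) (hX _) _ fun u hu => ?_)
      have := hsym _ (X_mem_lastVars hi) _ (X_mem_lastVars hj0) u hu
      field_simp
      linear_combination this
    have hX0 : Λ (X 0 * s) = 0 := by
      by_contra hne
      -- The variable must not be proportional to `a`: comparing Λ(X₀·Xⱼu) with Λ(Xⱼ·X₀u) would make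
      -- its contraction a multiple of evaluation, hence of the contraction of `a`.
      obtain ⟨j, hj0, hja⟩ : ∃ j : Fin 4, j ≠ 0 ∧ ∀ c : k, (X j : MvPolynomial (Fin 4) k) ≠ c • a := by
        rcases h.eq_X with ha | ha <;> rw [ha]
        · exact ⟨1, by decide, X_ne_smul_X (by decide)⟩
        · exact ⟨2, by decide, X_ne_smul_X (by decide)⟩
      obtain ⟨d, hd1⟩ := hd _ (hX j)
      obtain ⟨d', hd2⟩ := hd _ (hX 0)
      refine hja (d / (Λ (X 0 * s) * γ (a * X 0 ^ 2)))
        (h.eq_of_forall (hX _) h.mem_forms _ fun u hu => ?_)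
      have e1 := hd1 _ (mul_mem_forms (hX 0) hu)
      have e2 := hd2 _ (mul_mem_forms (hX j) hu)
      rw [hXs j hj0, zero_mul, zero_add, map_mul (evalFirst k), evalFirst_X_zero, one_mul] at e1
      rw [map_mul (evalFirst k), evalFirst_X_of_ne hj0, zero_mul, mul_zero, add_zero,
        show (X 0 * (X j * u) : MvPolynomial (Fin 4) k) = X j * (X 0 * u) by ring, e1] at e2
      rw [h.apply_mul hu]
      have := h.apply_ne_zero
      field_simp
      linear_combination -e2
    have hfin : ∀ v ∈ lastVars k, ∀ p ∈ forms k 3, Λ (v * p) = 0 := by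
      intro v hv p hp
      refine lastVars_induction (P := fun v => Λ (v * p) = 0) (by simp) (fun i hi => ?_)
        (fun x y hx hy => by rw [add_mul, map_add, hx, hy, add_zero])
        (fun c x hx => by rw [smul_mul_assoc, map_smul, hx, smul_zero]) hv
      obtain ⟨d, hd1⟩ := hd _ (hX i)
      obtain ⟨d', hd2⟩ := hd _ (hX 0)
      have e1 := hd1 _ (X_pow_mem_forms 0 3)
      have e2 := hd2 _ (mul_mem_forms (hX i) (X_pow_mem_forms 0 2))
      rw [hXs i hi, zero_mul, zero_add, map_pow (evalFirst k), evalFirst_X_zero, one_pow,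
        mul_one] at e1
      rw [hX0, zero_mul, zero_add, map_mul (evalFirst k), evalFirst_X_of_ne hi, zero_mul, mul_zero,
        show (X 0 * (X i * X 0 ^ 2) : MvPolynomial (Fin 4) k) = X i * X 0 ^ 3 by ring, e1] at e2
      rw [hd1 p hp, hXs i hi, e2, zero_mul, zero_mul, add_zero]
    exact functional_eq_zero_on_mul hfin
  have heq : nullQuadrics γ * forms k 3 = lastVars k * forms k 4 := by
    refine le_antisymm ?_ ?_
    · refine (mul_le_mul' h.nullQuadrics_le le_rfl).trans ?_
      rw [mul_assoc, forms_mul]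
    · rw [← forms_mul 3 1, ← mul_assoc]
      refine (mul_le_mul' key le_rfl).trans ?_
      rw [mul_comm (forms k 2), mul_assoc, forms_mul]
  have h55 := finrank_lastVars_mul_forms (k := k) 4
  have : (3 + (4 + 1)).choose (4 + 1) = 56 := by decide
  rw [heq]
  omega

end IsRankOne

end RankOne

section Products

variable {k : Type*} [Field k]

/-! ### Spans of products of quadrics -/

/-- The unordered pairs are divided between `L`, whose products form a basis, and `L'`, whose
products are redundant. In the applications both lists are explicit. -/
theorem finrank_span_range_mul_self {A : Type*} [CommRing A] [Algebra k A] (q : Fin 6 → A)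
    (L L' : List (Fin 6 × Fin 6)) (hL : L.Nodup)
    (hcov : ∀ i j : Fin 6, i ≤ j → (i, j) ∈ L ∨ (i, j) ∈ L')
    (h1 : ∀ p ∈ L', q p.1 * q p.2 ∈
      Submodule.span k ((fun p : Fin 6 × Fin 6 => q p.1 * q p.2) '' {p | p ∈ L}))
    (h2 : ∀ c : Fin 6 → Fin 6 → k,
      (L.map fun p => c p.1 p.2 • (q p.1 * q p.2)).sum = 0 → ∀ p ∈ L, c p.1 p.2 = 0) :
    Module.finrank k ↥(Submodule.span k (Set.range q) * Submodule.span k (Set.range q)) =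
      L.length := by
  classical
  have hspan : Submodule.span k (Set.range q) * Submodule.span k (Set.range q) =
      Submodule.span k (Set.range fun p : L.toFinset =>
        q (p : Fin 6 × Fin 6).1 * q (p : Fin 6 × Fin 6).2) := by
    have hr : (Set.range fun p : L.toFinset => q (p : Fin 6 × Fin 6).1 * q (p : Fin 6 × Fin 6).2) =
        (fun p : Fin 6 × Fin 6 => q p.1 * q p.2) '' {p | p ∈ L} := by
      ext x; simp
    rw [hr, Submodule.span_mul_span]
    refine le_antisymm (Submodule.span_le.2 ?_) (Submodule.span_mono ?_)
    · rintro _ ⟨_, ⟨i, rfl⟩, _, ⟨j, rfl⟩, rfl⟩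
      have key : ∀ i j : Fin 6, i ≤ j → q i * q j ∈ Submodule.span k
          ((fun p : Fin 6 × Fin 6 => q p.1 * q p.2) '' {p | p ∈ L}) := by
        intro i j hij
        rcases hcov i j hij with h | h
        · exact Submodule.subset_span ⟨(i, j), h, rfl⟩
        · exact h1 (i, j) h
      rcases le_total i j with h | h
      · exact key i j h
      · change q i * q j ∈ _
        rw [mul_comm]; exact key j i h
    · rintro _ ⟨p, -, rfl⟩
      exact Set.mul_mem_mul ⟨_, rfl⟩ ⟨_, rfl⟩
  rw [hspan, finrank_span_eq_card, Fintype.card_coe, List.toFinset_card_of_nodup hL]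
  rw [Fintype.linearIndependent_iff]
  intro g hg p
  let c : Fin 6 → Fin 6 → k := fun i j => if h : (i, j) ∈ L.toFinset then g ⟨(i, j), h⟩ else 0
  have hc : ∀ p : L.toFinset, c (p : Fin 6 × Fin 6).1 (p : Fin 6 × Fin 6).2 = g p := fun p => by
    simp only [c, Prod.mk.eta, Subtype.coe_eta]
    rw [dif_pos p.2]
  rw [← hc]
  refine h2 c ?_ _ (List.mem_toFinset.1 p.2)
  rw [← List.sum_toFinset _ hL, ← Finset.sum_coe_sort, ← hg]
  exact Finset.sum_congr rfl fun p _ => by rw [hc]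

/-- Multiplying a linear relation among the `q j` by `q 0` gives a relation among products listed in
`L`. Hence independence of the quadrics needs no separate check. -/
theorem linearIndependent_of_products {A : Type*} [CommRing A] [Algebra k A] {q : Fin 6 → A}
    {L : List (Fin 6 × Fin 6)} (hL : L.Nodup) (h0 : ∀ j, (0, j) ∈ L)
    (h2 : ∀ c : Fin 6 → Fin 6 → k,
      (L.map fun p => c p.1 p.2 • (q p.1 * q p.2)).sum = 0 → ∀ p ∈ L, c p.1 p.2 = 0) :
    LinearIndependent k q := by
  classical
  rw [Fintype.linearIndependent_iff]
  intro g hg j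
  have := h2 (fun i j => if i = 0 then g j else 0) ?_ (0, j) (h0 j)
  · simpa using this
  · have h3 : q 0 * ∑ j, g j • q j = 0 := by rw [hg, mul_zero]
    rw [← h3, Finset.mul_sum, ← List.sum_toFinset _ hL]
    symm
    rw [← Finset.sum_subset (s₁ := Finset.univ.image fun j : Fin 6 => ((0 : Fin 6), j))]
    · rw [Finset.sum_image (fun x _ y _ h => (Prod.mk.inj h).2)]
      exact Finset.sum_congr rfl fun j _ => by simp
    · intro p hp
      obtain ⟨j, -, rfl⟩ := Finset.mem_image.1 hp
      exact List.mem_toFinset.2 (h0 j)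
    · rintro ⟨i, j⟩ _ hp
      have : i ≠ 0 := by
        rintro rfl
        exact hp (Finset.mem_image.2 ⟨j, Finset.mem_univ _, rfl⟩)
      simp [this]

theorem span_range_eq_nullQuadrics {γ : MvPolynomial (Fin 4) k →ₗ[k] k}
    (hγ : NondegenerateOn γ (forms k 1)) {q : Fin 6 → MvPolynomial (Fin 4) k}
    (hq : ∀ i, q i ∈ nullQuadrics γ) (hli : LinearIndependent k q) :
    Submodule.span k (Set.range q) = nullQuadrics γ := by
  have : FiniteDimensional k (nullQuadrics γ) := finiteDimensional_of_le_forms (nullQuadrics_le γ)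
  refine Submodule.eq_of_le_of_finrank_eq (Submodule.span_le.2 ?_) ?_
  · rintro _ ⟨i, rfl⟩; exact hq i
  · rw [finrank_nullQuadrics hγ, finrank_span_eq_card hli, Fintype.card_fin]

/-- Kronecker substitution: it separates the monomials of degree at most four. -/
def kronecker (k : Type*) [Field k] : MvPolynomial (Fin 4) k →ₐ[k] Polynomial k :=
  aeval ![Polynomial.X, Polynomial.X ^ 5, Polynomial.X ^ 25, Polynomial.X ^ 125]

/-! ### Quotients isomorphic to an algebra of dimension four -/

/-- Since ρ kills N₂, is injective on S₁ and sends v₀ to 1, the spaces N₂ and v₀S₁ meet in zero, and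
6 + 4 = 10 gives S₂ = N₂ ⊕ v₀S₁. Inductively S_{d+2} = N₂S_d + v₀^{d+1}S₁, so ρ on S_{d+2} has
kernel exactly N₂S_d and the four-dimensional image ρ(S₁). -/
theorem finrank_nullQuadrics_mul_forms_add_four {γ : MvPolynomial (Fin 4) k →ₗ[k] k}
    (hγ : NondegenerateOn γ (forms k 1)) {Z : Type*} [CommRing Z] [Algebra k Z]
    (ρ : MvPolynomial (Fin 4) k →ₐ[k] Z) {v₀ : MvPolynomial (Fin 4) k} (hv₀ : v₀ ∈ forms k 1)
    (hρ₀ : ρ v₀ = 1) (hinj : ∀ v ∈ forms k 1, ρ v = 0 → v = 0)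
    (hker : ∀ q ∈ nullQuadrics γ, ρ q = 0) (d : ℕ) :
    Module.finrank k ↥(nullQuadrics γ * forms k d) + 4 = Module.finrank k (forms k (d + 2)) := by
  have hL : ∀ d, ∀ x ∈ Submodule.span k {v₀ ^ d} * forms k 1, ∃ v ∈ forms k 1, x = v₀ ^ d * v := by
    intro d x hx
    rw [Submodule.mem_span_singleton_mul] at hx
    obtain ⟨v, hv, rfl⟩ := hx
    exact ⟨v, hv, rfl⟩
  have hinf : nullQuadrics γ ⊓ Submodule.span k {v₀ ^ 1} * forms k 1 = ⊥ := by
    rw [eq_bot_iff]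
    rintro x ⟨hx, hx'⟩
    obtain ⟨v, hv, rfl⟩ := hL 1 x hx'
    have := hker _ hx
    rw [map_mul, map_pow, hρ₀, one_pow, one_mul] at this
    rw [hinj v hv this, mul_zero]
    exact zero_mem _
  have hv0ne : v₀ ≠ 0 := by
    rintro rfl
    rw [map_zero] at hρ₀
    have h1 : (X 0 : MvPolynomial (Fin 4) k) = 0 := hinj _ (X_mem_forms 0) (by
      rw [← one_mul (ρ _), ← hρ₀, zero_mul])
    exact X_ne_zero _ h1
  have hdimL : Module.finrank k ↥(Submodule.span k {v₀ ^ 1} * forms k 1) = 4 := by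
    have : Submodule.span k {v₀ ^ 1} * forms k 1 = (forms k 1).map (LinearMap.mulLeft k v₀) := by
      ext x
      rw [Submodule.mem_span_singleton_mul, pow_one]
      rfl
    rw [this, finrank_map_of_injective _ (mul_right_injective₀ hv0ne), finrank_forms]
    rfl
  have hLle : Submodule.span k {v₀ ^ 1} * forms k 1 ≤ forms k 2 := by
    rw [← forms_mul 1 1]
    refine mul_le_mul' ?_ le_rfl
    rw [Submodule.span_le, Set.singleton_subset_iff, pow_one]
    exact hv₀
  have h2 : forms k 2 = nullQuadrics γ ⊔ Submodule.span k {v₀ ^ 1} * forms k 1 := by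
    have f1 : FiniteDimensional k (nullQuadrics γ) :=
      finiteDimensional_of_le_forms (nullQuadrics_le γ)
    have f2 : FiniteDimensional k ↥(Submodule.span k {v₀ ^ 1} * forms k 1) :=
      finiteDimensional_of_le_forms hLle
    refine (Submodule.eq_of_le_of_finrank_eq (sup_le (nullQuadrics_le γ) hLle) ?_).symm
    have := Submodule.finrank_sup_add_finrank_inf_eq (nullQuadrics γ)
      (Submodule.span k {v₀ ^ 1} * forms k 1)
    rw [hinf, finrank_bot, finrank_nullQuadrics hγ, hdimL] at this
    rw [finrank_forms]
    have e : (3 + 2).choose 2 = 10 := by decide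
    omega
  have h3 : ∀ d, forms k (d + 2) ≤
      nullQuadrics γ * forms k d ⊔ Submodule.span k {v₀ ^ (d + 1)} * forms k 1 := by
    intro d
    induction d with
    | zero =>
      rw [zero_add, zero_add, show forms k 0 = 1 from homogeneousSubmodule_zero _, mul_one]
      exact h2.le
    | succ d ih =>
      rw [show d + 1 + 2 = (d + 2) + 1 by ring, ← forms_mul (d + 2) 1]
      refine (mul_le_mul' ih le_rfl).trans ?_
      rw [Submodule.sup_mul, mul_assoc, forms_mul, mul_assoc, forms_mul]
      refine sup_le le_sup_left ?_
      change Submodule.span k {v₀ ^ (d + 1)} * forms k 2 ≤ _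
      rw [h2, Submodule.mul_sup]
      refine sup_le ?_ ?_
      · refine le_sup_of_le_left ?_
        rw [mul_comm]
        refine mul_le_mul' le_rfl ?_
        rw [Submodule.span_le, Set.singleton_subset_iff, ← forms_one_pow]
        exact Submodule.pow_mem_pow _ hv₀ _
      · refine le_sup_of_le_right ?_
        rw [← mul_assoc, Submodule.span_mul_span, Set.singleton_mul_singleton, ← pow_add]
  let f : forms k (d + 2) →ₗ[k] Z := ρ.toLinearMap.domRestrict _
  have hkerZ : ∀ x ∈ nullQuadrics γ * forms k d, ρ x = 0 := by
    intro x hx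
    induction hx using Submodule.mul_induction_on' with
    | mem_mul_mem q hq w _ => rw [map_mul, hker q hq, zero_mul]
    | add x _ y _ hx hy => rw [map_add, hx, hy, add_zero]
  have hle : nullQuadrics γ * forms k d ≤ forms k (d + 2) := by
    rw [add_comm d 2, ← forms_mul]
    exact mul_le_mul' (nullQuadrics_le γ) le_rfl
  have hk : (LinearMap.ker f).map (forms k (d + 2)).subtype = nullQuadrics γ * forms k d := by
    ext x
    constructor
    · rintro ⟨y, hy, rfl⟩
      obtain ⟨n, hn, l, hl, hnl⟩ := Submodule.mem_sup.1 (h3 d y.2)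
      obtain ⟨v, hv, rfl⟩ := hL _ l hl
      have hy' : ρ y = 0 := hy
      rw [← hnl, map_add, hkerZ n hn, zero_add, map_mul, map_pow, hρ₀, one_pow, one_mul] at hy'
      rw [hinj v hv hy', mul_zero, add_zero] at hnl
      rw [Submodule.subtype_apply, ← hnl]
      exact hn
    · intro hx
      exact ⟨⟨x, hle hx⟩, hkerZ x hx, rfl⟩
  have hrange : LinearMap.range f = (forms k 1).map ρ.toLinearMap := by
    rw [LinearMap.range_domRestrict]
    ext z
    constructor
    · rintro ⟨y, hy, rfl⟩
      obtain ⟨n, hn, l, hl, hnl⟩ := Submodule.mem_sup.1 (h3 d hy)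
      obtain ⟨v, hv, rfl⟩ := hL _ l hl
      refine ⟨v, hv, ?_⟩
      rw [← hnl, AlgHom.toLinearMap_apply, AlgHom.toLinearMap_apply, map_add, hkerZ n hn, zero_add,
        map_mul, map_pow, hρ₀, one_pow, one_mul]
    · rintro ⟨v, hv, rfl⟩
      refine ⟨v₀ ^ (d + 1) * v, ?_, ?_⟩
      · rw [show d + 2 = (d + 1) + 1 by ring]
        refine mul_mem_forms ?_ hv
        rw [← forms_one_pow]
        exact Submodule.pow_mem_pow _ hv₀ _
      · rw [AlgHom.toLinearMap_apply, AlgHom.toLinearMap_apply, map_mul, map_pow, hρ₀, one_pow,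
          one_mul]
  have hr4 : Module.finrank k ↥((forms k 1).map ρ.toLinearMap) = 4 := by
    have hinj' : Function.Injective (ρ.toLinearMap.domRestrict (forms k 1)) := by
      rw [injective_iff_map_eq_zero]
      intro v hv
      exact Subtype.ext (hinj v v.2 hv)
    rw [← LinearMap.range_domRestrict, LinearMap.finrank_range_of_inj hinj', finrank_forms]
    rfl
  have := LinearMap.finrank_range_add_finrank_ker f
  rw [hrange, hr4, ← finrank_map_of_injective _ (Submodule.subtype_injective _), hk] at this
  omega

/-- Codimension four in cubics and quintics: 16 = 20 − 4 and 52 = 56 − 4. -/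
theorem hasExpectedDimensions_of_algHom {γ : MvPolynomial (Fin 4) k →ₗ[k] k}
    {a : MvPolynomial (Fin 4) k} (h : IsRankOne γ a) {Z : Type*} [CommRing Z] [Algebra k Z]
    (ρ : MvPolynomial (Fin 4) k →ₐ[k] Z) {v₀ : MvPolynomial (Fin 4) k} (hv₀ : v₀ ∈ forms k 1)
    (hρ₀ : ρ v₀ = 1) (hinj : ∀ v ∈ forms k 1, ρ v = 0 → v = 0)
    (hker : ∀ q ∈ nullQuadrics γ, ρ q = 0)
    (h19 : Module.finrank k ↥(nullQuadrics γ * nullQuadrics γ) = 19) :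
    HasExpectedDimensions γ := by
  refine ⟨Or.inr ⟨?_, h19, ?_⟩, h.forms_six_le⟩
  · have := finrank_nullQuadrics_mul_forms_add_four h.nondeg ρ hv₀ hρ₀ hinj hker 1
    rw [finrank_forms, mul_comm] at this
    have e : (3 + (1 + 2)).choose (1 + 2) = 20 := by decide
    omega
  · have := finrank_nullQuadrics_mul_forms_add_four h.nondeg ρ hv₀ hρ₀ hinj hker 3
    rw [finrank_forms] at this
    have e : (3 + (3 + 2)).choose (3 + 2) = 56 := by decide
    rw [h.nullQuadrics_mul_nullCubics]
    omega

theorem exists_eq_sum_of_mem_forms_one {v : MvPolynomial (Fin 4) k} (hv : v ∈ forms k 1) :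
    ∃ c : Fin 4 → k, v = ∑ i, c i • X i := by
  rw [forms_one_eq_span, Submodule.mem_span_range_iff_exists_fun] at hv
  obtain ⟨c, hc⟩ := hv
  exact ⟨c, hc.symm⟩

/-- The case in which the quadrics of the apolar ideal cut out a scheme of length four with
coordinate ring `Z`. -/
theorem hasExpectedDimensions_of_quadrics {γ : MvPolynomial (Fin 4) k →ₗ[k] k}
    {a : MvPolynomial (Fin 4) k} (h : IsRankOne γ a) {q : Fin 6 → MvPolynomial (Fin 4) k}
    (hq : ∀ i, q i ∈ nullQuadrics γ) {L L' : List (Fin 6 × Fin 6)} (hL : L.Nodup)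
    (hlen : L.length = 19) (h0 : ∀ j, (0, j) ∈ L)
    (hcov : ∀ i j : Fin 6, i ≤ j → (i, j) ∈ L ∨ (i, j) ∈ L')
    (h1 : ∀ p ∈ L', q p.1 * q p.2 ∈
      Submodule.span k ((fun p : Fin 6 × Fin 6 => q p.1 * q p.2) '' {p | p ∈ L}))
    (h2 : ∀ c : Fin 6 → Fin 6 → k,
      (L.map fun p => c p.1 p.2 • (q p.1 * q p.2)).sum = 0 → ∀ p ∈ L, c p.1 p.2 = 0)
    {Z : Type*} [CommRing Z] [Algebra k Z] (z : Fin 4 → Z)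
    (hz : ∀ c : Fin 4 → k, ∑ i, c i • z i = 0 → ∀ i, c i = 0) {v₀ : MvPolynomial (Fin 4) k}
    (hv₀ : v₀ ∈ forms k 1) (hz₀ : aeval z v₀ = 1) (hzq : ∀ i, aeval z (q i) = 0) :
    HasExpectedDimensions γ := by
  have hspan := span_range_eq_nullQuadrics h.nondeg hq (linearIndependent_of_products hL h0 h2)
  refine hasExpectedDimensions_of_algHom h (aeval z) hv₀ hz₀ (fun v hv hv0 => ?_)
    (fun x hx => ?_) ?_
  · obtain ⟨c, rfl⟩ := exists_eq_sum_of_mem_forms_one hv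
    have := hz c (by simpa using hv0)
    simp [this]
  · rw [← hspan] at hx
    have : Submodule.span k (Set.range q) ≤ LinearMap.ker (aeval z).toLinearMap := by
      rw [Submodule.span_le]
      rintro _ ⟨i, rfl⟩
      exact hzq i
    exact this hx
  · rw [← hspan, finrank_span_range_mul_self q L L' hL hcov h1 h2, hlen]

end Products

/-! ### Quadrics through schemes of length four -/

section LengthFour

variable {k : Type*} [Field k] {γ : MvPolynomial (Fin 4) k →ₗ[k] k}

theorem mk_span_X_pow_eq_zero_iff {n : ℕ} {p : Polynomial k} :
    Ideal.Quotient.mk (Ideal.span {(Polynomial.X : Polynomial k) ^ n}) p = 0 ↔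
      ∀ d < n, p.coeff d = 0 := by
  rw [Ideal.Quotient.eq_zero_iff_mem, Ideal.mem_span_singleton, Polynomial.X_pow_dvd_iff]

set_option linter.unusedSimpArgs false

/-- The quadrics through the four coordinate points. -/
def fourPointsQuadrics (k : Type*) [Field k] : Fin 6 → MvPolynomial (Fin 4) k :=
  ![X 0 * X 1, X 0 * X 2, X 0 * X 3, X 1 * X 2, X 1 * X 3, X 2 * X 3]

def fourPointsPairs : List (Fin 6 × Fin 6) :=
  [(0, 0), (0, 1), (0, 2), (0, 3), (0, 4), (0, 5), (1, 1), (1, 2), (1, 3), (1, 5), (2,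
    2), (2, 4), (2, 5), (3, 3), (3, 4), (3, 5), (4, 4), (4, 5), (5, 5)]

/-- Kronecker substitution turns distinct quartic monomials into distinct powers of one variable.
The list contains the exponents of all the products, so comparing coefficients isolates the
unknowns; the other schemes are treated in the same way. -/
theorem fourPointsQuadrics_independent (c : Fin 6 → Fin 6 → k)
    (h : (fourPointsPairs.map
      fun p => c p.1 p.2 • (fourPointsQuadrics k p.1 * fourPointsQuadrics k p.2)).sum = 0) :
    ∀ p ∈ fourPointsPairs, c p.1 p.2 = 0 := by
  have h' := congrArg (kronecker k) h
  simp only [fourPointsQuadrics, fourPointsPairs, List.map_cons, List.sum_cons, List.map_nil,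
    List.sum_nil, add_zero,
    kronecker, map_add, map_smul, map_mul, aeval_X, map_zero, map_sub, Matrix.cons_val,
    ← pow_succ', ← pow_add, ← pow_succ, sub_mul, mul_sub, smul_mul_assoc, mul_smul_comm,
    smul_smul, smul_sub, Nat.reduceAdd] at h'
  have e := fun n (_ : n ∈ [12, 32, 36, 52, 56, 60, 132, 136, 152, 156, 160, 176, 180, 252, 256,
      260, 276, 280, 300]) =>
    congrArg (Polynomial.coeff · n) h'
  simp only [Polynomial.coeff_add, Polynomial.coeff_sub, Polynomial.coeff_smul,
    Polynomial.coeff_X_pow, Polynomial.coeff_zero, smul_eq_mul, mul_ite, mul_one, mul_zero,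
    List.forall_mem_cons, Nat.reduceEqDiff, if_true, if_false, add_zero, zero_add, sub_zero,
    zero_sub] at e
  obtain ⟨e12, e32, e36, e52, e56, e60, e132, e136, e152, e156, e160, e176, e180, e252,
    e256, e260, e276, e280, e300, -⟩ := e
  simp only [fourPointsPairs, List.forall_mem_cons]
  grind

theorem hasExpectedDimensions_fourPoints (hγ : NondegenerateOn γ (forms k 1))
    (hq : ∀ i, fourPointsQuadrics k i ∈ nullQuadrics γ) : HasExpectedDimensions γ := by
  have hr : IsRankOne γ (X 0) := by
    refine ⟨Or.inl rfl, hγ, fun i hi => ?_⟩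
    fin_cases i
    · exact absurd rfl hi
    · exact hq 0
    · exact hq 1
    · exact hq 2
  refine hasExpectedDimensions_of_quadrics hr hq (L := fourPointsPairs)
      (L' := [(1, 4), (2, 3)]) (by decide) rfl (by decide) (by decide) (fun p hp => ?_)
      (fourPointsQuadrics_independent) (Z := k × k × k × k)
    (![(1, 0, 0, 0), (0, 1, 0, 0), (0, 0, 1, 0), (0, 0, 0, 1)])
      (v₀ := X 0 + X 1 + X 2 + X 3) ?_ ?_ ?_ ?_
  · have hs : ∀ p ∈ fourPointsPairs, fourPointsQuadrics k p.1 * fourPointsQuadrics k p.2 ∈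
      Submodule.span k
      ((fun p : Fin 6 × Fin 6 => fourPointsQuadrics k p.1 * fourPointsQuadrics k p.2) '' {p | p ∈
        fourPointsPairs}) :=
      fun p hp => Submodule.subset_span ⟨p, hp, rfl⟩
    rw [List.mem_cons, List.mem_singleton] at hp
    rcases hp with rfl | rfl
    · have e : fourPointsQuadrics k 1 * fourPointsQuadrics k 4 =
          (fourPointsQuadrics k 0 * fourPointsQuadrics k 5) := by
        simp only [fourPointsQuadrics, Matrix.cons_val, smul_eq_C_mul]
        ring
      rw [e]
      exact hs (0, 5) (by decide)
    · have e : fourPointsQuadrics k 2 * fourPointsQuadrics k 3 =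
          (fourPointsQuadrics k 0 * fourPointsQuadrics k 5) := by
        simp only [fourPointsQuadrics, Matrix.cons_val, smul_eq_C_mul]
        ring
      rw [e]
      exact hs (0, 5) (by decide)
  · intro c hc
    simp [Fin.sum_univ_four, Prod.ext_iff] at hc
    intro i
    fin_cases i <;> simp [hc]
  · exact add_mem (add_mem (add_mem (X_mem_forms 0) (X_mem_forms 1)) (X_mem_forms 2)) (X_mem_forms
    3)
  · simp [Prod.ext_iff]
  · intro i
    fin_cases i <;> simp [fourPointsQuadrics]

/-- Two reduced coordinate points, and a double point at the third one directed towards the fourth.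
-/
def doublePointQuadrics (k : Type*) [Field k] : Fin 6 → MvPolynomial (Fin 4) k :=
  ![X 0 * X 1, X 0 * X 2, X 0 * X 3, X 1 * X 2, X 1 * X 3, X 3 * X 3]

def doublePointPairs : List (Fin 6 × Fin 6) :=
  [(0, 0), (0, 1), (0, 2), (0, 3), (0, 4), (0, 5), (1, 1), (1, 2), (1, 3), (1, 4), (1,
    5), (2, 2), (2, 5), (3, 3), (3, 4), (3, 5), (4, 4), (4, 5), (5, 5)]

theorem doublePointQuadrics_independent (c : Fin 6 → Fin 6 → k)
    (h : (doublePointPairs.map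
      fun p => c p.1 p.2 • (doublePointQuadrics k p.1 * doublePointQuadrics k p.2)).sum = 0) :
    ∀ p ∈ doublePointPairs, c p.1 p.2 = 0 := by
  have h' := congrArg (kronecker k) h
  simp only [doublePointQuadrics, doublePointPairs, List.map_cons, List.sum_cons, List.map_nil,
    List.sum_nil, add_zero,
    kronecker, map_add, map_smul, map_mul, aeval_X, map_zero, map_sub, Matrix.cons_val,
    ← pow_succ', ← pow_add, ← pow_succ, sub_mul, mul_sub, smul_mul_assoc, mul_smul_comm,
    smul_smul, smul_sub, Nat.reduceAdd] at h'
  have e := fun n (_ : n ∈ [12, 32, 36, 52, 56, 60, 132, 136, 152, 156, 160, 252, 256, 260, 276,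
      280, 376, 380, 500]) =>
    congrArg (Polynomial.coeff · n) h'
  simp only [Polynomial.coeff_add, Polynomial.coeff_sub, Polynomial.coeff_smul,
    Polynomial.coeff_X_pow, Polynomial.coeff_zero, smul_eq_mul, mul_ite, mul_one, mul_zero,
    List.forall_mem_cons, Nat.reduceEqDiff, if_true, if_false, add_zero, zero_add, sub_zero,
    zero_sub] at e
  obtain ⟨e12, e32, e36, e52, e56, e60, e132, e136, e152, e156, e160, e252, e256, e260,
    e276, e280, e376, e380, e500, -⟩ := e
  simp only [doublePointPairs, List.forall_mem_cons]
  grind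

theorem hasExpectedDimensions_doublePoint (hγ : NondegenerateOn γ (forms k 1))
    (hq : ∀ i, doublePointQuadrics k i ∈ nullQuadrics γ) : HasExpectedDimensions γ := by
  have hr : IsRankOne γ (X 0) := by
    refine ⟨Or.inl rfl, hγ, fun i hi => ?_⟩
    fin_cases i
    · exact absurd rfl hi
    · exact hq 0
    · exact hq 1
    · exact hq 2
  refine hasExpectedDimensions_of_quadrics hr hq (L := doublePointPairs)
      (L' := [(2, 4), (2, 3)]) (by decide) rfl (by decide) (by decide) (fun p hp => ?_)
      (doublePointQuadrics_independent) (Z := k × k × DualNumber k)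
    (![(1, 0, 0), (0, 1, 0), (0, 0, 1), (0, 0, DualNumber.eps)])
      (v₀ := X 0 + X 1 + X 2) ?_ ?_ ?_ ?_
  · have hs : ∀ p ∈ doublePointPairs, doublePointQuadrics k p.1 * doublePointQuadrics k p.2 ∈
      Submodule.span k
      ((fun p : Fin 6 × Fin 6 => doublePointQuadrics k p.1 * doublePointQuadrics k p.2) '' {p | p ∈
        doublePointPairs}) :=
      fun p hp => Submodule.subset_span ⟨p, hp, rfl⟩
    rw [List.mem_cons, List.mem_singleton] at hp
    rcases hp with rfl | rfl
    · have e : doublePointQuadrics k 2 * doublePointQuadrics k 4 =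
          (doublePointQuadrics k 0 * doublePointQuadrics k 5) := by
        simp only [doublePointQuadrics, Matrix.cons_val, smul_eq_C_mul]
        ring
      rw [e]
      exact hs (0, 5) (by decide)
    · have e : doublePointQuadrics k 2 * doublePointQuadrics k 3 =
          (doublePointQuadrics k 1 * doublePointQuadrics k 4) := by
        simp only [doublePointQuadrics, Matrix.cons_val, smul_eq_C_mul]
        ring
      rw [e]
      exact hs (1, 4) (by decide)
  · intro c hc
    simp [Fin.sum_univ_four, Prod.ext_iff, TrivSqZeroExt.ext_iff] at hc
    intro i
    fin_cases i <;> simp [hc]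
  · exact add_mem (add_mem (X_mem_forms 0) (X_mem_forms 1)) (X_mem_forms 2)
  · simp [Prod.ext_iff]
  · intro i
    fin_cases i <;> simp [doublePointQuadrics]

/-- Two double points, with supports at the coordinate points 0 and 2, directed towards 1 and 3. -/
def twoDoublePointsQuadrics (k : Type*) [Field k] : Fin 6 → MvPolynomial (Fin 4) k :=
  ![X 0 * X 2, X 0 * X 3, X 1 * X 2, X 1 * X 3, X 1 * X 1, X 3 * X 3]

def twoDoublePointsPairs : List (Fin 6 × Fin 6) :=
  [(0, 0), (0, 1), (0, 2), (0, 3), (0, 4), (0, 5), (1, 1), (1, 3), (1, 4), (1, 5), (2,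
    2), (2, 3), (2, 4), (2, 5), (3, 4), (3, 5), (4, 4), (4, 5), (5, 5)]

theorem twoDoublePointsQuadrics_independent (c : Fin 6 → Fin 6 → k)
    (h : (twoDoublePointsPairs.map
      fun p => c p.1 p.2 • (twoDoublePointsQuadrics k p.1 * twoDoublePointsQuadrics k p.2)).sum =
        0) :
    ∀ p ∈ twoDoublePointsPairs, c p.1 p.2 = 0 := by
  have h' := congrArg (kronecker k) h
  simp only [twoDoublePointsQuadrics, twoDoublePointsPairs, List.map_cons, List.sum_cons,
    List.map_nil, List.sum_nil, add_zero,
    kronecker, map_add, map_smul, map_mul, aeval_X, map_zero, map_sub, Matrix.cons_val,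
    ← pow_succ', ← pow_add, ← pow_succ, sub_mul, mul_sub, smul_mul_assoc, mul_smul_comm,
    smul_smul, smul_sub, Nat.reduceAdd] at h'
  have e := fun n (_ : n ∈ [20, 36, 40, 52, 56, 60, 136, 140, 152, 156, 160, 252, 256, 260, 276,
      280, 376, 380, 500]) =>
    congrArg (Polynomial.coeff · n) h'
  simp only [Polynomial.coeff_add, Polynomial.coeff_sub, Polynomial.coeff_smul,
    Polynomial.coeff_X_pow, Polynomial.coeff_zero, smul_eq_mul, mul_ite, mul_one, mul_zero,
    List.forall_mem_cons, Nat.reduceEqDiff, if_true, if_false, add_zero, zero_add, sub_zero,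
    zero_sub] at e
  obtain ⟨e20, e36, e40, e52, e56, e60, e136, e140, e152, e156, e160, e252, e256, e260,
    e276, e280, e376, e380, e500, -⟩ := e
  simp only [twoDoublePointsPairs, List.forall_mem_cons]
  grind

theorem hasExpectedDimensions_twoDoublePoints (hγ : NondegenerateOn γ (forms k 1))
    (hq : ∀ i, twoDoublePointsQuadrics k i ∈ nullQuadrics γ) : HasExpectedDimensions γ := by
  -- Here the rank-one direction is `X 1`, not `X 0`: its products with `X 1`, `X 2`, `X 3` are
  -- among the six quadrics, while `X 0 * X 1` is not.
  have hr : IsRankOne γ (X 1) := by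
    refine ⟨Or.inr rfl, hγ, fun i hi => ?_⟩
    fin_cases i
    · exact absurd rfl hi
    · exact hq 4
    · exact hq 2
    · exact hq 3
  refine hasExpectedDimensions_of_quadrics hr hq (L := twoDoublePointsPairs)
      (L' := [(1, 2), (3, 3)]) (by decide) rfl (by decide) (by decide) (fun p hp => ?_)
      (twoDoublePointsQuadrics_independent) (Z := DualNumber k × DualNumber k)
    (![(1, 0), (DualNumber.eps, 0), (0, 1), (0, DualNumber.eps)])
      (v₀ := X 0 + X 2) ?_ ?_ ?_ ?_
  · have hs : ∀ p ∈ twoDoublePointsPairs, twoDoublePointsQuadrics k p.1 * twoDoublePointsQuadrics k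
      p.2 ∈ Submodule.span k
      ((fun p : Fin 6 × Fin 6 => twoDoublePointsQuadrics k p.1 * twoDoublePointsQuadrics k p.2) ''
        {p | p ∈ twoDoublePointsPairs}) :=
      fun p hp => Submodule.subset_span ⟨p, hp, rfl⟩
    rw [List.mem_cons, List.mem_singleton] at hp
    rcases hp with rfl | rfl
    · have e : twoDoublePointsQuadrics k 1 * twoDoublePointsQuadrics k 2 =
          (twoDoublePointsQuadrics k 0 * twoDoublePointsQuadrics k 3) := by
        simp only [twoDoublePointsQuadrics, Matrix.cons_val, smul_eq_C_mul]
        ring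
      rw [e]
      exact hs (0, 3) (by decide)
    · have e : twoDoublePointsQuadrics k 3 * twoDoublePointsQuadrics k 3 =
          (twoDoublePointsQuadrics k 4 * twoDoublePointsQuadrics k 5) := by
        simp only [twoDoublePointsQuadrics, Matrix.cons_val, smul_eq_C_mul]
        ring
      rw [e]
      exact hs (4, 5) (by decide)
  · intro c hc
    simp [Fin.sum_univ_four, Prod.ext_iff, TrivSqZeroExt.ext_iff] at hc
    intro i
    fin_cases i <;> simp [hc]
  · exact add_mem (X_mem_forms 0) (X_mem_forms 2)
  · simp [Prod.ext_iff]
  · intro i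
    fin_cases i <;> simp [twoDoublePointsQuadrics]

/-- A reduced point and a triple point with local ring k[t]/(t³); the binomial records that `X 1`,
`X 2`, `X 3` restrict to 1, t, t². -/
def triplePointQuadrics (k : Type*) [Field k] : Fin 6 → MvPolynomial (Fin 4) k :=
  ![X 0 * X 1, X 0 * X 2, X 0 * X 3, X 3 * X 3, X 2 * X 3, X 2 * X 2 - X 1 * X 3]

def triplePointPairs : List (Fin 6 × Fin 6) :=
  [(0, 0), (0, 1), (0, 2), (0, 3), (0, 4), (0, 5), (1, 1), (1, 2), (1, 4), (1, 5), (2,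
    2), (2, 3), (2, 4), (3, 3), (3, 4), (3, 5), (4, 4), (4, 5), (5, 5)]

theorem triplePointQuadrics_independent (c : Fin 6 → Fin 6 → k)
    (h : (triplePointPairs.map
      fun p => c p.1 p.2 • (triplePointQuadrics k p.1 * triplePointQuadrics k p.2)).sum = 0) :
    ∀ p ∈ triplePointPairs, c p.1 p.2 = 0 := by
  have h' := congrArg (kronecker k) h
  simp only [triplePointQuadrics, triplePointPairs, List.map_cons, List.sum_cons, List.map_nil,
    List.sum_nil, add_zero,
    kronecker, map_add, map_smul, map_mul, aeval_X, map_zero, map_sub, Matrix.cons_val,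
    ← pow_succ', ← pow_add, ← pow_succ, sub_mul, mul_sub, smul_mul_assoc, mul_smul_comm,
    smul_smul, smul_sub, Nat.reduceAdd] at h'
  -- There are more exponents than the nineteen unknowns because the last quadric is a binomial.
  have e := fun n (_ : n ∈ [12, 32, 52, 56, 76, 100, 132, 136, 152, 156, 176, 180, 200, 252, 256,
      260, 276, 280, 300, 376, 380, 400, 500]) =>
    congrArg (Polynomial.coeff · n) h'
  simp only [Polynomial.coeff_add, Polynomial.coeff_sub, Polynomial.coeff_smul,
    Polynomial.coeff_X_pow, Polynomial.coeff_zero, smul_eq_mul, mul_ite, mul_one, mul_zero,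
    List.forall_mem_cons, Nat.reduceEqDiff, if_true, if_false, add_zero, zero_add, sub_zero,
    zero_sub] at e
  obtain ⟨e12, e32, e52, e56, e76, e100, e132, e136, e152, e156, e176, e180, e200, e252,
    e256, e260, e276, e280, e300, e376, e380, e400, e500, -⟩ := e
  simp only [triplePointPairs, List.forall_mem_cons]
  grind

theorem hasExpectedDimensions_triplePoint (hγ : NondegenerateOn γ (forms k 1))
    (hq : ∀ i, triplePointQuadrics k i ∈ nullQuadrics γ) : HasExpectedDimensions γ := by
  have hr : IsRankOne γ (X 0) := by
    refine ⟨Or.inl rfl, hγ, fun i hi => ?_⟩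
    fin_cases i
    · exact absurd rfl hi
    · exact hq 0
    · exact hq 1
    · exact hq 2
  refine hasExpectedDimensions_of_quadrics hr hq (L := triplePointPairs)
      (L' := [(2, 5), (1, 3)]) (by decide) rfl (by decide) (by decide) (fun p hp => ?_)
      (triplePointQuadrics_independent) (Z := k × (Polynomial k ⧸ Ideal.span {(Polynomial.X :
        Polynomial k) ^ 3}))
    (![(1, 0), (0, 1), (0, Ideal.Quotient.mk _ Polynomial.X),
      (0, Ideal.Quotient.mk _ (Polynomial.X ^ 2))])
      (v₀ := X 0 + X 1) ?_ ?_ ?_ ?_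
  · have hs : ∀ p ∈ triplePointPairs, triplePointQuadrics k p.1 * triplePointQuadrics k p.2 ∈
      Submodule.span k
      ((fun p : Fin 6 × Fin 6 => triplePointQuadrics k p.1 * triplePointQuadrics k p.2) '' {p | p ∈
        triplePointPairs}) :=
      fun p hp => Submodule.subset_span ⟨p, hp, rfl⟩
    rw [List.mem_cons, List.mem_singleton] at hp
    rcases hp with rfl | rfl
    · have e : triplePointQuadrics k 2 * triplePointQuadrics k 5 =
          (triplePointQuadrics k 1 * triplePointQuadrics k 4) - (triplePointQuadrics k 0 *
            triplePointQuadrics k 3) := by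
        simp only [triplePointQuadrics, Matrix.cons_val, smul_eq_C_mul]
        ring
      rw [e]
      exact sub_mem (hs (1, 4) (by decide)) (hs (0, 3) (by decide))
    · have e : triplePointQuadrics k 1 * triplePointQuadrics k 3 =
          (triplePointQuadrics k 2 * triplePointQuadrics k 4) := by
        simp only [triplePointQuadrics, Matrix.cons_val, smul_eq_C_mul]
        ring
      rw [e]
      exact hs (2, 4) (by decide)
  · intro c hc
    simp only [Fin.sum_univ_four, Prod.ext_iff, Matrix.cons_val, Prod.fst_add, Prod.snd_add,
      Prod.smul_fst, Prod.smul_snd, Prod.fst_zero, Prod.snd_zero, smul_zero, add_zero, zero_add,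
      smul_eq_mul, mul_one] at hc
    obtain ⟨hc0, hc⟩ := hc
    have hc' := (mk_span_X_pow_eq_zero_iff (p := c 1 • 1 + c 2 • Polynomial.X +
      c 3 • Polynomial.X ^ 2)).1 hc
    have h0 := hc' 0 (by norm_num)
    have h1 := hc' 1 (by norm_num)
    have h2 := hc' 2 (by norm_num)
    simp [Polynomial.coeff_one, Polynomial.coeff_X] at h0 h1 h2
    simp only [mul_zero, add_zero] at hc0
    intro i
    fin_cases i <;> assumption
  · exact add_mem (X_mem_forms 0) (X_mem_forms 1)
  · simp [Prod.ext_iff]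
  · have hX : ∀ n, 3 ≤ n → (Ideal.Quotient.mk (Ideal.span {(Polynomial.X : Polynomial k) ^ 3}))
        Polynomial.X ^ n = 0 := fun n hn => by
      rw [← map_pow, mk_span_X_pow_eq_zero_iff]
      intro d hd
      rw [Polynomial.coeff_X_pow, if_neg (by omega)]
    intro i
    fin_cases i <;> simp [triplePointQuadrics, ← pow_add, ← pow_succ, ← pow_succ', hX] <;> ring

/-- One point of length four: k[t]/(t⁴) for d ≠ 0, and k[x,y]/(x²,y²) for d = 0. -/
def quadruplePointQuadrics (d : k) : Fin 6 → MvPolynomial (Fin 4) k :=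
  ![X 1 * X 1, X 1 * X 2, X 1 * X 3, X 2 * X 2, X 2 * X 3 - X 0 * X 1, X 3 * X 3 - d • (X 0 * X 2)]

def quadruplePointPairs : List (Fin 6 × Fin 6) :=
  [(0, 0), (0, 1), (0, 2), (0, 3), (0, 4), (0, 5), (1, 2), (1, 3), (1, 4), (1, 5), (2,
    3), (2, 4), (2, 5), (3, 3), (3, 4), (3, 5), (4, 4), (4, 5), (5, 5)]

theorem quadruplePointQuadrics_independent (d : k) (c : Fin 6 → Fin 6 → k)
    (h : (quadruplePointPairs.map
      fun p => c p.1 p.2 • (quadruplePointQuadrics d p.1 * quadruplePointQuadrics d p.2)).sum = 0) :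
    ∀ p ∈ quadruplePointPairs, c p.1 p.2 = 0 := by
  have h' := congrArg (kronecker k) h
  simp only [quadruplePointQuadrics, quadruplePointPairs, List.map_cons, List.sum_cons,
    List.map_nil, List.sum_nil, add_zero,
    kronecker, map_add, map_smul, map_mul, aeval_X, map_zero, map_sub, Matrix.cons_val,
    ← pow_succ', ← pow_add, ← pow_succ, sub_mul, mul_sub, smul_mul_assoc, mul_smul_comm,
    smul_smul, smul_sub, Nat.reduceAdd] at h'
  have e := fun n (_ : n ∈ [12, 16, 20, 32, 36, 40, 52, 56, 60, 76, 80, 100, 136, 140, 156, 160,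
      176, 180, 200, 256, 260, 276, 280, 300, 380, 400, 500]) =>
    congrArg (Polynomial.coeff · n) h'
  simp only [Polynomial.coeff_add, Polynomial.coeff_sub, Polynomial.coeff_smul,
    Polynomial.coeff_X_pow, Polynomial.coeff_zero, smul_eq_mul, mul_ite, mul_one, mul_zero,
    List.forall_mem_cons, Nat.reduceEqDiff, if_true, if_false, add_zero, zero_add, sub_zero,
    zero_sub] at e
  obtain ⟨e12, e16, e20, e32, e36, e40, e52, e56, e60, e76, e80, e100, e136, e140, e156,
    e160, e176, e180, e200, e256, e260, e276, e280, e300, e380, e400, e500, -⟩ := e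
  simp only [quadruplePointPairs, List.forall_mem_cons]
  grind

theorem hasExpectedDimensions_quadruplePoint (d : k) (hγ : NondegenerateOn γ (forms k 1))
    (hq : ∀ i, quadruplePointQuadrics d i ∈ nullQuadrics γ) : HasExpectedDimensions γ := by
  have hr : IsRankOne γ (X 1) := by
    refine ⟨Or.inr rfl, hγ, fun i hi => ?_⟩
    fin_cases i
    · exact absurd rfl hi
    · exact hq 0
    · exact hq 1
    · exact hq 2
  have h1 : ∀ p ∈ ([(1, 1), (2, 2)] : List (Fin 6 × Fin 6)), quadruplePointQuadrics d p.1 *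
    quadruplePointQuadrics d p.2 ∈ Submodule.span k
      ((fun p : Fin 6 × Fin 6 => quadruplePointQuadrics d p.1 * quadruplePointQuadrics d p.2) '' {p
        | p ∈ quadruplePointPairs}) := by
    intro p hp
    have hs : ∀ p ∈ quadruplePointPairs, quadruplePointQuadrics d p.1 * quadruplePointQuadrics d
      p.2 ∈ Submodule.span k
      ((fun p : Fin 6 × Fin 6 => quadruplePointQuadrics d p.1 * quadruplePointQuadrics d p.2) '' {p
        | p ∈ quadruplePointPairs}) :=
      fun p hp => Submodule.subset_span ⟨p, hp, rfl⟩
    rw [List.mem_cons, List.mem_singleton] at hp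
    rcases hp with rfl | rfl
    · have e : quadruplePointQuadrics d 1 * quadruplePointQuadrics d 1 =
          (quadruplePointQuadrics d 0 * quadruplePointQuadrics d 3) := by
        simp only [quadruplePointQuadrics, Matrix.cons_val, smul_eq_C_mul]
        ring
      rw [e]
      exact hs (0, 3) (by decide)
    · have e : quadruplePointQuadrics d 2 * quadruplePointQuadrics d 2 =
          (quadruplePointQuadrics d 0 * quadruplePointQuadrics d 5) + d • (quadruplePointQuadrics d
            2 * quadruplePointQuadrics d 3) - d • (quadruplePointQuadrics d 1 *
            quadruplePointQuadrics d 4) := by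
        simp only [quadruplePointQuadrics, Matrix.cons_val, smul_eq_C_mul]
        ring
      rw [e]
      exact sub_mem (add_mem (hs (0, 5) (by decide)) (Submodule.smul_mem _ d (hs (2, 3) (by
        decide)))) (Submodule.smul_mem _ d (hs (1, 4) (by decide)))
  -- On X₀ = 1 the equations give x₁ = x₂x₃, x₂² = 0 and x₃² = d x₂. For d = 0 these are nested dual
  -- numbers. For d ≠ 0 everything is expressed by t = x₃, with x₂ = t²/d and x₁ = t³/d.
  by_cases hd : d = 0
  · subst hd
    refine hasExpectedDimensions_of_quadrics hr hq (L := quadruplePointPairs)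
      (L' := [(1, 1), (2, 2)]) (by decide) rfl (by decide) (by decide) h1
      (quadruplePointQuadrics_independent 0) (Z := DualNumber (DualNumber k))
      ![1, TrivSqZeroExt.inl DualNumber.eps * DualNumber.eps, TrivSqZeroExt.inl DualNumber.eps,
        DualNumber.eps]
      (v₀ := X 0) ?_ (X_mem_forms 0) ?_ ?_
    · intro c hc
      simp [Fin.sum_univ_four, TrivSqZeroExt.ext_iff] at hc
      intro i
      fin_cases i <;> simp [hc]
    · simp
    · intro i
      fin_cases i <;> simp [quadruplePointQuadrics, TrivSqZeroExt.ext_iff]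
  · obtain ⟨mk, hmk⟩ : ∃ f : Polynomial k →ₐ[k] Polynomial k ⧸ Ideal.span
        {(Polynomial.X : Polynomial k) ^ 4}, f = Ideal.Quotient.mkₐ k _ := ⟨_, rfl⟩
    have hmk0 : ∀ p, mk p = 0 ↔ ∀ i < 4, p.coeff i = 0 := fun p => by
      rw [hmk]
      exact mk_span_X_pow_eq_zero_iff
    have ht : mk Polynomial.X ^ 4 = 0 := by
      rw [← map_pow, hmk0]
      intro i hi
      rw [Polynomial.coeff_X_pow, if_neg (by omega)]
    have hdd : mk (Polynomial.C d) * mk (Polynomial.C d⁻¹) = 1 := by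
      rw [← map_mul, ← Polynomial.C_mul, mul_inv_cancel₀ hd, Polynomial.C_1, map_one]
    have hds : ∀ p, d • p = mk (Polynomial.C d) * p := fun p => by
      rw [show mk (Polynomial.C d) = algebraMap k _ d from mk.commutes d]
      exact Algebra.smul_def d p
    refine hasExpectedDimensions_of_quadrics hr hq (L := quadruplePointPairs)
      (L' := [(1, 1), (2, 2)]) (by decide) rfl (by decide) (by decide) h1
      (quadruplePointQuadrics_independent d)
      ![1, mk (Polynomial.C d⁻¹ * Polynomial.X ^ 3), mk (Polynomial.C d⁻¹ * Polynomial.X ^ 2),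
        mk Polynomial.X]
      (v₀ := X 0) ?_ (X_mem_forms 0) ?_ ?_
    · intro c hc
      simp only [Fin.sum_univ_four, Matrix.cons_val, ← map_one mk, ← map_smul, ← map_add] at hc
      have hc' := (hmk0 _).1 hc
      have h0 := hc' 0 (by norm_num)
      have h1 := hc' 1 (by norm_num)
      have h2 := hc' 2 (by norm_num)
      have h3 := hc' 3 (by norm_num)
      simp [Polynomial.coeff_one, Polynomial.coeff_X, hd] at h0 h1 h2 h3
      intro i
      fin_cases i <;> assumption
    · simp
    · intro i
      fin_cases i <;> simp [quadruplePointQuadrics, hds]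
      · linear_combination mk (Polynomial.C d⁻¹) ^ 2 * mk Polynomial.X ^ 2 * ht
      · linear_combination mk (Polynomial.C d⁻¹) ^ 2 * mk Polynomial.X * ht
      · linear_combination mk (Polynomial.C d⁻¹) * ht
      · linear_combination mk (Polynomial.C d⁻¹) ^ 2 * ht
      · ring
      · linear_combination -mk Polynomial.X ^ 2 * hdd

end LengthFour

section Relations

variable {k : Type*} [Field k]

/-! ### Differentiation -/

theorem pderiv_eq_zero_of_mem_varSpan_pow {s : Finset (Fin 4)} {i : Fin 4} (hi : i ∉ s) {d : ℕ}
    {p : MvPolynomial (Fin 4) k} (hp : p ∈ varSpan k s ^ d) : pderiv i p = 0 := by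
  have h1 : ∀ p ∈ varSpan k s, pderiv i p = 0 := by
    intro p hp
    induction hp using Submodule.span_induction with
    | mem x hx =>
      obtain ⟨j, hj, rfl⟩ := hx
      exact pderiv_X_of_ne fun h => hi (by rw [← h]; exact hj)
    | zero => exact map_zero _
    | add x y _ _ hx hy => rw [map_add, hx, hy, add_zero]
    | smul c x _ hx => rw [Derivation.map_smul, hx, smul_zero]
  induction d generalizing p with
  | zero =>
    obtain ⟨c, rfl⟩ := Submodule.mem_one.1 (by rwa [pow_zero] at hp)
    exact Derivation.map_algebraMap _ _
  | succ d ih =>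
    rw [pow_succ] at hp
    induction hp using Submodule.mul_induction_on' with
    | mem_mul_mem x hx y hy =>
      rw [Derivation.leibniz, ih hx, h1 y hy, smul_zero, smul_zero, add_zero]
    | add x _ y _ hx hy => rw [map_add, hx, hy, add_zero]

theorem pderiv_mem_varSpan {s : Finset (Fin 4)} (i : Fin 4) {p : MvPolynomial (Fin 4) k}
    (hp : p ∈ varSpan k s ^ 2) : pderiv i p ∈ varSpan k s := by
  have h1 : ∀ p ∈ varSpan k s, ∃ c : k, pderiv i p = C c := by
    intro p hp
    induction hp using Submodule.span_induction with
    | mem x hx =>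
      obtain ⟨j, hj, rfl⟩ := hx
      rw [pderiv_X]
      by_cases h : j = i
      · subst h
        exact ⟨1, by simp⟩
      · exact ⟨0, by simp [Pi.single_eq_of_ne h]⟩
    | zero => exact ⟨0, by simp⟩
    | add x y _ _ hx hy =>
      obtain ⟨c, hc⟩ := hx
      obtain ⟨c', hc'⟩ := hy
      exact ⟨c + c', by rw [map_add, hc, hc', map_add]⟩
    | smul a x _ hx =>
      obtain ⟨c, hc⟩ := hx
      exact ⟨a * c, by rw [Derivation.map_smul, hc, smul_eq_C_mul, map_mul]⟩
  rw [pow_two] at hp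
  induction hp using Submodule.mul_induction_on' with
  | mem_mul_mem x hx y hy =>
    obtain ⟨c, hc⟩ := h1 x hx
    obtain ⟨c', hc'⟩ := h1 y hy
    rw [Derivation.leibniz, hc, hc', smul_eq_mul, smul_eq_mul, mul_comm x, mul_comm y,
      ← smul_eq_C_mul, ← smul_eq_C_mul]
    exact add_mem (Submodule.smul_mem _ _ hx) (Submodule.smul_mem _ _ hy)
  | add x _ y _ hx hy => rw [map_add]; exact add_mem hx hy

theorem varSpan_le (s : Finset (Fin 4)) : varSpan k s ≤ forms k 1 := by
  rw [← varSpan_univ]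
  exact Submodule.span_mono (Set.image_mono (Finset.coe_subset.2 (Finset.subset_univ s)))

theorem varSpan_pow_le (s : Finset (Fin 4)) (d : ℕ) : varSpan k s ^ d ≤ forms k d := by
  rw [← forms_one_pow]
  exact pow_le_pow_left' (varSpan_le s) d

theorem eq_zero_of_pderiv_eq_zero [CharZero k] {d : ℕ} (hd : d ≠ 0) {p : MvPolynomial (Fin 4) k}
    (hp : p ∈ forms k d) (h : ∀ i, pderiv i p = 0) : p = 0 := by
  have := ((mem_homogeneousSubmodule _ _).1 hp).sum_X_mul_pderiv
  simp only [h, mul_zero, Finset.sum_const_zero] at this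
  exact (smul_eq_zero.1 this.symm).resolve_left hd

/-- A polynomial of degree at most two in the first variable is determined by its coefficients. -/
theorem eq_zero_of_quadratic_eq_zero [CharZero k] {i : Fin 4} {a b c : MvPolynomial (Fin 4) k}
    (ha : pderiv i a = 0) (hb : pderiv i b = 0) (hc : pderiv i c = 0)
    (h : X i * X i * a + X i * b + c = 0) : a = 0 ∧ b = 0 ∧ c = 0 := by
  have h1 := congrArg (pderiv i) h
  simp only [map_add, Derivation.leibniz, pderiv_X_self, ha, hb, hc, smul_eq_mul, mul_zero,
    zero_add, add_zero, mul_one, map_zero] at h1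
  have h2 := congrArg (pderiv i) h1
  simp only [map_add, Derivation.leibniz, pderiv_X_self, ha, hb, smul_eq_mul, mul_zero,
    add_zero, map_zero] at h2
  have ha0 : a = 0 := by
    have : (2 : MvPolynomial (Fin 4) k) * a = 0 := by linear_combination h2
    exact (mul_eq_zero.1 this).resolve_left two_ne_zero
  rw [ha0] at h1 h
  have hb0 : b = 0 := by linear_combination h1
  rw [hb0] at h
  exact ⟨ha0, hb0, by linear_combination h⟩

theorem ternary_quadratic_independent {a b c d e f : k}
    (h : a • (X 1 * X 1) + b • (X 1 * X 2) + c • (X 1 * X 3) + d • (X 2 * X 2) + e • (X 2 * X 3) +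
      f • (X 3 * X 3) = (0 : MvPolynomial (Fin 4) k)) :
    a = 0 ∧ b = 0 ∧ c = 0 ∧ d = 0 ∧ e = 0 ∧ f = 0 := by
  have h' := congrArg (kronecker k) h
  simp only [kronecker, map_add, map_smul, map_mul, aeval_X, map_zero, Matrix.cons_val, ← pow_add,
    Nat.reduceAdd] at h'
  have e := fun n (_ : n ∈ [10, 30, 130, 50, 150, 250]) => congrArg (Polynomial.coeff · n) h'
  simp only [Polynomial.coeff_add, Polynomial.coeff_smul, Polynomial.coeff_X_pow,
    Polynomial.coeff_zero, smul_eq_mul, mul_ite, mul_one, mul_zero, List.forall_mem_cons,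
    Nat.reduceEqDiff, if_true, if_false, add_zero, zero_add] at e
  obtain ⟨e1, e2, e3, e4, e5, e6, -⟩ := e
  exact ⟨e1, e2, e3, e4, e5, e6⟩

/-! ### Algebras whose quadrics satisfy no quadratic relation -/

variable {γ : MvPolynomial (Fin 4) k →ₗ[k] k}

theorem forms_one_eq_sup : forms k 1 = Submodule.span k {X 0} ⊔ lastVars k := by
  rw [← varSpan_univ]
  unfold lastVars varSpan
  rw [← Submodule.span_union]
  congr 1
  ext x
  simp only [Finset.coe_univ, Set.image_univ, Set.mem_range, Set.mem_union, Set.mem_singleton_iff,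
    Set.mem_image, Finset.mem_coe]
  constructor
  · rintro ⟨i, rfl⟩
    fin_cases i
    · exact Or.inl rfl
    all_goals exact Or.inr ⟨_, by decide, rfl⟩
  · rintro (rfl | ⟨i, -, rfl⟩)
    exacts [⟨0, rfl⟩, ⟨i, rfl⟩]

/-- Replacing `lastVars k * forms k 1` twice modulo null quadrics moves every cubic vanishing at
(1,0,0,0) into P³ modulo S₁N₂. Together with w and X₀³ this leaves codimension at most two, and 20 −
2 = 18. -/
theorem le_finrank_forms_mul_nullQuadrics {P : Submodule k (MvPolynomial (Fin 4) k)}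
    {w : MvPolynomial (Fin 4) k} (hP : P ≤ lastVars k)
    (h2 : lastVars k * forms k 1 ≤ nullQuadrics γ ⊔ P ^ 2)
    (h3 : P ^ 3 ≤ forms k 1 * nullQuadrics γ ⊔ Submodule.span k {w}) :
    18 ≤ Module.finrank k ↥(forms k 1 * nullQuadrics γ) := by
  set W := forms k 1 * nullQuadrics γ with hW
  have hle : forms k 3 ≤ W ⊔ Submodule.span k {w, X 0 ^ 3} := by
    have hK : lastVars k * forms k 2 ≤ W ⊔ Submodule.span k {w} := by
      rw [← forms_mul 1 1, ← mul_assoc]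
      refine (mul_le_mul' h2 le_rfl).trans ?_
      rw [Submodule.sup_mul]
      refine sup_le (by rw [mul_comm]; exact le_sup_left) ?_
      rw [pow_two, mul_assoc]
      refine (mul_le_mul' le_rfl ((mul_le_mul' hP le_rfl).trans h2)).trans ?_
      rw [Submodule.mul_sup]
      refine sup_le (le_sup_of_le_left (mul_le_mul' (hP.trans lastVars_le) le_rfl)) ?_
      rw [← pow_succ']
      exact h3
    intro p hp
    have := hK (sub_evalFirst_mem 2 hp)
    rw [← sub_add_cancel p (evalFirst k p • X 0 ^ (2 + 1))]
    refine add_mem ((sup_le_sup (le_refl W) (Submodule.span_mono (Set.singleton_subset_iff.2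
      (Set.mem_insert _ _)))) this) ?_
    exact Submodule.mem_sup_right (Submodule.smul_mem _ _ (Submodule.subset_span (by simp)))
  have hf : FiniteDimensional k W := finiteDimensional_of_le_forms
    ((forms_one_mul_nullQuadrics_le γ).trans (nullCubics_le γ))
  have hf2 : FiniteDimensional k (Submodule.span k {w, (X 0 : MvPolynomial (Fin 4) k) ^ 3}) :=
    FiniteDimensional.span_of_finite k (by simp)
  have h1 := Submodule.finrank_mono hle
  have h4 := Submodule.finrank_add_le_finrank_add_finrank W
    (Submodule.span k {w, (X 0 : MvPolynomial (Fin 4) k) ^ 3})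
  have h5 : Module.finrank k (Submodule.span k {w, (X 0 : MvPolynomial (Fin 4) k) ^ 3}) ≤ 2 :=
    by
    classical
    have := finrank_span_finset_le_card (R := k) ({w, X 0 ^ 3} : Finset (MvPolynomial (Fin 4) k))
    rw [Finset.coe_pair] at this
    exact this.trans Finset.card_le_two
  rw [finrank_forms] at h1
  have : (3 + 3).choose 3 = 20 := by decide
  omega

def allPairs : List (Fin 6 × Fin 6) :=
  [(0, 0), (0, 1), (0, 2), (0, 3), (0, 4), (0, 5), (1, 1), (1, 2), (1, 3), (1, 4), (1, 5),
    (2, 2), (2, 3), (2, 4), (2, 5), (3, 3), (3, 4), (3, 5), (4, 4), (4, 5), (5, 5)]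

/-- This is the outcome β = 1: all 21 products of the six quadrics are independent, and the rank-one
direction supplies the quintics and the inclusion in degree 6. -/
theorem IsRankOne.hasExpectedDimensions {a : MvPolynomial (Fin 4) k} (h : IsRankOne γ a)
    {q : Fin 6 → MvPolynomial (Fin 4) k} (hq : ∀ i, q i ∈ nullQuadrics γ)
    (h2 : ∀ c : Fin 6 → Fin 6 → k,
      (allPairs.map fun p => c p.1 p.2 • (q p.1 * q p.2)).sum = 0 → ∀ p ∈ allPairs, c p.1 p.2 = 0)
    (h18 : Module.finrank k ↥(forms k 1 * nullQuadrics γ) = 18) : HasExpectedDimensions γ := by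
  have hL : allPairs.Nodup := by decide
  have hspan := span_range_eq_nullQuadrics h.nondeg hq
    (linearIndependent_of_products hL (by decide) h2)
  refine ⟨Or.inl ⟨h18, ?_, ?_⟩, h.forms_six_le⟩
  · rw [← hspan, finrank_span_range_mul_self q allPairs [] hL (by decide) (by simp) h2]
    rfl
  · rw [h.nullQuadrics_mul_nullCubics]
    exact h.finrank_nullQuadrics_mul_forms h18

end Relations

/-! ### A cube plus a ternary cubic whose null quadrics have no linear syzygy -/

section Relations

variable {k : Type*} [Field k]

theorem exists_le_sup_span_singleton {M : Type*} [AddCommGroup M] [Module k M]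
    {U V : Submodule k M} [FiniteDimensional k V] (hUV : U ≤ V)
    (h : Module.finrank k V ≤ Module.finrank k U + 1) : ∃ w, V ≤ U ⊔ Submodule.span k {w} := by
  by_cases hVU : V ≤ U
  · exact ⟨0, hVU.trans le_sup_left⟩
  · obtain ⟨w, hw, hwU⟩ := SetLike.not_le_iff_exists.1 hVU
    refine ⟨w, ?_⟩
    have hle : U ⊔ Submodule.span k {w} ≤ V :=
      sup_le hUV ((Submodule.span_singleton_le_iff_mem _ _).2 hw)
    have hf := Submodule.finiteDimensional_of_le hle
    have hlt : U < U ⊔ Submodule.span k {w} :=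
      lt_of_le_of_ne le_sup_left fun he => hwU (by
        rw [he]
        exact Submodule.mem_sup_right (Submodule.mem_span_singleton_self w))
    have := Submodule.finrank_lt_finrank_of_lt hlt
    exact (Submodule.eq_of_le_of_finrank_le hle (by omega)).ge

/-- The multiplication map from Vⁿ to VU is onto. If VU has dimension at least n · dim V, the map is
also injective, which excludes linear syzygies. -/
theorem syzygy_eq_zero {A : Type*} [CommRing A] [Algebra k A] {V U : Submodule k A}
    [FiniteDimensional k V] {n : ℕ} {J : Fin n → A} (hU : U = Submodule.span k (Set.range J))
    (h : n * Module.finrank k V ≤ Module.finrank k ↥(V * U)) {l : Fin n → A}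
    (hl : ∀ j, l j ∈ V) (h0 : ∑ j, l j * J j = 0) (j : Fin n) : l j = 0 := by
  let f : (Fin n → V) →ₗ[k] A :=
    ∑ j, (LinearMap.mulRight k (J j)) ∘ₗ V.subtype ∘ₗ LinearMap.proj j
  have hf : ∀ x, f x = ∑ j, (x j : A) * J j := fun x => by
    simp [f, LinearMap.sum_apply]
  have hr : V * U ≤ LinearMap.range f := by
    rw [Submodule.mul_le]
    intro v hv u hu
    rw [hU, Submodule.mem_span_range_iff_exists_fun] at hu
    obtain ⟨c, rfl⟩ := hu
    refine ⟨fun j => c j • ⟨v, hv⟩, ?_⟩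
    rw [hf, Finset.mul_sum]
    refine Finset.sum_congr rfl fun j _ => ?_
    rw [Submodule.coe_smul, smul_mul_assoc, mul_smul_comm]
  have h1 := Submodule.finrank_mono hr
  have h2 := LinearMap.finrank_range_add_finrank_ker f
  rw [Module.finrank_pi_fintype, Finset.sum_const, Finset.card_univ, Fintype.card_fin,
    smul_eq_mul] at h2
  have h3 : LinearMap.ker f = ⊥ := Submodule.finrank_eq_zero.1 (by omega)
  have h4 : (fun j => ⟨l j, hl j⟩ : Fin n → V) ∈ LinearMap.ker f := by
    change f _ = 0
    rw [hf]
    exact h0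
  rw [h3, Submodule.mem_bot] at h4
  exact congrArg Subtype.val (congrFun h4 j)

theorem aeval_eq_self_of_mem_varSpan_pow {s : Finset (Fin 4)} {f : Fin 4 → MvPolynomial (Fin 4) k}
    (hf : ∀ i ∈ s, f i = X i) {d : ℕ} {p : MvPolynomial (Fin 4) k} (hp : p ∈ varSpan k s ^ d) :
    aeval f p = p := by
  have hs : ∀ x ∈ varSpan k s, aeval f x = x := by
    intro x hx
    induction hx using Submodule.span_induction with
    | mem x hx =>
      obtain ⟨j, hj, rfl⟩ := hx
      rw [aeval_X, hf j hj]
    | zero => exact map_zero _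
    | add x y _ _ hx hy => rw [map_add, hx, hy]
    | smul c x _ hx => rw [map_smul, hx]
  induction d generalizing p with
  | zero =>
    obtain ⟨c, rfl⟩ := Submodule.mem_one.1 (by rwa [pow_zero] at hp)
    exact AlgHom.commutes _ _
  | succ d ih =>
    rw [pow_succ] at hp
    induction hp using Submodule.mul_induction_on' with
    | mem_mul_mem x hx y hy => rw [map_mul, ih hx, hs y hy]
    | add x _ y _ hx hy => rw [map_add, hx, hy]

variable {γ : MvPolynomial (Fin 4) k →ₗ[k] k}

theorem ternary_linear_independent {a b c : k}
    (h : a • X 1 + b • X 2 + c • X 3 = (0 : MvPolynomial (Fin 4) k)) :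
    a = 0 ∧ b = 0 ∧ c = 0 := by
  have := ternary_quadratic_independent (a := a) (b := b) (c := c) (d := 0) (e := 0) (f := 0)
    (by
      simp only [smul_eq_C_mul, map_zero] at h ⊢
      linear_combination X 1 * h)
  exact ⟨this.1, this.2.1, this.2.2.1⟩

namespace IsRankOne

theorem apply_X_zero_mul (h : IsRankOne γ (X 0)) {p : MvPolynomial (Fin 4) k}
    (hp : p ∈ lastVars k * forms k 1) : γ (X 0 * p) = 0 := by
  have := lastVars_mul_forms_le 1 hp
  rw [h.apply_mul this, evalFirst_eq_zero_of_mem hp, zero_mul]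

theorem quadAnn_le (h : IsRankOne γ (X 0)) : quadAnn γ (lastVars k) ≤ nullQuadrics γ := by
  intro q hq
  obtain ⟨hq2, hq0⟩ := mem_quadAnn.1 hq
  refine mem_nullQuadrics.2 ⟨varSpan_pow_le _ 2 hq2, fun v hv => ?_⟩
  rw [forms_one_eq_sup] at hv
  obtain ⟨x, hx, u, hu, rfl⟩ := Submodule.mem_sup.1 hv
  obtain ⟨c, rfl⟩ := Submodule.mem_span_singleton.1 hx
  rw [add_mul, map_add, hq0 u hu, smul_mul_assoc, map_smul, h.apply_X_zero_mul, smul_zero,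
    add_zero]
  rw [pow_two] at hq2
  exact mul_le_mul' le_rfl lastVars_le hq2

/-- By `apply_X_zero_mul`, mixed products with `X 0` do not contribute to γ, so a ternary form with
zero ternary contraction has zero contraction altogether. -/
theorem nondegenerateOn_lastVars (h : IsRankOne γ (X 0)) : NondegenerateOn γ (lastVars k) := by
  intro v hv hv0
  refine h.nondeg v (lastVars_le hv) fun p hp => ?_
  have hv1 : ∀ w ∈ lastVars k * forms k 1, (γ ∘ₗ LinearMap.mulLeft k v) w = 0 := by
    refine functional_eq_zero_on_mul fun u hu w hw => ?_
    rw [forms_one_eq_sup] at hw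
    obtain ⟨x, hx, u', hu', rfl⟩ := Submodule.mem_sup.1 hw
    obtain ⟨c, rfl⟩ := Submodule.mem_span_singleton.1 hx
    have h1 := hv0 (u * u') (by rw [pow_two]; exact Submodule.mul_mem_mul hu hu')
    have h2 := h.apply_X_zero_mul (Submodule.mul_mem_mul hv (lastVars_le hu))
    rw [LinearMap.comp_apply, LinearMap.mulLeft_apply, mul_add, mul_add, map_add, h1, add_zero,
      mul_smul_comm, mul_smul_comm, map_smul, mul_comm u, mul_left_comm, h2, smul_zero]
  have hp' := sub_evalFirst_mem 1 (by rwa [forms_one_pow] at hp)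
  have h1 := hv1 _ hp'
  have h2 : γ (v * X 0 ^ 2) = 0 := by
    rw [pow_two, mul_left_comm]
    exact h.apply_X_zero_mul (Submodule.mul_mem_mul hv (X_mem_forms 0))
  rw [LinearMap.comp_apply, LinearMap.mulLeft_apply, mul_sub, map_sub, mul_smul_comm, map_smul,
    h2, smul_zero, sub_zero] at h1
  exact h1

theorem finrank_quadAnn_lastVars (h : IsRankOne γ (X 0)) :
    Module.finrank k ↥(quadAnn γ (lastVars k)) = 3 := by
  have hf : FiniteDimensional k (lastVars k) := finiteDimensional_of_le_forms lastVars_le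
  have hf2 : FiniteDimensional k ↥(lastVars k ^ 2) :=
    finiteDimensional_of_le_forms (varSpan_pow_le _ 2)
  have := finrank_quadAnn h.nondegenerateOn_lastVars
  rw [finrank_varSpan_pow, finrank_varSpan] at this
  have e : (({1, 2, 3} : Finset (Fin 4)).card + 2 - 1).choose 2 = 6 := by decide
  have e' : ({1, 2, 3} : Finset (Fin 4)).card = 3 := by decide
  omega

end IsRankOne

theorem exists_basis_of_finrank {A : Type*} [AddCommGroup A] [Module k A] {U : Submodule k A}
    {n : ℕ} [FiniteDimensional k U] (h : Module.finrank k U = n) :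
    ∃ J : Fin n → A, U = Submodule.span k (Set.range J) ∧ ∀ j, J j ∈ U := by
  let b := Module.finBasisOfFinrankEq k U h
  refine ⟨fun j => b j, ?_, fun j => (b j).2⟩
  have := congrArg (Submodule.map U.subtype) b.span_eq
  rw [Submodule.map_span, ← Set.range_comp, Submodule.map_top, Submodule.range_subtype] at this
  exact this.symm

theorem card_lastVars : ({1, 2, 3} : Finset (Fin 4)).card = 3 := by decide

/-- If three ternary quadrics have no linear syzygy, their products are linearly independent. -/
theorem quadratic_independent_of_syzygy [CharZero k] {J : Fin 3 → MvPolynomial (Fin 4) k}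
    (hJ2 : ∀ j, J j ∈ lastVars k ^ 2) (hX1 : (X 1 : MvPolynomial (Fin 4) k) ∈ lastVars k)
    (hsyz : ∀ l : Fin 3 → MvPolynomial (Fin 4) k, (∀ j, l j ∈ lastVars k) →
      l 0 * J 0 + l 1 * J 1 + l 2 * J 2 = 0 → ∀ j, l j = 0) {c : Fin 6 → Fin 6 → k}
    (hC : c 3 3 • (J 0 * J 0) + c 3 4 • (J 0 * J 1) + c 3 5 • (J 0 * J 2) +
      c 4 4 • (J 1 * J 1) + c 4 5 • (J 1 * J 2) + c 5 5 • (J 2 * J 2) = 0) :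
    c 3 3 = 0 ∧ c 3 4 = 0 ∧ c 3 5 = 0 ∧ c 4 4 = 0 ∧ c 4 5 = 0 ∧ c 5 5 = 0 := by
  have hJind : ∀ a b d : k, a • J 0 + b • J 1 + d • J 2 = 0 → a = 0 ∧ b = 0 ∧ d = 0 := by
    intro a b d h0
    have := hsyz ![a • X 1, b • X 1, d • X 1]
      (fun j => by fin_cases j <;> exact Submodule.smul_mem _ _ hX1) (by
        simp only [smul_eq_C_mul, Matrix.cons_val] at h0 ⊢
        linear_combination X 1 * h0)
    have hz : ∀ a : k, a • (X 1 : MvPolynomial (Fin 4) k) = 0 → a = 0 := fun a ha =>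
      (smul_eq_zero.1 ha).resolve_right (X_ne_zero _)
    exact ⟨hz a (this 0), hz b (this 1), hz d (this 2)⟩
  -- Differentiating Q(J) = 0 gives Σ Lⱼ ∂ᵤJⱼ = 0 with Lⱼ = ∂Q/∂Jⱼ linear in the J's. As Q is
  -- symmetric this is also Σ (∂ᵤLⱼ)Jⱼ = 0, a linear syzygy. Hence all derivatives of Lⱼ vanish, and
  -- Lⱼ = 0 by Euler's identity.
  have hC' := fun u => hsyz ![pderiv u ((2 * c 3 3) • J 0 + c 3 4 • J 1 + c 3 5 • J 2),
      pderiv u (c 3 4 • J 0 + (2 * c 4 4) • J 1 + c 4 5 • J 2),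
      pderiv u (c 3 5 • J 0 + c 4 5 • J 1 + (2 * c 5 5) • J 2)]
    (fun j => by
      have hm : ∀ a b d : k, a • J 0 + b • J 1 + d • J 2 ∈ lastVars k ^ 2 := fun a b d =>
        add_mem (add_mem (Submodule.smul_mem _ _ (hJ2 0)) (Submodule.smul_mem _ _ (hJ2 1)))
          (Submodule.smul_mem _ _ (hJ2 2))
      fin_cases j <;> exact pderiv_mem_varSpan u (hm _ _ _))
    (by
      have := congrArg (pderiv u) hC
      simp only [map_add, Derivation.map_smul, Derivation.leibniz, smul_eq_mul, map_zero,
        Matrix.cons_val] at this ⊢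
      simp only [smul_eq_C_mul, map_mul, map_ofNat] at this ⊢
      linear_combination this)
  have hP : ∀ a b d : k, (∀ u, pderiv u (a • J 0 + b • J 1 + d • J 2) = 0) →
      a = 0 ∧ b = 0 ∧ d = 0 := fun a b d h0 =>
    hJind a b d (eq_zero_of_pderiv_eq_zero two_ne_zero (add_mem (add_mem
      (Submodule.smul_mem _ _ (varSpan_pow_le _ 2 (hJ2 0)))
      (Submodule.smul_mem _ _ (varSpan_pow_le _ 2 (hJ2 1))))
      (Submodule.smul_mem _ _ (varSpan_pow_le _ 2 (hJ2 2)))) h0)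
  obtain ⟨e1, e2, e3⟩ := hP _ _ _ fun u => hC' u 0
  obtain ⟨-, e4, e5⟩ := hP _ _ _ fun u => hC' u 1
  obtain ⟨-, -, e6⟩ := hP _ _ _ fun u => hC' u 2
  have h2 : (2 : k) ≠ 0 := two_ne_zero
  simp only [mul_eq_zero, h2, false_or] at e1 e4 e6
  exact ⟨e1, e2, e3, e4, e5, e6⟩

/-- The relation is graded by powers of `X 0`. The part of degree two is a relation among ternary
monomials, the part of degree one a linear syzygy of the J's, and the part of degree zero a
quadratic relation among them. -/
theorem relation_cone [CharZero k]
    (h9 : 9 ≤ Module.finrank k ↥(lastVars k * quadAnn γ (lastVars k)))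
    {J : Fin 3 → MvPolynomial (Fin 4) k}
    (hJ : quadAnn γ (lastVars k) = Submodule.span k (Set.range J))
    (hJm : ∀ j, J j ∈ quadAnn γ (lastVars k)) (c : Fin 6 → Fin 6 → k)
    (hc : (allPairs.map fun p => c p.1 p.2 •
      ((![X 0 * X 1, X 0 * X 2, X 0 * X 3, J 0, J 1, J 2] : Fin 6 → MvPolynomial (Fin 4) k) p.1 *
        (![X 0 * X 1, X 0 * X 2, X 0 * X 3, J 0, J 1, J 2] : Fin 6 → _) p.2)).sum = 0) :
    ∀ p ∈ allPairs, c p.1 p.2 = 0 := by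
  have hf : FiniteDimensional k (lastVars k) := finiteDimensional_of_le_forms lastVars_le
  have hsyz : ∀ l : Fin 3 → MvPolynomial (Fin 4) k, (∀ j, l j ∈ lastVars k) →
      l 0 * J 0 + l 1 * J 1 + l 2 * J 2 = 0 → ∀ j, l j = 0 := fun l hl h0 =>
    syzygy_eq_zero hJ (by rw [finrank_varSpan, card_lastVars]; exact h9) hl
      (by rw [Fin.sum_univ_three]; exact h0)
  have hX1 : (X 1 : MvPolynomial (Fin 4) k) ∈ lastVars k := X_mem_lastVars (by decide)
  have hX2 : (X 2 : MvPolynomial (Fin 4) k) ∈ lastVars k := X_mem_lastVars (by decide)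
  have hX3 : (X 3 : MvPolynomial (Fin 4) k) ∈ lastVars k := X_mem_lastVars (by decide)
  have hJ2 : ∀ j, J j ∈ lastVars k ^ 2 := fun j => (mem_quadAnn.1 (hJm j)).1
  have hd : ∀ j, pderiv 0 (J j) = 0 := fun j =>
    pderiv_eq_zero_of_mem_varSpan_pow (by decide) (hJ2 j)
  simp only [allPairs, List.map_cons, List.map_nil, List.sum_cons, List.sum_nil,
    Matrix.cons_val] at hc
  have d1 : pderiv 0 (X 1 : MvPolynomial (Fin 4) k) = 0 := pderiv_X_of_ne (by decide)
  have d2 : pderiv 0 (X 2 : MvPolynomial (Fin 4) k) = 0 := pderiv_X_of_ne (by decide)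
  have d3 : pderiv 0 (X 3 : MvPolynomial (Fin 4) k) = 0 := pderiv_X_of_ne (by decide)
  obtain ⟨hA, hB, hC⟩ := eq_zero_of_quadratic_eq_zero (i := 0)
    (a := c 0 0 • (X 1 * X 1) + c 0 1 • (X 1 * X 2) + c 0 2 • (X 1 * X 3) + c 1 1 • (X 2 * X 2) +
      c 1 2 • (X 2 * X 3) + c 2 2 • (X 3 * X 3))
    (b := (c 0 3 • X 1 + c 1 3 • X 2 + c 2 3 • X 3) * J 0 +
      (c 0 4 • X 1 + c 1 4 • X 2 + c 2 4 • X 3) * J 1 +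
      (c 0 5 • X 1 + c 1 5 • X 2 + c 2 5 • X 3) * J 2)
    (c := c 3 3 • (J 0 * J 0) + c 3 4 • (J 0 * J 1) + c 3 5 • (J 0 * J 2) + c 4 4 • (J 1 * J 1) +
      c 4 5 • (J 1 * J 2) + c 5 5 • (J 2 * J 2))
    (by simp [Derivation.leibniz, d1, d2, d3]) (by simp [Derivation.leibniz, d1, d2, d3, hd])
    (by simp [Derivation.leibniz, hd]) (by
      rw [← hc]
      simp only [smul_eq_C_mul]
      ring)
  obtain ⟨a1, a2, a3, a4, a5, a6⟩ := ternary_quadratic_independent hA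
  have hlin : ∀ a b d : k, a • X 1 + b • X 2 + d • X 3 ∈ lastVars k := fun a b d =>
    add_mem (add_mem (Submodule.smul_mem _ _ hX1) (Submodule.smul_mem _ _ hX2))
      (Submodule.smul_mem _ _ hX3)
  have hB' := hsyz ![c 0 3 • X 1 + c 1 3 • X 2 + c 2 3 • X 3,
    c 0 4 • X 1 + c 1 4 • X 2 + c 2 4 • X 3, c 0 5 • X 1 + c 1 5 • X 2 + c 2 5 • X 3]
    (fun j => by fin_cases j <;> exact hlin _ _ _) hB
  obtain ⟨b1, b2, b3⟩ := ternary_linear_independent (hB' 0)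
  obtain ⟨b4, b5, b6⟩ := ternary_linear_independent (hB' 1)
  obtain ⟨b7, b8, b9⟩ := ternary_linear_independent (hB' 2)
  obtain ⟨e1, e2, e3, e4, e5, e6⟩ := quadratic_independent_of_syzygy hJ2 hX1 hsyz hC
  simp only [allPairs, List.forall_mem_cons]
  exact ⟨a1, a2, a3, b1, b4, b7, a4, a5, b2, b5, b8, a6, b3, b6, b9, e1, e2, e3, e4, e5, e6,
    fun _ h => absurd h List.not_mem_nil⟩

/-- The case in which `γ` is a cube of a linear form plus a ternary cubic whose apolar algebra is a
complete intersection. -/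
theorem hasExpectedDimensions_cone [CharZero k] (h : IsRankOne γ (X 0))
    (h9 : 9 ≤ Module.finrank k ↥(lastVars k * quadAnn γ (lastVars k)))
    (h18 : Module.finrank k ↥(forms k 1 * nullQuadrics γ) ≤ 18) : HasExpectedDimensions γ := by
  have hf : FiniteDimensional k (quadAnn γ (lastVars k)) :=
    finiteDimensional_of_le_forms (h.quadAnn_le.trans (nullQuadrics_le γ))
  obtain ⟨J, hJ, hJm⟩ := exists_basis_of_finrank h.finrank_quadAnn_lastVars
  have hf3 : FiniteDimensional k ↥(lastVars k ^ 3) :=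
    finiteDimensional_of_le_forms (varSpan_pow_le _ 3)
  have hle : lastVars k * quadAnn γ (lastVars k) ≤ lastVars k ^ 3 := by
    rw [pow_succ' _ 2]
    exact mul_le_mul' le_rfl fun x hx => (mem_quadAnn.1 hx).1
  -- Ternary cubics have dimension 10, and at least 9 of it is filled.
  obtain ⟨w, hw⟩ := exists_le_sup_span_singleton hle (by
    rw [finrank_varSpan_pow]
    have e : (({1, 2, 3} : Finset (Fin 4)).card + 3 - 1).choose 3 = 10 := by decide
    omega)
  have h18' := le_finrank_forms_mul_nullQuadrics (γ := γ) (P := lastVars k) (w := w) le_rfl ?_ ?_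
  · refine h.hasExpectedDimensions (fun i => ?_) (relation_cone h9 hJ hJm)
      (le_antisymm h18 h18')
    fin_cases i
    · exact h.mem 1 (by decide)
    · exact h.mem 2 (by decide)
    · exact h.mem 3 (by decide)
    · exact h.quadAnn_le (hJm 0)
    · exact h.quadAnn_le (hJm 1)
    · exact h.quadAnn_le (hJm 2)
  · rw [forms_one_eq_sup, Submodule.mul_sup, ← pow_two]
    refine sup_le_sup ?_ le_rfl
    rw [mul_comm, Submodule.mul_le]
    intro x hx v hv
    obtain ⟨c, rfl⟩ := Submodule.mem_span_singleton.1 hx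
    rw [smul_mul_assoc]
    exact Submodule.smul_mem _ _ (h.mul_mem hv)
  · exact hw.trans (sup_le_sup (mul_le_mul' lastVars_le h.quadAnn_le) le_rfl)

end Relations

/-! ### The tangent case without quadratic relations -/

section Relations

variable {k : Type*} [Field k]

/-- Again the relation is expanded in powers of `X 0`. Its two higher coefficients kill or pair off
the unknowns, and what is left of the lowest coefficient is divisible by `X 1`; its value at X₁ = 0
is a relation of the kind excluded by `hind`. -/
theorem relation_tangent [CharZero k] {n m m' : MvPolynomial (Fin 4) k}
    (hn : n ∈ varSpan k {2, 3} ^ 2) (hm : m ∈ varSpan k {2, 3} ^ 2)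
    (hm' : m' ∈ varSpan k {2, 3} ^ 2)
    (hind : ∀ a b c : k, a • (X 2 * n) + b • (X 3 * n) + c • (X 3 * m - X 2 * m') = 0 →
      a = 0 ∧ b = 0 ∧ c = 0) (c : Fin 6 → Fin 6 → k)
    (hc : (allPairs.map fun p => c p.1 p.2 •
      ((![X 1 * X 1, X 1 * X 2, X 1 * X 3, X 0 * X 1 + n, X 0 * X 2 + m, X 0 * X 3 + m'] :
          Fin 6 → MvPolynomial (Fin 4) k) p.1 *
        (![X 1 * X 1, X 1 * X 2, X 1 * X 3, X 0 * X 1 + n, X 0 * X 2 + m, X 0 * X 3 + m'] :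
          Fin 6 → _) p.2)).sum = 0) :
    ∀ p ∈ allPairs, c p.1 p.2 = 0 := by
  simp only [allPairs, List.map_cons, List.map_nil, List.sum_cons, List.sum_nil,
    Matrix.cons_val] at hc
  have d1 : pderiv 0 (X 1 : MvPolynomial (Fin 4) k) = 0 := pderiv_X_of_ne (by decide)
  have d2 : pderiv 0 (X 2 : MvPolynomial (Fin 4) k) = 0 := pderiv_X_of_ne (by decide)
  have d3 : pderiv 0 (X 3 : MvPolynomial (Fin 4) k) = 0 := pderiv_X_of_ne (by decide)
  have hd : ∀ {x : MvPolynomial (Fin 4) k}, x ∈ varSpan k {2, 3} ^ 2 → pderiv 0 x = 0 :=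
    fun hx => pderiv_eq_zero_of_mem_varSpan_pow (by decide) hx
  have hn0 := hd hn
  have hm0 := hd hm
  have hm0' := hd hm'
  obtain ⟨hA, hB, hC⟩ := eq_zero_of_quadratic_eq_zero (i := 0)
    (a := c 3 3 • (X 1 * X 1) + c 3 4 • (X 1 * X 2) + c 3 5 • (X 1 * X 3) + c 4 4 • (X 2 * X 2) +
      c 4 5 • (X 2 * X 3) + c 5 5 • (X 3 * X 3))
    (b := X 1 * (c 0 3 • (X 1 * X 1) + (c 0 4 + c 1 3) • (X 1 * X 2) +
      (c 0 5 + c 2 3) • (X 1 * X 3) + c 1 4 • (X 2 * X 2) + (c 1 5 + c 2 4) • (X 2 * X 3) +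
      c 2 5 • (X 3 * X 3)) + c 3 3 • (X 1 * n + X 1 * n) + c 3 4 • (X 1 * m + X 2 * n) +
      c 3 5 • (X 1 * m' + X 3 * n) + c 4 4 • (X 2 * m + X 2 * m) + c 4 5 • (X 2 * m' + X 3 * m) +
      c 5 5 • (X 3 * m' + X 3 * m'))
    (c := X 1 * X 1 * (c 0 0 • (X 1 * X 1) + c 0 1 • (X 1 * X 2) + c 0 2 • (X 1 * X 3) +
      c 1 1 • (X 2 * X 2) + c 1 2 • (X 2 * X 3) + c 2 2 • (X 3 * X 3)) +
      X 1 * (c 0 3 • (X 1 * n) + c 0 4 • (X 1 * m) + c 0 5 • (X 1 * m') + c 1 3 • (X 2 * n) +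
        c 1 4 • (X 2 * m) + c 1 5 • (X 2 * m') + c 2 3 • (X 3 * n) + c 2 4 • (X 3 * m) +
        c 2 5 • (X 3 * m')) +
      (c 3 3 • (n * n) + c 3 4 • (n * m) + c 3 5 • (n * m') + c 4 4 • (m * m) + c 4 5 • (m * m') +
        c 5 5 • (m' * m')))
    (by simp [Derivation.leibniz, d1, d2, d3])
    (by simp [Derivation.leibniz, d1, d2, d3, hn0, hm0, hm0'])
    (by simp [Derivation.leibniz, d1, d2, d3, hn0, hm0, hm0']) (by
      rw [← hc]
      simp only [smul_eq_C_mul, map_add]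
      ring)
  obtain ⟨e1, e2, e3, e4, e5, e6⟩ := ternary_quadratic_independent hA
  simp only [e1, e2, e3, e4, e5, e6, zero_smul, add_zero] at hB hC
  have hX1 : (X 1 : MvPolynomial (Fin 4) k) ≠ 0 := X_ne_zero _
  obtain ⟨b1, b2, b3, b4, b5, b6⟩ := ternary_quadratic_independent
    ((mul_eq_zero.1 hB).resolve_left hX1)
  rw [b1, b4, b6, eq_neg_of_add_eq_zero_right b2, eq_neg_of_add_eq_zero_right b3,
    eq_neg_of_add_eq_zero_right b5, mul_assoc, ← mul_add] at hC
  have hC' := (mul_eq_zero.1 hC).resolve_left hX1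
  have hψ : ∀ {x : MvPolynomial (Fin 4) k}, x ∈ varSpan k {2, 3} ^ 2 →
      aeval (R := k) ![X 0, 0, X 2, X 3] x = x :=
    fun hx => aeval_eq_self_of_mem_varSpan_pow (by simp) hx
  -- Setting X₁ = 0 leaves the binary forms `n`, `m`, `m'` unchanged.
  have h1 := congrArg (aeval (R := k) (![X 0, 0, X 2, X 3] : Fin 4 → MvPolynomial (Fin 4) k)) hC'
  simp only [map_add, map_mul, map_smul, aeval_X, hψ hn, hψ hm, hψ hm', Matrix.cons_val, zero_mul,
    smul_zero, zero_add, zero_smul, add_zero, map_zero] at h1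
  obtain ⟨f1, f2, f3⟩ := hind (-c 0 4) (-c 0 5) (-c 1 5) (by
    rw [← h1]
    simp only [smul_eq_C_mul, map_neg]
    ring)
  rw [neg_eq_zero] at f1 f2 f3
  rw [f1, zero_add] at b2
  rw [f2, zero_add] at b3
  rw [f3, zero_add] at b5
  simp only [f1, f2, f3, neg_zero, zero_smul, add_zero] at hC'
  obtain ⟨a1, a2, a3, a4, a5, a6⟩ := ternary_quadratic_independent
    ((mul_eq_zero.1 hC').resolve_left hX1)
  simp only [allPairs, List.forall_mem_cons]
  exact ⟨a1, a2, a3, b1, f1, f2, a4, a5, b2, b4, f3, a6, b3, b5, b6, e1, e2, e3, e4, e5, e6,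
    fun _ h => absurd h List.not_mem_nil⟩

variable {γ : MvPolynomial (Fin 4) k →ₗ[k] k}

theorem lastVars_eq_sup : lastVars k = Submodule.span k {X 1} ⊔ varSpan k {2, 3} := by
  unfold lastVars varSpan
  rw [← Submodule.span_union]
  congr 1
  ext x
  simp [Set.image_insert_eq]
  tauto

/-- The case in which `X 1` annihilates the last three variables, and the binary parts `n`, `m`, `m'`
of the other null quadrics make the cubics `X 2 * n`, `X 3 * n`, `X 3 * m - X 2 * m'` linearly
independent. -/
theorem hasExpectedDimensions_tangent [CharZero k] (h : IsRankOne γ (X 1))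
    {n m m' : MvPolynomial (Fin 4) k}
    (hn : n ∈ varSpan k {2, 3} ^ 2) (hm : m ∈ varSpan k {2, 3} ^ 2)
    (hm' : m' ∈ varSpan k {2, 3} ^ 2) (h1 : X 0 * X 1 + n ∈ nullQuadrics γ)
    (h2 : X 0 * X 2 + m ∈ nullQuadrics γ) (h3 : X 0 * X 3 + m' ∈ nullQuadrics γ)
    (hind : ∀ a b c : k, a • (X 2 * n) + b • (X 3 * n) + c • (X 3 * m - X 2 * m') = 0 →
      a = 0 ∧ b = 0 ∧ c = 0)
    (h18 : Module.finrank k ↥(forms k 1 * nullQuadrics γ) ≤ 18) : HasExpectedDimensions γ := by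
  set P := varSpan k {2, 3} with hP
  have hPK : P ≤ lastVars k := by rw [lastVars_eq_sup]; exact le_sup_right
  have hX2 : (X 2 : MvPolynomial (Fin 4) k) ∈ P := Submodule.subset_span ⟨2, by simp, rfl⟩
  have hX3 : (X 3 : MvPolynomial (Fin 4) k) ∈ P := Submodule.subset_span ⟨3, by simp, rfl⟩
  have hX11 : X 1 * X 1 ∈ nullQuadrics γ := h.mem 1 (by decide)
  have hX12 : X 1 * X 2 ∈ nullQuadrics γ := h.mem 2 (by decide)
  have hX13 : X 1 * X 3 ∈ nullQuadrics γ := h.mem 3 (by decide)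
  let f : Fin 3 → MvPolynomial (Fin 4) k := ![X 2 * n, X 3 * n, X 3 * m - X 2 * m']
  have hfli : LinearIndependent k f := by
    rw [Fintype.linearIndependent_iff]
    intro c hc
    rw [Fin.sum_univ_three] at hc
    obtain ⟨c0, c1, c2⟩ := hind _ _ _ hc
    intro i
    fin_cases i
    exacts [c0, c1, c2]
  have hfP : Submodule.span k (Set.range f) ≤ P ^ 3 := by
    rw [Submodule.span_le, pow_succ' _ 2]
    rintro _ ⟨i, rfl⟩
    fin_cases i
    · exact Submodule.mul_mem_mul hX2 hn
    · exact Submodule.mul_mem_mul hX3 hn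
    · exact sub_mem (Submodule.mul_mem_mul hX3 hm) (Submodule.mul_mem_mul hX2 hm')
  have hmul : ∀ i, ∀ q ∈ nullQuadrics γ, X i * q ∈ forms k 1 * nullQuadrics γ := fun i q hq =>
    Submodule.mul_mem_mul (X_mem_forms i) hq
  -- In each combination the terms divisible by `X 0` cancel, leaving a binary cubic.
  have hfN : Submodule.span k (Set.range f) ≤ forms k 1 * nullQuadrics γ := by
    rw [Submodule.span_le]
    rintro _ ⟨i, rfl⟩
    fin_cases i
    · have := sub_mem (hmul 2 _ h1) (hmul 0 _ hX12)
      rwa [show X 2 * (X 0 * X 1 + n) - X 0 * (X 1 * X 2) = f 0 by simp only [f, Matrix.cons_val]; ring]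
        at this
    · have := sub_mem (hmul 3 _ h1) (hmul 0 _ hX13)
      rwa [show X 3 * (X 0 * X 1 + n) - X 0 * (X 1 * X 3) = f 1 by simp only [f, Matrix.cons_val]; ring]
        at this
    · have := sub_mem (hmul 3 _ h2) (hmul 2 _ h3)
      rwa [show X 3 * (X 0 * X 2 + m) - X 2 * (X 0 * X 3 + m') = f 2 by
        simp only [f, Matrix.cons_val]; ring] at this
  have hf3 : FiniteDimensional k ↥(P ^ 3) := finiteDimensional_of_le_forms (varSpan_pow_le _ 3)
  -- Binary cubics have dimension four, so three independent ones leave at most one direction.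
  obtain ⟨w, hw⟩ := exists_le_sup_span_singleton hfP (by
    rw [hP, finrank_varSpan_pow, finrank_span_eq_card hfli, Fintype.card_fin]
    decide)
  have h18' := le_finrank_forms_mul_nullQuadrics (γ := γ) (P := P) (w := w) hPK ?_ ?_
  · refine h.hasExpectedDimensions (fun i => ?_) (relation_tangent hn hm hm' hind)
      (le_antisymm h18 h18')
    fin_cases i
    exacts [hX11, hX12, hX13, h1, h2, h3]
  · have hPn : ∀ x ∈ P ^ 2, x ∈ nullQuadrics γ ⊔ P ^ 2 := fun x hx => Submodule.mem_sup_right hx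
    have hNn : ∀ x ∈ nullQuadrics γ, x ∈ nullQuadrics γ ⊔ P ^ 2 := fun x hx =>
      Submodule.mem_sup_left hx
    have hX0 : ∀ v ∈ lastVars k, v * X 0 ∈ nullQuadrics γ ⊔ P ^ 2 := by
      intro v hv
      refine lastVars_induction (P := fun v => v * X 0 ∈ nullQuadrics γ ⊔ P ^ 2)
        (by rw [zero_mul]; exact zero_mem _) (fun i hi => ?_)
        (fun x y hx hy => by rw [add_mul]; exact add_mem hx hy)
        (fun c x hx => by rw [smul_mul_assoc]; exact Submodule.smul_mem _ _ hx) hv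
      fin_cases i
      · exact absurd rfl hi
      · have := sub_mem (hNn _ h1) (hPn _ hn)
        rwa [add_sub_cancel_right, mul_comm] at this
      · have := sub_mem (hNn _ h2) (hPn _ hm)
        rwa [add_sub_cancel_right, mul_comm] at this
      · have := sub_mem (hNn _ h3) (hPn _ hm')
        rwa [add_sub_cancel_right, mul_comm] at this
    have hX1 : ∀ v ∈ lastVars k, v * X 1 ∈ nullQuadrics γ ⊔ P ^ 2 := fun v hv => by
      rw [mul_comm]
      exact hNn _ (h.mul_mem hv)
    have hs : ∀ i : Fin 4, (∀ v ∈ lastVars k, v * X i ∈ nullQuadrics γ ⊔ P ^ 2) →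
        lastVars k * Submodule.span k {X i} ≤ nullQuadrics γ ⊔ P ^ 2 := by
      intro i hi
      rw [Submodule.mul_le]
      intro v hv x hx
      obtain ⟨c, rfl⟩ := Submodule.mem_span_singleton.1 hx
      rw [mul_smul_comm]
      exact Submodule.smul_mem _ _ (hi v hv)
    have hKP : lastVars k * P ≤ nullQuadrics γ ⊔ P ^ 2 := by
      rw [lastVars_eq_sup, Submodule.sup_mul, ← hP, ← pow_two, mul_comm]
      exact sup_le ((mul_le_mul' hPK le_rfl).trans (hs 1 hX1)) le_sup_right
    rw [forms_one_eq_sup, Submodule.mul_sup]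
    refine sup_le (hs 0 hX0) ?_
    nth_rw 2 [lastVars_eq_sup]
    rw [Submodule.mul_sup]
    exact sup_le (hs 1 hX1) hKP
  · exact hw.trans (sup_le_sup hfN le_rfl)

end Relations

/-! ### Normal forms in an arbitrary frame -/

section Frames

variable {k : Type*} [Field k] {γ : MvPolynomial (Fin 4) k →ₗ[k] k}
  {a b c d : MvPolynomial (Fin 4) k}

namespace IsFrame

theorem hasExpectedDimensions_fourPoints (h : IsFrame a b c d)
    (hγ : NondegenerateOn γ (forms k 1)) (hab : a * b ∈ nullQuadrics γ)
    (hac : a * c ∈ nullQuadrics γ) (had : a * d ∈ nullQuadrics γ) (hbc : b * c ∈ nullQuadrics γ)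
    (hbd : b * d ∈ nullQuadrics γ) (hcd : c * d ∈ nullQuadrics γ) : HasExpectedDimensions γ := by
  refine h.hasExpectedDimensions (_root_.hasExpectedDimensions_fourPoints
    (h.nondegenerateOn_comp hγ) fun i => h.mem_nullQuadrics_comp γ ?_)
  fin_cases i <;> simpa [fourPointsQuadrics, frameHom]

theorem hasExpectedDimensions_doublePoint (h : IsFrame a b c d)
    (hγ : NondegenerateOn γ (forms k 1)) (hab : a * b ∈ nullQuadrics γ)
    (hac : a * c ∈ nullQuadrics γ) (had : a * d ∈ nullQuadrics γ) (hbc : b * c ∈ nullQuadrics γ)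
    (hbd : b * d ∈ nullQuadrics γ) (hdd : d * d ∈ nullQuadrics γ) : HasExpectedDimensions γ := by
  refine h.hasExpectedDimensions (_root_.hasExpectedDimensions_doublePoint
    (h.nondegenerateOn_comp hγ) fun i => h.mem_nullQuadrics_comp γ ?_)
  fin_cases i <;> simpa [doublePointQuadrics, frameHom]

theorem hasExpectedDimensions_twoDoublePoints (h : IsFrame a b c d)
    (hγ : NondegenerateOn γ (forms k 1)) (hac : a * c ∈ nullQuadrics γ)
    (had : a * d ∈ nullQuadrics γ) (hbc : b * c ∈ nullQuadrics γ) (hbd : b * d ∈ nullQuadrics γ)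
    (hbb : b * b ∈ nullQuadrics γ) (hdd : d * d ∈ nullQuadrics γ) : HasExpectedDimensions γ := by
  refine h.hasExpectedDimensions (_root_.hasExpectedDimensions_twoDoublePoints
    (h.nondegenerateOn_comp hγ) fun i => h.mem_nullQuadrics_comp γ ?_)
  fin_cases i <;> simpa [twoDoublePointsQuadrics, frameHom]

theorem hasExpectedDimensions_triplePoint (h : IsFrame a b c d)
    (hγ : NondegenerateOn γ (forms k 1)) (hab : a * b ∈ nullQuadrics γ)
    (hac : a * c ∈ nullQuadrics γ) (had : a * d ∈ nullQuadrics γ) (hdd : d * d ∈ nullQuadrics γ)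
    (hcd : c * d ∈ nullQuadrics γ) (hcb : c * c - b * d ∈ nullQuadrics γ) :
    HasExpectedDimensions γ := by
  refine h.hasExpectedDimensions (_root_.hasExpectedDimensions_triplePoint
    (h.nondegenerateOn_comp hγ) fun i => h.mem_nullQuadrics_comp γ ?_)
  fin_cases i <;> simpa [triplePointQuadrics, frameHom]

theorem hasExpectedDimensions_quadruplePoint (h : IsFrame a b c d)
    (hγ : NondegenerateOn γ (forms k 1)) (e : k) (hbb : b * b ∈ nullQuadrics γ)
    (hbc : b * c ∈ nullQuadrics γ) (hbd : b * d ∈ nullQuadrics γ) (hcc : c * c ∈ nullQuadrics γ)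
    (hcd : c * d - a * b ∈ nullQuadrics γ) (hdd : d * d - e • (a * c) ∈ nullQuadrics γ) :
    HasExpectedDimensions γ := by
  refine h.hasExpectedDimensions (_root_.hasExpectedDimensions_quadruplePoint e
    (h.nondegenerateOn_comp hγ) fun i => h.mem_nullQuadrics_comp γ ?_)
  fin_cases i <;> simpa [quadruplePointQuadrics, frameHom]

theorem mem_nullQuadrics (h : IsFrame a b c d) {q : MvPolynomial (Fin 4) k} (hq : q ∈ forms k 2)
    (ha : γ (a * q) = 0) (hb : γ (b * q) = 0) (hc : γ (c * q) = 0) (hd : γ (d * q) = 0) :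
    q ∈ nullQuadrics γ := by
  refine _root_.mem_nullQuadrics.2 ⟨hq, fun v hv => ?_⟩
  rw [← (show _ = _ from h)] at hv
  have : Submodule.span k {a, b, c, d} ≤ LinearMap.ker (γ ∘ₗ LinearMap.mulRight k q) := by
    rw [Submodule.span_le]
    rintro x (rfl | rfl | rfl | rfl) <;> assumption
  exact this hv

/-- Ten values on products of frame members determine the contraction of a linear form; this turns
nondegeneracy into a finite check of coefficients. -/
theorem eq_zero_of_apply (h : IsFrame a b c d) (hγ : NondegenerateOn γ (forms k 1))
    {v : MvPolynomial (Fin 4) k} (hv : v ∈ forms k 1) (haa : γ (v * a * a) = 0)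
    (hab : γ (v * a * b) = 0) (hac : γ (v * a * c) = 0) (had : γ (v * a * d) = 0)
    (hbb : γ (v * b * b) = 0) (hbc : γ (v * b * c) = 0) (hbd : γ (v * b * d) = 0)
    (hcc : γ (v * c * c) = 0) (hcd : γ (v * c * d) = 0) (hdd : γ (v * d * d) = 0) : v = 0 := by
  have hN : ∀ x ∈ ({a, b, c, d} : Set (MvPolynomial (Fin 4) k)), v * x ∈ nullQuadrics γ := by
    have hm := h.mem
    have e : ∀ {x y}, γ (v * x * y) = 0 → γ (y * (v * x)) = 0 := fun hxy => by
      rwa [mul_comm]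
    have e' : ∀ {x y}, γ (v * y * x) = 0 → γ (y * (v * x)) = 0 := fun {x y} hxy => by
      rwa [mul_comm, mul_right_comm]
    rintro x (rfl | rfl | rfl | rfl)
    · exact h.mem_nullQuadrics (mul_mem_forms hv hm.1) (e haa) (e hab) (e hac) (e had)
    · exact h.mem_nullQuadrics (mul_mem_forms hv hm.2.1) (e' hab) (e hbb) (e hbc) (e hbd)
    · exact h.mem_nullQuadrics (mul_mem_forms hv hm.2.2.1) (e' hac) (e' hbc) (e hcc) (e hcd)
    · exact h.mem_nullQuadrics (mul_mem_forms hv hm.2.2.2) (e' had) (e' hbd) (e' hcd) (e hdd)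
  refine hγ v hv fun p hp => ?_
  rw [pow_two] at hp
  refine functional_eq_zero_on_mul (Λ := γ ∘ₗ LinearMap.mulLeft k v) (fun u hu w hw => ?_) p hp
  have hu' : v * u ∈ nullQuadrics γ := by
    rw [← (show _ = _ from h)] at hu
    have : Submodule.span k {a, b, c, d} ≤ (nullQuadrics γ).comap (LinearMap.mulLeft k v) :=
      Submodule.span_le.2 hN
    exact this hu
  rw [LinearMap.comp_apply, LinearMap.mulLeft_apply, ← mul_assoc, mul_comm]
  exact (_root_.mem_nullQuadrics.1 hu').2 w hw

end IsFrame

theorem apply_eq_zero_of_mem {u v w : MvPolynomial (Fin 4) k} (h : u * v ∈ nullQuadrics γ)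
    (hw : w ∈ forms k 1) : γ (u * v * w) = 0 := by
  rw [mul_comm]
  exact (mem_nullQuadrics.1 h).2 w hw

end Frames

/-! ### Factoring binary quadrics -/

section Binary

variable {k A : Type*} [Field k] [CommRing A] [Algebra k A]

theorem span_pair_eq {x y x' y' : A} (hx' : x' ∈ Submodule.span k {x, y})
    (hy' : y' ∈ Submodule.span k {x, y}) (hx : x ∈ Submodule.span k {x', y'})
    (hy : y ∈ Submodule.span k {x', y'}) : Submodule.span k {x', y'} = Submodule.span k {x, y} := by
  refine le_antisymm (Submodule.span_le.2 ?_) (Submodule.span_le.2 ?_)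
  · rintro z (rfl | rfl) <;> assumption
  · rintro z (rfl | rfl) <;> assumption

theorem exists_factorization [IsAlgClosed k] [CharZero k] (x y : A) {p q r : k}
    (h : ¬ (p = 0 ∧ q = 0 ∧ r = 0)) :
    ∃ x' y' : A, Submodule.span k {x', y'} = Submodule.span k {x, y} ∧ ∃ e : k, e ≠ 0 ∧
      (p • (x * x) + q • (x * y) + r • (y * y) = e • (x' * y') ∨
        p • (x * x) + q • (x * y) + r • (y * y) = e • (y' * y')) := by
  by_cases hp : p = 0
  · subst hp
    by_cases hq : q = 0
    · subst hq
      exact ⟨x, y, rfl, r, fun hr => h ⟨rfl, rfl, hr⟩, Or.inr (by simp)⟩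
    · refine ⟨q • x + r • y, y, span_pair_eq ?_ ?_ ?_ ?_, 1, one_ne_zero, Or.inl ?_⟩
      · exact Submodule.mem_span_pair.2 ⟨q, r, rfl⟩
      · exact Submodule.subset_span (by simp)
      · refine Submodule.mem_span_pair.2 ⟨q⁻¹, -(q⁻¹ * r), ?_⟩
        rw [smul_add, smul_smul, smul_smul, inv_mul_cancel₀ hq, one_smul, neg_smul,
          add_neg_cancel_right]
      · exact Submodule.subset_span (by simp)
      · simp only [zero_smul, zero_add, one_smul, add_mul, smul_mul_assoc]
  · obtain ⟨s, hs⟩ := IsAlgClosed.exists_pow_nat_eq (q ^ 2 - 4 * p * r) (n := 2) two_pos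
    have h2 : (2 : k) ≠ 0 := two_ne_zero
    have e : ∀ α β : k, p * (α + β) = q → p * (α * β) = r →
        p • (x * x) + q • (x * y) + r • (y * y) = p • ((x + α • y) * (x + β • y)) := by
      rintro α β rfl rfl
      simp only [Algebra.smul_def, map_mul, map_add]
      ring
    have e' := e ((q + s) / (2 * p)) ((q - s) / (2 * p)) (by field_simp; ring)
      (by field_simp; linear_combination -hs)
    by_cases hs0 : s = 0
    · subst hs0
      refine ⟨y, x + ((q + 0) / (2 * p)) • y, span_pair_eq ?_ ?_ ?_ ?_, p, hp, Or.inr ?_⟩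
      · exact Submodule.subset_span (by simp)
      · exact Submodule.mem_span_pair.2 ⟨1, _, by rw [one_smul]⟩
      · exact Submodule.mem_span_pair.2 ⟨-((q + 0) / (2 * p)), 1, by
          rw [one_smul, neg_smul, add_comm, add_neg_cancel_right]⟩
      · exact Submodule.subset_span (by simp)
      · rw [e', sub_zero, add_zero]
    · refine ⟨x + ((q + s) / (2 * p)) • y, x + ((q - s) / (2 * p)) • y, span_pair_eq ?_ ?_ ?_ ?_,
        p, hp, Or.inl e'⟩
      · exact Submodule.mem_span_pair.2 ⟨1, _, by rw [one_smul]⟩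
      · exact Submodule.mem_span_pair.2 ⟨1, _, by rw [one_smul]⟩
      · refine Submodule.mem_span_pair.2 ⟨(s - q) / (2 * s), (s + q) / (2 * s), ?_⟩
        simp only [Algebra.smul_def, div_eq_mul_inv, map_mul, map_add, map_sub, mul_inv]
        have h1 : algebraMap k A s * algebraMap k A s⁻¹ = 1 := by
          rw [← map_mul, mul_inv_cancel₀ hs0, map_one]
        have h3 : algebraMap k A 2 * algebraMap k A 2⁻¹ = 1 := by
          rw [← map_mul, mul_inv_cancel₀ h2, map_one]
        rw [map_ofNat] at h3
        linear_combination (2 * x * algebraMap k A 2⁻¹) * h1 + x * h3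
      · refine Submodule.mem_span_pair.2 ⟨p / s, -(p / s), ?_⟩
        rw [neg_smul, ← sub_eq_add_neg, ← smul_sub, add_sub_add_left_eq_sub, ← sub_smul, smul_smul,
          show p / s * ((q + s) / (2 * p) - (q - s) / (2 * p)) = 1 by field_simp; ring, one_smul]

/-- Two linear conditions on the three coefficients of a binary quadric have a nonzero solution,
which then factors into a product or a square. -/
theorem exists_apolar_product [IsAlgClosed k] [CharZero k] (x y : A) (Λ Λ' : A →ₗ[k] k) :
    ∃ x' y' : A, Submodule.span k {x', y'} = Submodule.span k {x, y} ∧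
      ((Λ (x' * y') = 0 ∧ Λ' (x' * y') = 0) ∨ (Λ (y' * y') = 0 ∧ Λ' (y' * y') = 0)) := by
  let M : Matrix (Fin 2) (Fin 3) k := !![Λ (x * x), Λ (x * y), Λ (y * y);
    Λ' (x * x), Λ' (x * y), Λ' (y * y)]
  obtain ⟨v, hv, hv0⟩ := Submodule.exists_mem_ne_zero_of_ne_bot
    (LinearMap.ker_ne_bot_of_finrank_lt (f := M.mulVecLin) (by simp))
  have hv' : M.mulVec v = 0 := hv
  have h1 := congrFun hv' 0
  have h2 := congrFun hv' 1
  simp only [M, Matrix.mulVec, dotProduct, Fin.sum_univ_three, Matrix.of_apply, Matrix.cons_val,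
    Pi.zero_apply] at h1 h2
  obtain ⟨x', y', hs, e, he, hm⟩ := exists_factorization x y (p := v 0) (q := v 1) (r := v 2)
    (fun h => hv0 (by
      ext i
      fin_cases i
      exacts [h.1, h.2.1, h.2.2]))
  have key : ∀ Γ : A →ₗ[k] k, ∀ z, v 0 • (x * x) + v 1 • (x * y) + v 2 • (y * y) = e • z →
      Γ (x * x) * v 0 + Γ (x * y) * v 1 + Γ (y * y) * v 2 = 0 → Γ z = 0 := by
    intro Γ z hz h0
    have := congrArg Γ hz
    simp only [map_add, map_smul, smul_eq_mul] at this
    refine (mul_eq_zero.1 (?_ : e * Γ z = 0)).resolve_left he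
    rw [← this, ← h0]
    ring
  refine ⟨x', y', hs, ?_⟩
  rcases hm with hm | hm
  · exact Or.inl ⟨key Λ _ hm h1, key Λ' _ hm h2⟩
  · exact Or.inr ⟨key Λ _ hm h1, key Λ' _ hm h2⟩

end Binary

/-! ### Splittings leading to schemes of length four -/

section Splittings

variable {k : Type*} [Field k] {γ : MvPolynomial (Fin 4) k →ₗ[k] k}
  {a b c d : MvPolynomial (Fin 4) k}

theorem isFrame_iff_sup : IsFrame a b c d ↔
    Submodule.span k {a, b} ⊔ Submodule.span k {c, d} = forms k 1 := by
  rw [IsFrame, ← Submodule.span_union]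
  have : ({a, b} ∪ {c, d} : Set (MvPolynomial (Fin 4) k)) = {a, b, c, d} := by
    ext x
    simp only [Set.mem_union, Set.mem_insert_iff, Set.mem_singleton_iff, or_assoc]
  rw [this]

theorem isFrame_iff_sup_singleton : IsFrame a b c d ↔
    Submodule.span k {a} ⊔ Submodule.span k {b, c, d} = forms k 1 := by
  rw [IsFrame, ← Submodule.span_union]
  rfl

theorem mul_mem_of_mem_span_pair {W : Submodule k (MvPolynomial (Fin 4) k)} (hac : a * c ∈ W)
    (had : a * d ∈ W) (hbc : b * c ∈ W) (hbd : b * d ∈ W) {u v : MvPolynomial (Fin 4) k}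
    (hu : u ∈ Submodule.span k {a, b}) (hv : v ∈ Submodule.span k {c, d}) : u * v ∈ W := by
  obtain ⟨p, q, rfl⟩ := Submodule.mem_span_pair.1 hu
  obtain ⟨r, s, rfl⟩ := Submodule.mem_span_pair.1 hv
  simp only [add_mul, mul_add, smul_mul_assoc, mul_smul_comm]
  exact add_mem (W.smul_mem _ (add_mem (W.smul_mem _ hac) (W.smul_mem _ hbc)))
    (W.smul_mem _ (add_mem (W.smul_mem _ had) (W.smul_mem _ hbd)))

theorem apply_left {u v w : MvPolynomial (Fin 4) k} (h : u * v ∈ nullQuadrics γ)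
    (hw : w ∈ forms k 1) : γ (u * (v * w)) = 0 := by
  rw [← mul_assoc]
  exact apply_eq_zero_of_mem h hw

theorem apply_right {u v w : MvPolynomial (Fin 4) k} (h : u * v ∈ nullQuadrics γ)
    (hw : w ∈ forms k 1) : γ (w * (u * v)) = 0 :=
  (mem_nullQuadrics.1 h).2 w hw

set_option linter.unusedSimpArgs false

namespace IsFrame

theorem eq_zero_of_sum_eq_zero (h : IsFrame a b c d) {p q r s : k}
    (h0 : p • a + q • b + r • c + s • d = 0) : p = 0 ∧ q = 0 ∧ r = 0 ∧ s = 0 := by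
  have := Fintype.linearIndependent_iff.1 h.linearIndependent ![p, q, r, s] (by
    rw [Fin.sum_univ_four]
    exact h0)
  exact ⟨this 0, this 1, this 2, this 3⟩

/-- γ is a sum of two binary cubics, one for {a, b} and one for {c, d}. Each is apolar to a product
or to a square, contributing two reduced points or one double point to the scheme. -/
theorem hasExpectedDimensions_of_pairs [IsAlgClosed k] [CharZero k] (h : IsFrame a b c d)
    (hγ : NondegenerateOn γ (forms k 1)) (hac : a * c ∈ nullQuadrics γ)
    (had : a * d ∈ nullQuadrics γ) (hbc : b * c ∈ nullQuadrics γ) (hbd : b * d ∈ nullQuadrics γ) :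
    HasExpectedDimensions γ := by
  obtain ⟨ha, hb, hc, hd⟩ := h.mem
  have hU : Submodule.span k {a, b} ≤ forms k 1 := by
    rw [Submodule.span_le]
    rintro x (rfl | rfl) <;> assumption
  have hV : Submodule.span k {c, d} ≤ forms k 1 := by
    rw [Submodule.span_le]
    rintro x (rfl | rfl) <;> assumption
  have hN : ∀ {u v}, u ∈ Submodule.span k {a, b} → v ∈ Submodule.span k {c, d} →
      u * v ∈ nullQuadrics γ := fun hu hv => mul_mem_of_mem_span_pair hac had hbc hbd hu hv
  have hmem : ∀ {e f : MvPolynomial (Fin 4) k}, e ∈ ({e, f} : Set _) := by simp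
  have hmem' : ∀ {e f : MvPolynomial (Fin 4) k}, f ∈ ({e, f} : Set _) := by simp
  obtain ⟨a', b', hab', hΛ⟩ := exists_apolar_product a b (γ ∘ₗ LinearMap.mulLeft k a)
    (γ ∘ₗ LinearMap.mulLeft k b)
  obtain ⟨c', d', hcd', hΛ'⟩ := exists_apolar_product c d (γ ∘ₗ LinearMap.mulLeft k c)
    (γ ∘ₗ LinearMap.mulLeft k d)
  have h' : IsFrame a' b' c' d' := by
    rw [isFrame_iff_sup, hab', hcd', ← isFrame_iff_sup]
    exact h
  have ha' : a' ∈ Submodule.span k {a, b} := hab' ▸ Submodule.subset_span hmem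
  have hb' : b' ∈ Submodule.span k {a, b} := hab' ▸ Submodule.subset_span hmem'
  have hc' : c' ∈ Submodule.span k {c, d} := hcd' ▸ Submodule.subset_span hmem
  have hd' : d' ∈ Submodule.span k {c, d} := hcd' ▸ Submodule.subset_span hmem'
  have h1 : a' * b' ∈ nullQuadrics γ ∨ b' * b' ∈ nullQuadrics γ := by
    have key : ∀ {u v}, u ∈ Submodule.span k {a, b} → v ∈ Submodule.span k {a, b} →
        γ (a * (u * v)) = 0 ∧ γ (b * (u * v)) = 0 → u * v ∈ nullQuadrics γ := by
      rintro u v hu hv ⟨e1, e2⟩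
      refine h.mem_nullQuadrics (mul_mem_forms (hU hu) (hU hv)) e1 e2 ?_ ?_
      · rw [← mul_assoc, mul_comm c]
        exact apply_eq_zero_of_mem (hN hu (Submodule.subset_span hmem)) (hU hv)
      · rw [← mul_assoc, mul_comm d]
        exact apply_eq_zero_of_mem (hN hu (Submodule.subset_span hmem')) (hU hv)
    rcases hΛ with e | e
    · exact Or.inl (key ha' hb' e)
    · exact Or.inr (key hb' hb' e)
  have h2 : c' * d' ∈ nullQuadrics γ ∨ d' * d' ∈ nullQuadrics γ := by
    have key : ∀ {u v}, u ∈ Submodule.span k {c, d} → v ∈ Submodule.span k {c, d} →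
        γ (c * (u * v)) = 0 ∧ γ (d * (u * v)) = 0 → u * v ∈ nullQuadrics γ := by
      rintro u v hu hv ⟨e1, e2⟩
      refine h.mem_nullQuadrics (mul_mem_forms (hV hu) (hV hv)) ?_ ?_ e1 e2
      · rw [← mul_assoc]
        exact apply_eq_zero_of_mem (hN (Submodule.subset_span hmem) hu) (hV hv)
      · rw [← mul_assoc]
        exact apply_eq_zero_of_mem (hN (Submodule.subset_span hmem') hu) (hV hv)
    rcases hΛ' with e | e
    · exact Or.inl (key hc' hd' e)
    · exact Or.inr (key hd' hd' e)
  have e1 := hN ha' hc'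
  have e2 := hN ha' hd'
  have e3 := hN hb' hc'
  have e4 := hN hb' hd'
  rcases h1 with h1 | h1 <;> rcases h2 with h2 | h2
  · exact h'.hasExpectedDimensions_fourPoints hγ h1 e1 e2 e3 e4 h2
  · exact h'.hasExpectedDimensions_doublePoint hγ h1 e1 e2 e3 e4 h2
  · have h'' : IsFrame c' d' a' b' := by
      rw [isFrame_iff_sup, sup_comm, ← isFrame_iff_sup]
      exact h'
    rw [mul_comm] at e1 e2 e3 e4
    exact h''.hasExpectedDimensions_doublePoint hγ h2 e1 e3 e2 e4 h1
  · exact h'.hasExpectedDimensions_twoDoublePoints hγ e1 e2 e3 e4 h1 h2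

/-- Here `a` is isolated and the ternary part has `c * d` and `d * d` null. The value t = γ(c³)
decides: for t ≠ 0 the scheme has two reduced points and a double point, for t = 0 a reduced point
and a triple point. -/
theorem hasExpectedDimensions_of_nilpotent [CharZero k] (h : IsFrame a b c d)
    (hγ : NondegenerateOn γ (forms k 1)) (hab : a * b ∈ nullQuadrics γ)
    (hac : a * c ∈ nullQuadrics γ) (had : a * d ∈ nullQuadrics γ) (hcd : c * d ∈ nullQuadrics γ)
    (hdd : d * d ∈ nullQuadrics γ) : HasExpectedDimensions γ := by
  obtain ⟨ha, hb, hc, hd⟩ := h.mem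
  have a1 := apply_left hab hb
  have a2 := apply_left hab hc
  have a3 := apply_left hab hd
  have a4 := apply_left hac hc
  have a5 := apply_left hac hd
  have a6 := apply_left had hd
  have a7 := apply_right hab ha
  have a8 := apply_right hac ha
  have a9 := apply_right had ha
  have n2 := apply_right hcd hb
  have n3 := apply_right hdd hb
  have n4 := apply_right hcd hc
  have n5 := apply_left hcd hd
  have n6 := apply_left hdd hd
  obtain ⟨s, hs⟩ : ∃ s, γ (b * (c * c)) = s := ⟨_, rfl⟩
  obtain ⟨t, ht⟩ : ∃ t, γ (c * (c * c)) = t := ⟨_, rfl⟩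
  obtain ⟨δ, hδ⟩ : ∃ δ, γ (b * (b * d)) = δ := ⟨_, rfl⟩
  obtain ⟨e, he⟩ : ∃ e, γ (b * (b * c)) = e := ⟨_, rfl⟩
  have hδ0 : δ ≠ 0 := by
    rintro rfl
    have hd0 : d = 0 := by
      refine h.eq_zero_of_apply hγ hd ?_ ?_ ?_ ?_ ?_ ?_ ?_ ?_ ?_ ?_ <;>
        simp only [mul_assoc, mul_comm, mul_left_comm, a1, a2, a3, a4, a5, a6, a7, a8, a9, n2, n3, n4, n5, n6, hs, ht, hδ, he]
    have := h.eq_zero_of_sum_eq_zero (p := 0) (q := 0) (r := 0) (s := 1) (by simp [hd0])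
    exact one_ne_zero this.2.2.2
  by_cases ht0 : t = 0
  · subst ht0
    -- For s = t = 0 the contractions of `c` and `d` would be proportional with ratio e/δ.
    have hs0 : s ≠ 0 := by
      rintro rfl
      have hv : c - (e / δ) • d = 0 := by
        refine h.eq_zero_of_apply hγ (sub_mem hc (Submodule.smul_mem _ _ hd))
          ?_ ?_ ?_ ?_ ?_ ?_ ?_ ?_ ?_ ?_ <;>
        · simp only [mul_add, mul_sub, add_mul, sub_mul, smul_mul_assoc, mul_smul_comm, smul_add,
            smul_sub, map_add, map_sub, map_smul, smul_eq_mul, mul_assoc, mul_comm, mul_left_comm,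
            a1, a2, a3, a4, a5, a6, a7, a8, a9, n2, n3, n4, n5, n6,
            hs, ht, hδ, he]
          try field_simp
          try ring
      have := h.eq_zero_of_sum_eq_zero (p := 0) (q := 0) (r := 1) (s := -(e / δ)) (by
        rw [← hv, neg_smul, one_smul, zero_smul, zero_smul, zero_add, zero_add, sub_eq_add_neg])
      exact one_ne_zero this.2.2.1
    -- The scaling makes γ(b·b·d) equal to γ(b·c·c), so that c² − bd is null.
    have h' : IsFrame a b c ((s / δ) • d) := by
      refine h.of_mem ha hb hc (Submodule.smul_mem _ _ hd)
        (Submodule.subset_span (by simp)) (Submodule.subset_span (by simp))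
        (Submodule.subset_span (by simp)) (mem_span_four 0 0 0 (δ / s) ?_)
      rw [smul_smul, show δ / s * (s / δ) = 1 by field_simp]
      simp
    refine h'.hasExpectedDimensions_triplePoint hγ hab hac ?_ ?_ ?_ ?_
    · rw [mul_smul_comm]
      exact Submodule.smul_mem _ _ had
    · rw [mul_smul_comm, smul_mul_assoc]
      exact Submodule.smul_mem _ _ (Submodule.smul_mem _ _ hdd)
    · rw [mul_smul_comm]
      exact Submodule.smul_mem _ _ hcd
    · refine h.mem_nullQuadrics (sub_mem (mul_mem_forms hc hc)
        (mul_mem_forms hb (Submodule.smul_mem _ _ hd))) ?_ ?_ ?_ ?_ <;>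
      · simp only [mul_add, mul_sub, add_mul, sub_mul, smul_mul_assoc, mul_smul_comm, smul_add,
          smul_sub, map_add, map_sub, map_smul, smul_eq_mul, mul_assoc, mul_comm, mul_left_comm,
          a1, a2, a3, a4, a5, a6, a7, a8, a9, n2, n3, n4, n5, n6,
          hs, ht, hδ, he]
        try field_simp
        try ring
  -- The combination tb − sc makes the product null against `c`; the multiple of `d` added to `c`
  -- then removes its value te − s² against `b`.
  · have hc' : c + ((s ^ 2 - t * e) / (t * δ)) • d ∈ forms k 1 :=
      add_mem hc (Submodule.smul_mem _ _ hd)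
    have hb' : t • b - s • c ∈ forms k 1 :=
      sub_mem (Submodule.smul_mem _ _ hb) (Submodule.smul_mem _ _ hc)
    have hN : (c + ((s ^ 2 - t * e) / (t * δ)) • d) * (t • b - s • c) ∈ nullQuadrics γ := by
      refine h.mem_nullQuadrics (mul_mem_forms hc' hb') ?_ ?_ ?_ ?_ <;>
      · simp only [mul_add, mul_sub, add_mul, sub_mul, smul_mul_assoc, mul_smul_comm, smul_add,
          smul_sub, map_add, map_sub, map_smul, smul_eq_mul, mul_assoc, mul_comm, mul_left_comm,
          a1, a2, a3, a4, a5, a6, a7, a8, a9, n2, n3, n4, n5, n6,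
          hs, ht, hδ, he]
        try field_simp
        try ring
    have h' : IsFrame a (c + ((s ^ 2 - t * e) / (t * δ)) • d) (t • b - s • c) d := by
      refine h.of_mem ha hc' hb' hd (Submodule.subset_span (by simp))
        (mem_span_four 0 (s / t) (1 / t) (-(s / t * ((s ^ 2 - t * e) / (t * δ)))) ?_)
        (mem_span_four 0 1 0 (-((s ^ 2 - t * e) / (t * δ))) ?_) (Submodule.subset_span (by simp))
      · simp only [smul_sub, smul_add, smul_smul, zero_smul, neg_smul,
          show 1 / t * t = 1 by field_simp, show 1 / t * s = s / t by ring, one_smul]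
        abel
      · simp only [zero_smul, one_smul, neg_smul]
        abel
    refine h'.hasExpectedDimensions_doublePoint hγ ?_ ?_ had hN ?_ hdd
    · rw [mul_add, mul_smul_comm]
      exact add_mem hac (Submodule.smul_mem _ _ had)
    · rw [mul_sub, mul_smul_comm, mul_smul_comm]
      exact sub_mem (Submodule.smul_mem _ _ hab) (Submodule.smul_mem _ _ hac)
    · rw [add_mul, smul_mul_assoc]
      exact add_mem hcd (Submodule.smul_mem _ _ hdd)

end IsFrame

end Splittings

/-! ### Bases adapted to a decomposition or to a square-zero endomorphism -/

section LinearAlgebra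

variable {k V : Type*} [Field k] [AddCommGroup V] [Module k V]

theorem range_le_ker_of_sq_eq_zero {N : V →ₗ[k] V} (h : ∀ u, N (N u) = 0) :
    LinearMap.range N ≤ LinearMap.ker N := by
  rintro _ ⟨u, rfl⟩
  exact h u

variable [FiniteDimensional k V]

theorem range_fin_two {α : Type*} (f : Fin 2 → α) : Set.range f = {f 0, f 1} := by
  ext x
  simp [Fin.exists_fin_two, eq_comm]

theorem range_fin_three {α : Type*} (f : Fin 3 → α) : Set.range f = {f 0, f 1, f 2} := by
  ext x
  simp [Fin.exists_fin_succ, eq_comm]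

theorem exists_span_singleton {U : Submodule k V} (h : Module.finrank k U = 1) :
    ∃ a ∈ U, U = Submodule.span k {a} := by
  obtain ⟨J, hJ, hJm⟩ := exists_basis_of_finrank h
  refine ⟨J 0, hJm 0, ?_⟩
  rw [hJ]
  congr 1
  ext x
  simp [eq_comm]

theorem exists_span_pair {U : Submodule k V} (h : Module.finrank k U = 2) :
    ∃ a ∈ U, ∃ b ∈ U, U = Submodule.span k {a, b} := by
  obtain ⟨J, hJ, hJm⟩ := exists_basis_of_finrank h
  exact ⟨J 0, hJm 0, J 1, hJm 1, by rw [hJ, range_fin_two]⟩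

theorem exists_span_triple {U : Submodule k V} (h : Module.finrank k U = 3) :
    ∃ a ∈ U, ∃ b ∈ U, ∃ c ∈ U, U = Submodule.span k {a, b, c} := by
  obtain ⟨J, hJ, hJm⟩ := exists_basis_of_finrank h
  exact ⟨J 0, hJm 0, J 1, hJm 1, J 2, hJm 2, by rw [hJ, range_fin_three]⟩

theorem exists_adapted_of_isCompl_three (hV : Module.finrank k V = 3) {V₁ V₂ : Submodule k V}
    (h₁ : V₁ ≠ ⊥) (h₂ : V₂ ≠ ⊥) (h : IsCompl V₁ V₂) :
    ∃ a b c : V, Submodule.span k {a, b, c} = ⊤ ∧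
      (a ∈ V₁ ∧ b ∈ V₂ ∧ c ∈ V₂ ∨ a ∈ V₂ ∧ b ∈ V₁ ∧ c ∈ V₁) := by
  have h1 : Module.finrank k V₁ ≠ 0 := fun h0 => h₁ (Submodule.finrank_eq_zero.1 h0)
  have h2 : Module.finrank k V₂ ≠ 0 := fun h0 => h₂ (Submodule.finrank_eq_zero.1 h0)
  have h3 := Submodule.finrank_add_eq_of_isCompl h
  have key : ∀ {U W : Submodule k V}, IsCompl U W → Module.finrank k U = 1 →
      Module.finrank k W = 2 →
      ∃ a b c : V, Submodule.span k {a, b, c} = ⊤ ∧ a ∈ U ∧ b ∈ W ∧ c ∈ W := by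
    intro U W hUW hU hW
    obtain ⟨a, ha, rfl⟩ := exists_span_singleton hU
    obtain ⟨b, hb, c, hc, rfl⟩ := exists_span_pair hW
    refine ⟨a, b, c, ?_, ha, hb, hc⟩
    rw [← hUW.sup_eq_top, ← Submodule.span_union]
    rfl
  rcases (by omega : Module.finrank k V₁ = 1 ∧ Module.finrank k V₂ = 2 ∨
    Module.finrank k V₂ = 1 ∧ Module.finrank k V₁ = 2) with ⟨e1, e2⟩ | ⟨e1, e2⟩
  · obtain ⟨a, b, c, hs, hm⟩ := key h e1 e2
    exact ⟨a, b, c, hs, Or.inl hm⟩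
  · obtain ⟨a, b, c, hs, hm⟩ := key h.symm e1 e2
    exact ⟨a, b, c, hs, Or.inr hm⟩

theorem exists_adapted_of_isCompl_four (hV : Module.finrank k V = 4) {V₁ V₂ : Submodule k V}
    (h₁ : V₁ ≠ ⊥) (h₂ : V₂ ≠ ⊥) (h : IsCompl V₁ V₂) :
    ∃ a b c d : V, Submodule.span k {a, b, c, d} = ⊤ ∧
      ((a ∈ V₁ ∧ b ∈ V₁ ∧ c ∈ V₂ ∧ d ∈ V₂) ∨ (a ∈ V₁ ∧ b ∈ V₂ ∧ c ∈ V₂ ∧ d ∈ V₂) ∨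
        (a ∈ V₂ ∧ b ∈ V₁ ∧ c ∈ V₁ ∧ d ∈ V₁)) := by
  have h1 : Module.finrank k V₁ ≠ 0 := fun h0 => h₁ (Submodule.finrank_eq_zero.1 h0)
  have h2 : Module.finrank k V₂ ≠ 0 := fun h0 => h₂ (Submodule.finrank_eq_zero.1 h0)
  have h3 := Submodule.finrank_add_eq_of_isCompl h
  have key : ∀ {U W : Submodule k V}, IsCompl U W → Module.finrank k U = 1 →
      Module.finrank k W = 3 →
      ∃ a b c d : V, Submodule.span k {a, b, c, d} = ⊤ ∧ a ∈ U ∧ b ∈ W ∧ c ∈ W ∧ d ∈ W := by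
    intro U W hUW hU hW
    obtain ⟨a, ha, rfl⟩ := exists_span_singleton hU
    obtain ⟨b, hb, c, hc, d, hd, rfl⟩ := exists_span_triple hW
    refine ⟨a, b, c, d, ?_, ha, hb, hc, hd⟩
    rw [← hUW.sup_eq_top, ← Submodule.span_union]
    rfl
  rcases (by omega : Module.finrank k V₁ = 2 ∧ Module.finrank k V₂ = 2 ∨
    Module.finrank k V₁ = 1 ∧ Module.finrank k V₂ = 3 ∨
    Module.finrank k V₂ = 1 ∧ Module.finrank k V₁ = 3) with ⟨e1, e2⟩ | ⟨e1, e2⟩ | ⟨e1, e2⟩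
  · obtain ⟨a, ha, b, hb, rfl⟩ := exists_span_pair e1
    obtain ⟨c, hc, d, hd, rfl⟩ := exists_span_pair e2
    refine ⟨a, b, c, d, ?_, Or.inl ⟨ha, hb, hc, hd⟩⟩
    rw [← h.sup_eq_top, ← Submodule.span_union]
    congr 1
    ext x
    simp only [Set.mem_union, Set.mem_insert_iff, Set.mem_singleton_iff, or_assoc]
  · obtain ⟨a, b, c, d, hs, hm⟩ := key h e1 e2
    exact ⟨a, b, c, d, hs, Or.inr (Or.inl hm)⟩
  · obtain ⟨a, b, c, d, hs, hm⟩ := key h.symm e1 e2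
    exact ⟨a, b, c, d, hs, Or.inr (Or.inr hm)⟩

theorem span_eq_top_of_sq_eq_zero_three (hV : Module.finrank k V = 3) {N : V →ₗ[k] V} (hN : N ≠ 0)
    (h : ∀ u, N (N u) = 0) : ∃ u w : V, N w = 0 ∧ Submodule.span k {u, w, N u} = ⊤ := by
  obtain ⟨u, hu⟩ : ∃ u, N u ≠ 0 := by
    by_contra! hc
    exact hN (LinearMap.ext hc)
  obtain ⟨w, hw, hwu⟩ : ∃ w ∈ LinearMap.ker N, w ∉ Submodule.span k {N u} := by
    by_contra! hc
    have h1 : Module.finrank k (LinearMap.ker N) ≤ 1 :=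
      (Submodule.finrank_mono hc).trans (finrank_span_singleton hu).le
    have h2 := Submodule.finrank_mono (range_le_ker_of_sq_eq_zero h)
    have h3 := LinearMap.finrank_range_add_finrank_ker N
    omega
  refine ⟨u, w, hw, ?_⟩
  have hw' : N w = 0 := hw
  have hli : LinearIndependent k ![u, w, N u] := by
    rw [Fintype.linearIndependent_iff]
    intro c hc
    rw [Fin.sum_univ_three] at hc
    simp only [Matrix.cons_val] at hc
    have h1 := congrArg N hc
    simp only [map_add, map_smul, hw', h, smul_zero, add_zero, map_zero] at h1
    have c0 := (smul_eq_zero.1 h1).resolve_right hu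
    rw [c0, zero_smul, zero_add] at hc
    have c1 : c 1 = 0 := by
      by_contra hc1
      refine hwu (Submodule.mem_span_singleton.2 ⟨-((c 1)⁻¹ * c 2), ?_⟩)
      rw [neg_smul, ← smul_smul, ← neg_eq_of_add_eq_zero_right hc, smul_neg, neg_neg,
        smul_smul, inv_mul_cancel₀ hc1, one_smul]
    rw [c1, zero_smul, zero_add] at hc
    have c2 := (smul_eq_zero.1 hc).resolve_right hu
    intro i
    fin_cases i
    exacts [c0, c1, c2]
  have := hli.span_eq_top_of_card_eq_finrank' (by rw [Fintype.card_fin, hV])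
  rwa [range_fin_three] at this

/-- The range lies in the kernel, so the rank is 1 or 2; for rank 2 the range equals the kernel. -/
theorem span_eq_top_of_sq_eq_zero_four (hV : Module.finrank k V = 4) {N : V →ₗ[k] V} (hN : N ≠ 0)
    (h : ∀ u, N (N u) = 0) :
    (∃ u v w : V, N v = 0 ∧ N w = 0 ∧ Submodule.span k {u, N u, v, w} = ⊤) ∨
      ∃ u v : V, Submodule.span k {u, v, N u, N v} = ⊤ := by
  have hr : Module.finrank k (LinearMap.range N) ≠ 0 := fun h0 =>
    hN (LinearMap.range_eq_bot.1 (Submodule.finrank_eq_zero.1 h0))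
  have h2 := Submodule.finrank_mono (range_le_ker_of_sq_eq_zero h)
  have h3 := LinearMap.finrank_range_add_finrank_ker N
  rcases (by omega : Module.finrank k (LinearMap.range N) = 1 ∧
      Module.finrank k (LinearMap.ker N) = 3 ∨ Module.finrank k (LinearMap.range N) = 2 ∧
      Module.finrank k (LinearMap.ker N) = 2) with ⟨e1, e2⟩ | ⟨e1, e2⟩
  · left
    obtain ⟨_, ⟨u, rfl⟩, hu⟩ := exists_span_singleton e1
    have hu0 : N u ≠ 0 := by
      intro h0
      rw [hu, h0, Submodule.span_zero_singleton, finrank_bot] at e1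
      omega
    have hext : ∀ U ≤ LinearMap.ker N, Module.finrank k U < 3 →
        ∃ w ∈ LinearMap.ker N, Module.finrank k U < Module.finrank k ↥(U ⊔ Submodule.span k {w}) := by
      intro U hU hU3
      obtain ⟨w, hw, hwU⟩ : ∃ w ∈ LinearMap.ker N, w ∉ U := by
        by_contra! hc
        have := Submodule.finrank_mono hc
        omega
      refine ⟨w, hw, Submodule.finrank_lt_finrank_of_lt (lt_of_le_of_ne le_sup_left fun he => hwU ?_)⟩
      rw [he]
      exact Submodule.mem_sup_right (Submodule.mem_span_singleton_self w)
    have hsing : ∀ w ∈ LinearMap.ker N, Submodule.span k {w} ≤ LinearMap.ker N := fun w hw =>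
      (Submodule.span_singleton_le_iff_mem _ _).2 hw
    have hu1 := finrank_span_singleton (K := k) hu0
    obtain ⟨v, hv, hv1⟩ := hext _ (hsing _ (h u)) (by omega)
    obtain ⟨w, hw, hw1⟩ : ∃ w ∈ LinearMap.ker N, 3 ≤ Module.finrank k
        ↥(Submodule.span k {N u} ⊔ Submodule.span k {v} ⊔ Submodule.span k {w}) := by
      -- Covering the alternative with `v` itself avoids proving an upper bound on this dimension.
      by_cases h3 : Module.finrank k ↥(Submodule.span k {N u} ⊔ Submodule.span k {v}) < 3
      · obtain ⟨w, hw, hw1⟩ := hext _ (sup_le (hsing _ (h u)) (hsing v hv)) h3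
        exact ⟨w, hw, by omega⟩
      · exact ⟨v, hv, (not_lt.1 h3).trans (Submodule.finrank_mono le_sup_left)⟩
    have hk : Submodule.span k {N u} ⊔ Submodule.span k {v} ⊔ Submodule.span k {w} =
        LinearMap.ker N := Submodule.eq_of_le_of_finrank_le
      (sup_le (sup_le (hsing _ (h u)) (hsing v hv)) (hsing w hw)) (by omega)
    refine ⟨u, v, w, hv, hw, ?_⟩
    rw [eq_top_iff]
    intro x _
    have hx : N x ∈ LinearMap.range N := ⟨x, rfl⟩
    rw [hu] at hx
    obtain ⟨p, hp⟩ := Submodule.mem_span_singleton.1 hx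
    have hx' : x - p • u ∈ LinearMap.ker N := by
      rw [LinearMap.mem_ker, map_sub, ← hp]
      simp
    rw [← hk, ← Submodule.span_union, ← Submodule.span_union] at hx'
    rw [← sub_add_cancel x (p • u)]
    refine add_mem (Submodule.span_mono ?_ hx')
      (Submodule.smul_mem _ _ (Submodule.subset_span (by simp)))
    intro y hy
    simp only [Set.mem_union, Set.mem_insert_iff, Set.mem_singleton_iff] at hy ⊢
    tauto
  · right
    obtain ⟨_, ⟨u, rfl⟩, _, ⟨v, rfl⟩, hu⟩ := exists_span_pair e1
    refine ⟨u, v, ?_⟩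
    rw [eq_top_iff]
    intro x _
    have hx : N x ∈ LinearMap.range N := ⟨x, rfl⟩
    rw [hu] at hx
    obtain ⟨p, q, hpq⟩ := Submodule.mem_span_pair.1 hx
    have hk : LinearMap.range N = LinearMap.ker N :=
      Submodule.eq_of_le_of_finrank_eq (range_le_ker_of_sq_eq_zero h) (by rw [e1, e2])
    have hx' : x - (p • u + q • v) ∈ LinearMap.range N := by
      rw [hk, LinearMap.mem_ker, map_sub, ← hpq]
      simp
    rw [hu] at hx'
    have hle : Submodule.span k {N u, N v} ≤ Submodule.span k {u, v, N u, N v} :=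
      Submodule.span_mono (by intro y hy; simp only [Set.mem_insert_iff] at hy ⊢; tauto)
    rw [← sub_add_cancel x (p • u + q • v)]
    exact add_mem (hle hx') (add_mem (Submodule.smul_mem _ _ (Submodule.subset_span (by simp)))
      (Submodule.smul_mem _ _ (Submodule.subset_span (by simp))))

end LinearAlgebra

/-! ### The case of an isolated linear form -/

section Splittings

variable {k : Type*} [Field k] {γ : MvPolynomial (Fin 4) k →ₗ[k] k}
  {a b c d : MvPolynomial (Fin 4) k}

theorem map_subtype_span {A : Type*} [AddCommGroup A] [Module k A] {W : Submodule k A} {s : Set W}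
    (h : Submodule.span k s = ⊤) : Submodule.span k (Subtype.val '' s) = W := by
  have := congrArg (Submodule.map W.subtype) h
  rwa [Submodule.map_span, Submodule.map_top, Submodule.range_subtype] at this

theorem isFrame_X_zero {u v w : lastVars k} (h : Submodule.span k {u, v, w} = ⊤) :
    IsFrame (X 0) u.1 v.1 w.1 := by
  rw [isFrame_iff_sup_singleton, forms_one_eq_sup]
  congr 1
  have := map_subtype_span h
  rwa [Set.image_insert_eq, Set.image_pair] at this

theorem IsRankOne.mem_nullQuadrics_of_forall (h : IsRankOne γ (X 0)) {u v : lastVars k}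
    (H : ∀ w : lastVars k, γ (u * v * w) = 0) : (u * v : MvPolynomial (Fin 4) k) ∈ nullQuadrics γ := by
  refine h.quadAnn_le (mem_quadAnn.2 ⟨?_, fun w hw => ?_⟩)
  · rw [pow_two]
    exact Submodule.mul_mem_mul u.2 v.2
  · rw [mul_comm]
    exact H ⟨w, hw⟩

/-- The self-adjoint argument is repeated for the ternary part. If its three null quadrics have no
linear syzygy the cone case applies; otherwise the ternary form splits or carries a square-zero
endomorphism. -/
theorem IsRankOne.hasExpectedDimensions_of_finrank_le [IsAlgClosed k] [CharZero k]
    (h : IsRankOne γ (X 0)) (h18 : Module.finrank k ↥(forms k 1 * nullQuadrics γ) ≤ 18) :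
    HasExpectedDimensions γ := by
  by_cases h9 : 9 ≤ Module.finrank k ↥(lastVars k * quadAnn γ (lastVars k))
  · exact hasExpectedDimensions_cone h h9 h18
  have f1 : FiniteDimensional k (lastVars k) := finiteDimensional_of_le_forms lastVars_le
  have f2 : FiniteDimensional k ↥(lastVars k ^ 2) :=
    finiteDimensional_of_le_forms (varSpan_pow_le _ 2)
  have f3 : FiniteDimensional k ↥(lastVars k ^ 3) :=
    finiteDimensional_of_le_forms (varSpan_pow_le _ 3)
  have hV : Module.finrank k (lastVars k) = 3 := by rw [finrank_varSpan, card_lastVars]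
  -- Failure of `h9` means dimension at most 8 in the ten-dimensional space of ternary cubics.
  obtain ⟨M, hM, hM'⟩ := exists_selfAdjoint h.nondegenerateOn_lastVars (by
    rw [finrank_varSpan_pow, card_lastVars]
    have e : (3 + 3 - 1).choose 3 = 10 := by decide
    omega)
  rcases split_or_squareZero M hM hM' with ⟨V₁, V₂, h1, h2, hc, ho⟩ | ⟨N, hN0, hN2, hN⟩
  · obtain ⟨u, v, w, hs, hm⟩ := exists_adapted_of_isCompl_three hV h1 h2 hc
    have hf := isFrame_X_zero hs
    refine hf.hasExpectedDimensions_of_pairs h.nondeg (h.mul_mem v.2) (h.mul_mem w.2)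
      (h.mem_nullQuadrics_of_forall fun z => ?_) (h.mem_nullQuadrics_of_forall fun z => ?_)
    · rcases hm with ⟨hu, hv, hw⟩ | ⟨hu, hv, hw⟩
      · exact ho u hu v hv z
      · rw [mul_comm (u : MvPolynomial (Fin 4) k)]
        exact ho v hv u hu z
    · rcases hm with ⟨hu, hv, hw⟩ | ⟨hu, hv, hw⟩
      · exact ho u hu w hw z
      · rw [mul_comm (u : MvPolynomial (Fin 4) k)]
        exact ho w hw u hu z
  · obtain ⟨u, w, hw, hs⟩ := span_eq_top_of_sq_eq_zero_three hV hN0 hN2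
    have hf := isFrame_X_zero hs
    refine hf.hasExpectedDimensions_of_nilpotent h.nondeg (h.mul_mem u.2) (h.mul_mem w.2)
      (h.mul_mem (N u).2) (h.mem_nullQuadrics_of_forall fun z => ?_)
      (h.mem_nullQuadrics_of_forall fun z => ?_)
    · rw [← hN, hw, ZeroMemClass.coe_zero, zero_mul, zero_mul, map_zero]
    · rw [← hN, hN2, ZeroMemClass.coe_zero, zero_mul, zero_mul, map_zero]

theorem IsFrame.hasExpectedDimensions_of_isolated [IsAlgClosed k] [CharZero k]
    (h : IsFrame a b c d) (hγ : NondegenerateOn γ (forms k 1)) (hab : a * b ∈ nullQuadrics γ)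
    (hac : a * c ∈ nullQuadrics γ) (had : a * d ∈ nullQuadrics γ)
    (h18 : Module.finrank k ↥(forms k 1 * nullQuadrics γ) ≤ 18) : HasExpectedDimensions γ := by
  refine h.hasExpectedDimensions (IsRankOne.hasExpectedDimensions_of_finrank_le
    ⟨Or.inl rfl, h.nondegenerateOn_comp hγ, fun i hi => h.mem_nullQuadrics_comp γ ?_⟩
    (by rwa [h.finrank_forms_mul_nullQuadrics]))
  fin_cases i
  · exact absurd rfl hi
  all_goals simpa [frameHom]

end Splittings

/-! ### Linear forms annihilating a hyperplane that contains them -/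

section Tangent

variable {k : Type*} [Field k] {γ : MvPolynomial (Fin 4) k →ₗ[k] k}
  {a b c d : MvPolynomial (Fin 4) k}

set_option linter.unusedSimpArgs false

/-- A frame with `b * span {b, c, d} ≤ nullQuadrics γ`, normalised with respect to `γ`. -/
structure IsTangentFrame (γ : MvPolynomial (Fin 4) k →ₗ[k] k) (a b c d : MvPolynomial (Fin 4) k) :
    Prop where
  nondeg : NondegenerateOn γ (forms k 1)
  isFrame : IsFrame a b c d
  mul_self_mem : b * b ∈ nullQuadrics γ
  mul_third_mem : b * c ∈ nullQuadrics γ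
  mul_fourth_mem : b * d ∈ nullQuadrics γ
  aab : γ (a * (a * b)) = 1
  aac : γ (a * (a * c)) = 0
  aad : γ (a * (a * d)) = 0

namespace IsTangentFrame

theorem bbb (ht : IsTangentFrame γ a b c d) : γ (b * (b * b)) = 0 :=
  apply_left ht.mul_self_mem ht.isFrame.mem.2.1

theorem bbc (ht : IsTangentFrame γ a b c d) : γ (b * (b * c)) = 0 :=
  apply_left ht.mul_self_mem ht.isFrame.mem.2.2.1

theorem bbd (ht : IsTangentFrame γ a b c d) : γ (b * (b * d)) = 0 :=
  apply_left ht.mul_self_mem ht.isFrame.mem.2.2.2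

theorem abb (ht : IsTangentFrame γ a b c d) : γ (a * (b * b)) = 0 :=
  apply_right ht.mul_self_mem ht.isFrame.mem.1

theorem abc (ht : IsTangentFrame γ a b c d) : γ (a * (b * c)) = 0 :=
  apply_right ht.mul_third_mem ht.isFrame.mem.1

theorem abd (ht : IsTangentFrame γ a b c d) : γ (a * (b * d)) = 0 :=
  apply_right ht.mul_fourth_mem ht.isFrame.mem.1

theorem bcc (ht : IsTangentFrame γ a b c d) : γ (b * (c * c)) = 0 :=
  apply_left ht.mul_third_mem ht.isFrame.mem.2.2.1

theorem bcd (ht : IsTangentFrame γ a b c d) : γ (b * (c * d)) = 0 :=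
  apply_left ht.mul_third_mem ht.isFrame.mem.2.2.2

theorem bdd (ht : IsTangentFrame γ a b c d) : γ (b * (d * d)) = 0 :=
  apply_left ht.mul_fourth_mem ht.isFrame.mem.2.2.2

theorem of_span_eq (ht : IsTangentFrame γ a b c d) {c' d' : MvPolynomial (Fin 4) k}
    (h : Submodule.span k {c', d'} = Submodule.span k {c, d}) :
    IsTangentFrame γ a b c' d' := by
  have hc' : c' ∈ Submodule.span k {c, d} := h ▸ Submodule.subset_span (by simp)
  have hd' : d' ∈ Submodule.span k {c, d} := h ▸ Submodule.subset_span (by simp)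
  have hN : ∀ {v}, v ∈ Submodule.span k {c, d} → b * v ∈ nullQuadrics γ := fun hv =>
    mul_mem_of_mem_span_pair ht.mul_third_mem ht.mul_fourth_mem ht.mul_third_mem ht.mul_fourth_mem
      (Submodule.subset_span (by simp : b ∈ ({b, b} : Set _))) hv
  have h0 : ∀ {v}, v ∈ Submodule.span k {c, d} → γ (a * (a * v)) = 0 := by
    intro v hv
    obtain ⟨p, q, rfl⟩ := Submodule.mem_span_pair.1 hv
    simp only [mul_add, mul_smul_comm, map_add, map_smul, ht.aac, ht.aad, smul_zero, add_zero]
  refine ⟨ht.nondeg, ?_, ht.mul_self_mem, hN hc', hN hd', ht.aab, h0 hc', h0 hd'⟩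
  rw [isFrame_iff_sup, h, ← isFrame_iff_sup]
  exact ht.isFrame

theorem swap (ht : IsTangentFrame γ a b c d) : IsTangentFrame γ a b d c :=
  ht.of_span_eq (by rw [Set.pair_comm])

/-- With c² null, the value e = γ(c·d·d) decides: for e = 0 the scheme is a point of length four,
for e ≠ 0 the space of linear forms splits into two orthogonal pairs. -/
theorem hasExpectedDimensions_of_square [IsAlgClosed k] [CharZero k]
    (ht : IsTangentFrame γ a b c d) (hcc : c * c ∈ nullQuadrics γ) : HasExpectedDimensions γ := by
  have h := ht.isFrame
  have hγ := ht.nondeg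
  obtain ⟨ha, hb, hc, hd⟩ := h.mem
  have acc := apply_right hcc ha
  have ccc := apply_left hcc hc
  have ccd := apply_left hcc hd
  obtain ⟨s, hs⟩ : ∃ s, γ (a * (c * d)) = s := ⟨_, rfl⟩
  obtain ⟨t, ht'⟩ : ∃ t, γ (a * (d * d)) = t := ⟨_, rfl⟩
  obtain ⟨e, he⟩ : ∃ e, γ (c * (d * d)) = e := ⟨_, rfl⟩
  obtain ⟨f, hf⟩ : ∃ f, γ (d * (d * d)) = f := ⟨_, rfl⟩
  obtain ⟨z, hz⟩ : ∃ z, γ (a * (a * a)) = z := ⟨_, rfl⟩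
  have hsm : ∀ (r : k) {v}, v ∈ forms k 1 → r • v ∈ forms k 1 := fun r _ hv =>
    Submodule.smul_mem _ r hv
  by_cases he0 : e = 0
  · subst he0
    have hs0 : s ≠ 0 := by
      rintro rfl
      have hc0 : c = 0 := by
        refine h.eq_zero_of_apply hγ hc ?_ ?_ ?_ ?_ ?_ ?_ ?_ ?_ ?_ ?_ <;>
        · simp only [mul_assoc, mul_comm, mul_left_comm, ht.bbb, ht.bbc, ht.bbd, ht.abb, ht.abc,
            ht.abd, ht.bcc, ht.bcd, ht.bdd, ht.aab, ht.aac, ht.aad, acc, ccc, ccd, hs, ht', he, hf, hz]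
      have := h.eq_zero_of_sum_eq_zero (p := 0) (q := 0) (r := 1) (s := 0) (by simp [hc0])
      exact one_ne_zero this.2.2.1
    -- This correction makes γ(a·d·d) zero, and scaling `b` by s gives γ(a·a·b) = γ(a·c·d).
    have hd1 : d - (t / (2 * s)) • c ∈ forms k 1 := sub_mem hd (hsm _ hc)
    have h' : IsFrame a (s • b) c (d - (t / (2 * s)) • c) := by
      refine h.of_mem ha (hsm _ hb) hc hd1 (Submodule.subset_span (by simp))
        (mem_span_four 0 s⁻¹ 0 0 ?_) (Submodule.subset_span (by simp))
        (mem_span_four 0 0 (t / (2 * s)) 1 ?_)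
      · rw [smul_smul, inv_mul_cancel₀ hs0]
        simp
      · simp
    refine h'.hasExpectedDimensions_quadruplePoint hγ (f / s) ?_ ?_ ?_ hcc ?_ ?_
    · rw [mul_smul_comm, smul_mul_assoc]
      exact Submodule.smul_mem _ _ (Submodule.smul_mem _ _ ht.mul_self_mem)
    · rw [smul_mul_assoc]
      exact Submodule.smul_mem _ _ ht.mul_third_mem
    · rw [smul_mul_assoc, mul_sub, mul_smul_comm]
      exact Submodule.smul_mem _ _
        (sub_mem ht.mul_fourth_mem (Submodule.smul_mem _ _ ht.mul_third_mem))
    · refine h.mem_nullQuadrics (sub_mem (mul_mem_forms hc hd1)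
        (mul_mem_forms ha (hsm _ hb))) ?_ ?_ ?_ ?_ <;>
      · simp only [mul_add, mul_sub, add_mul, sub_mul, smul_mul_assoc, mul_smul_comm, smul_add,
          smul_sub, map_add, map_sub, map_smul, smul_eq_mul, mul_assoc, mul_comm, mul_left_comm,
          ht.bbb, ht.bbc, ht.bbd, ht.abb, ht.abc, ht.abd, ht.bcc, ht.bcd, ht.bdd,
          ht.aab, ht.aac, ht.aad, acc, ccc, ccd, hs, ht', he, hf, hz]
        try field_simp
        try ring
    · refine h.mem_nullQuadrics (sub_mem (mul_mem_forms hd1 hd1)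
        (Submodule.smul_mem _ _ (mul_mem_forms ha hc))) ?_ ?_ ?_ ?_ <;>
      · simp only [mul_add, mul_sub, add_mul, sub_mul, smul_mul_assoc, mul_smul_comm, smul_add,
          smul_sub, map_add, map_sub, map_smul, smul_eq_mul, mul_assoc, mul_comm, mul_left_comm,
          ht.bbb, ht.bbc, ht.bbd, ht.abb, ht.abc, ht.abd, ht.bcc, ht.bcd, ht.bdd,
          ht.aab, ht.aac, ht.aad, acc, ccc, ccd, hs, ht', he, hf, hz]
        try field_simp
        try ring
  -- The coefficients s/e and s²/e make the product of the new `a` and `c` null. In the product of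
  -- the new `a` and `d`, the scalar ν removes the value against `d`, and ρ the remaining value
  -- against `a`.
  · obtain ⟨ν, hν⟩ : ∃ ν, ν = -(t - s / e * f) / e := ⟨_, rfl⟩
    obtain ⟨ρ, hρ⟩ : ∃ ρ, ρ = 2 * (s / e) * t - (s / e) ^ 2 * f := ⟨_, rfl⟩
    have hc1 : c + (s ^ 2 / e) • b ∈ forms k 1 := add_mem hc (hsm _ hb)
    have hd1 : d + ρ • b ∈ forms k 1 := add_mem hd (hsm _ hb)
    have ha1 : a - (s / e) • d + ν • (c + (s ^ 2 / e) • b) ∈ forms k 1 :=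
      add_mem (sub_mem ha (hsm _ hd)) (hsm _ hc1)
    have h' : IsFrame (a - (s / e) • d + ν • (c + (s ^ 2 / e) • b)) b (c + (s ^ 2 / e) • b)
        (d + ρ • b) := by
      refine h.of_mem ha1 hb hc1 hd1 (mem_span_four 1 (-(s / e * ρ)) (-ν) (s / e) ?_)
        (Submodule.subset_span (by simp)) (mem_span_four 0 (-(s ^ 2 / e)) 1 0 ?_)
        (mem_span_four 0 (-ρ) 0 1 ?_)
      · simp only [smul_eq_C_mul, map_neg, map_mul, map_one]
        ring
      · simp
      · simp
    refine h'.hasExpectedDimensions_of_pairs hγ ?_ ?_ ?_ ?_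
    · refine h.mem_nullQuadrics (mul_mem_forms ha1 hc1) ?_ ?_ ?_ ?_ <;>
      · simp only [mul_add, mul_sub, add_mul, sub_mul, smul_mul_assoc, mul_smul_comm, smul_add,
          smul_sub, map_add, map_sub, map_smul, smul_eq_mul, mul_assoc, mul_comm, mul_left_comm,
          ht.bbb, ht.bbc, ht.bbd, ht.abb, ht.abc, ht.abd, ht.bcc, ht.bcd, ht.bdd,
          ht.aab, ht.aac, ht.aad, acc, ccc, ccd, hs, ht', he, hf, hz, hν, hρ]
        try field_simp
        try ring
    · refine h.mem_nullQuadrics (mul_mem_forms ha1 hd1) ?_ ?_ ?_ ?_ <;>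
      · simp only [mul_add, mul_sub, add_mul, sub_mul, smul_mul_assoc, mul_smul_comm, smul_add,
          smul_sub, map_add, map_sub, map_smul, smul_eq_mul, mul_assoc, mul_comm, mul_left_comm,
          ht.bbb, ht.bbc, ht.bbd, ht.abb, ht.abc, ht.abd, ht.bcc, ht.bcd, ht.bdd,
          ht.aab, ht.aac, ht.aad, acc, ccc, ccd, hs, ht', he, hf, hz, hν, hρ]
        try field_simp
        try ring
    · rw [mul_add, mul_smul_comm]
      exact add_mem ht.mul_third_mem (Submodule.smul_mem _ _ ht.mul_self_mem)
    · rw [mul_add, mul_smul_comm]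
      exact add_mem ht.mul_fourth_mem (Submodule.smul_mem _ _ ht.mul_self_mem)

/-- A nonzero γ(c³) lets a correction of `c` by `b` be isolated: c(ea − sc) is null against `c` and
has the value −s² against `a`, which the multiple s²/e of `b` compensates. -/
theorem hasExpectedDimensions_of_product_of_ne [IsAlgClosed k] [CharZero k]
    (ht : IsTangentFrame γ a b c d) (hcd : c * d ∈ nullQuadrics γ) (he0 : γ (c * (c * c)) ≠ 0)
    (h18 : Module.finrank k ↥(forms k 1 * nullQuadrics γ) ≤ 18) : HasExpectedDimensions γ := by
  have h := ht.isFrame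
  obtain ⟨ha, hb, hc, hd⟩ := h.mem
  have acd := apply_right hcd ha
  have ccd := apply_right hcd hc
  have cdd := apply_left hcd hd
  obtain ⟨s, hs⟩ : ∃ s, γ (a * (c * c)) = s := ⟨_, rfl⟩
  obtain ⟨t, ht'⟩ : ∃ t, γ (a * (d * d)) = t := ⟨_, rfl⟩
  obtain ⟨e, he⟩ : ∃ e, γ (c * (c * c)) = e := ⟨_, rfl⟩
  obtain ⟨f, hf⟩ : ∃ f, γ (d * (d * d)) = f := ⟨_, rfl⟩
  obtain ⟨z, hz⟩ : ∃ z, γ (a * (a * a)) = z := ⟨_, rfl⟩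
  rw [he] at he0
  have hsm : ∀ (r : k) {v}, v ∈ forms k 1 → r • v ∈ forms k 1 := fun r _ hv =>
    Submodule.smul_mem _ r hv
  have hc1 : c + (s ^ 2 / e) • b ∈ forms k 1 := add_mem hc (hsm _ hb)
  have ha1 : e • a - s • c ∈ forms k 1 := sub_mem (hsm _ ha) (hsm _ hc)
  have h' : IsFrame (c + (s ^ 2 / e) • b) (e • a - s • c) b d := by
    refine h.of_mem hc1 ha1 hb hd (mem_span_four (s / e) e⁻¹ (-(s / e * (s ^ 2 / e))) 0 ?_)
      (Submodule.subset_span (by simp)) (mem_span_four 1 0 (-(s ^ 2 / e)) 0 ?_)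
      (Submodule.subset_span (by simp))
    · simp only [smul_add, smul_sub, smul_smul, inv_mul_cancel₀ he0, one_smul, neg_smul, zero_smul,
        show e⁻¹ * s = s / e by ring]
      abel
    · simp
  refine h'.hasExpectedDimensions_of_isolated ht.nondeg ?_ ?_ ?_ h18
  · refine h.mem_nullQuadrics (mul_mem_forms hc1 ha1) ?_ ?_ ?_ ?_ <;>
    · simp only [mul_add, mul_sub, add_mul, sub_mul, smul_mul_assoc, mul_smul_comm, smul_add,
        smul_sub, map_add, map_sub, map_smul, smul_eq_mul, mul_assoc, mul_comm, mul_left_comm,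
        ht.bbb, ht.bbc, ht.bbd, ht.abb, ht.abc, ht.abd, ht.bcc, ht.bcd, ht.bdd,
        ht.aab, ht.aac, ht.aad, acd, ccd, cdd, hs, ht', he, hf, hz]
      try field_simp
      try ring
  · rw [mul_comm, mul_add, mul_smul_comm]
    exact add_mem ht.mul_third_mem (Submodule.smul_mem _ _ ht.mul_self_mem)
  · rw [add_mul, smul_mul_assoc]
    exact add_mem hcd (Submodule.smul_mem _ _ ht.mul_fourth_mem)

theorem hasExpectedDimensions_of_product [IsAlgClosed k] [CharZero k]
    (ht : IsTangentFrame γ a b c d) (hcd : c * d ∈ nullQuadrics γ)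
    (h18 : Module.finrank k ↥(forms k 1 * nullQuadrics γ) ≤ 18) : HasExpectedDimensions γ := by
  by_cases he : γ (c * (c * c)) = 0
  swap
  · exact ht.hasExpectedDimensions_of_product_of_ne hcd he h18
  by_cases hf : γ (d * (d * d)) = 0
  swap
  · exact ht.swap.hasExpectedDimensions_of_product_of_ne (by rwa [mul_comm]) hf h18
  have h := ht.isFrame
  have hγ := ht.nondeg
  obtain ⟨ha, hb, hc, hd⟩ := h.mem
  have acd := apply_right hcd ha
  have ccd := apply_right hcd hc
  have cdd := apply_left hcd hd
  obtain ⟨s, hs⟩ : ∃ s, γ (a * (c * c)) = s := ⟨_, rfl⟩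
  obtain ⟨t, ht'⟩ : ∃ t, γ (a * (d * d)) = t := ⟨_, rfl⟩
  obtain ⟨z, hz⟩ : ∃ z, γ (a * (a * a)) = z := ⟨_, rfl⟩
  have ht0 : t ≠ 0 := by
    rintro rfl
    have hd0 : d = 0 := by
      refine h.eq_zero_of_apply hγ hd ?_ ?_ ?_ ?_ ?_ ?_ ?_ ?_ ?_ ?_ <;>
      · simp only [mul_assoc, mul_comm, mul_left_comm, ht.bbb, ht.bbc, ht.bbd, ht.abb, ht.abc, ht.abd, ht.bcc, ht.bcd, ht.bdd,
          ht.aab, ht.aac, ht.aad, acd, ccd, cdd, hs, ht', he, hf, hz]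
    have := h.eq_zero_of_sum_eq_zero (p := 0) (q := 0) (r := 0) (s := 1) (by simp [hd0])
    exact one_ne_zero this.2.2.2
  -- With γ(c³) = γ(d³) = 0 and cd null, the square of c + ρd has only the value s + ρ²t against `a`
  -- to annihilate.
  obtain ⟨ρ, hρ⟩ := IsAlgClosed.exists_pow_nat_eq (-(s / t)) (n := 2) two_pos
  have hs' : s = -(ρ * (ρ * t)) := by
    rw [← mul_assoc, ← pow_two, hρ]
    field_simp
  have hu : c + ρ • d ∈ forms k 1 := add_mem hc (Submodule.smul_mem _ _ hd)
  refine (ht.of_span_eq (c' := c + ρ • d) (d' := d) (span_pair_eq ?_ ?_ ?_ ?_))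
    |>.hasExpectedDimensions_of_square ?_
  · exact Submodule.mem_span_pair.2 ⟨1, ρ, by rw [one_smul]⟩
  · exact Submodule.subset_span (by simp)
  · exact Submodule.mem_span_pair.2 ⟨1, -ρ, by rw [one_smul, neg_smul, add_neg_cancel_right]⟩
  · exact Submodule.subset_span (by simp)
  · refine h.mem_nullQuadrics (mul_mem_forms hu hu) ?_ ?_ ?_ ?_ <;>
    · simp only [mul_add, mul_sub, add_mul, sub_mul, smul_mul_assoc, mul_smul_comm, smul_add,
        smul_sub, map_add, map_sub, map_smul, smul_eq_mul, mul_assoc, mul_comm, mul_left_comm,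
        ht.bbb, ht.bbc, ht.bbd, ht.abb, ht.abc, ht.abd, ht.bcc, ht.bcd, ht.bdd,
        ht.aab, ht.aac, ht.aad, acd, ccd, cdd, hs, hs', ht', he, hf, hz]
      try ring

/-- A change of frame from a linear relation among the cubics `X 2 * n`, `X 3 * n` and
`X 3 * m - X 2 * m'`. -/
theorem hasExpectedDimensions_of_relation [IsAlgClosed k] [CharZero k]
    (ht : IsTangentFrame γ a b c d) {n m m' l : MvPolynomial (Fin 4) k}
    (hn : a * b + n ∈ nullQuadrics γ) (hm : a * c + m ∈ nullQuadrics γ)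
    (hm' : a * d + m' ∈ nullQuadrics γ) (hl : l ∈ Submodule.span k {c, d}) (α β : k)
    (h1 : m + β • n = c * l) (h2 : m' - α • n = d * l) : HasExpectedDimensions γ := by
  have h := ht.isFrame
  obtain ⟨ha, hb, hc, hd⟩ := h.mem
  have hbl : b * l ∈ nullQuadrics γ :=
    mul_mem_of_mem_span_pair ht.mul_third_mem ht.mul_fourth_mem ht.mul_third_mem ht.mul_fourth_mem
      (Submodule.subset_span (by simp : b ∈ ({b, b} : Set _))) hl
  have hsm : ∀ (r : k) {v}, v ∈ forms k 1 → r • v ∈ forms k 1 := fun r _ hv =>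
    Submodule.smul_mem _ r hv
  have hl1 : l ∈ forms k 1 := by
    obtain ⟨p, q, rfl⟩ := Submodule.mem_span_pair.1 hl
    exact add_mem (hsm p hc) (hsm q hd)
  obtain ⟨p, q, hpq⟩ := Submodule.mem_span_pair.1 hl
  have h' : IsFrame (a + l) b (c + β • b) (d - α • b) := by
    refine h.of_mem (add_mem ha hl1) hb (add_mem hc (hsm _ hb)) (sub_mem hd (hsm _ hb))
      (mem_span_four 1 (p * β - q * α) (-p) (-q) ?_) (Submodule.subset_span (by simp))
      (mem_span_four 0 (-β) 1 0 ?_) (mem_span_four 0 α 0 1 ?_)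
    · rw [← hpq]
      simp only [smul_eq_C_mul, map_neg, map_mul, map_one, map_sub]
      ring
    · simp
    · simp
  refine h'.hasExpectedDimensions_of_pairs ht.nondeg ?_ ?_ ?_ ?_
  · have := add_mem (add_mem hm (Submodule.smul_mem _ β hn)) (Submodule.smul_mem _ β hbl)
    convert this using 1
    simp only [smul_eq_C_mul] at h1 ⊢
    linear_combination -h1
  · have := sub_mem (sub_mem hm' (Submodule.smul_mem _ α hn)) (Submodule.smul_mem _ α hbl)
    convert this using 1
    simp only [smul_eq_C_mul] at h2 ⊢
    linear_combination -h2
  · rw [mul_add, mul_smul_comm]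
    exact add_mem ht.mul_third_mem (Submodule.smul_mem _ _ ht.mul_self_mem)
  · rw [mul_sub, mul_smul_comm]
    exact sub_mem ht.mul_fourth_mem (Submodule.smul_mem _ _ ht.mul_self_mem)

/-- A null binary quadric in `c`, `d` factors and is covered by the two preceding cases. If there is
none, `a * b`, `a * c`, `a * d` can be corrected by binary quadrics to null ones. Their cubic
syzygies are then independent, giving β = 1, or a relation among them yields an orthogonal splitting
into pairs. -/
theorem hasExpectedDimensions [IsAlgClosed k] [CharZero k]
    (ht : IsTangentFrame γ a b c d)
    (h18 : Module.finrank k ↥(forms k 1 * nullQuadrics γ) ≤ 18) : HasExpectedDimensions γ := by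
  have h := ht.isFrame
  obtain ⟨ha, hb, hc, hd⟩ := h.mem
  let Q : (Fin 3 → k) →ₗ[k] MvPolynomial (Fin 4) k :=
    (Fintype.linearCombination k ![c * c, c * d, d * d])
  have hQ : ∀ v, Q v = v 0 • (c * c) + v 1 • (c * d) + v 2 • (d * d) := fun v => by
    simp [Q, Fintype.linearCombination_apply, Fin.sum_univ_three]
  have hQ2 : ∀ v, Q v ∈ forms k 2 := fun v => by
    rw [hQ]
    exact add_mem (add_mem (Submodule.smul_mem _ _ (mul_mem_forms hc hc))
      (Submodule.smul_mem _ _ (mul_mem_forms hc hd)))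
      (Submodule.smul_mem _ _ (mul_mem_forms hd hd))
  have hQb : ∀ v, γ (b * Q v) = 0 := fun v => by
    rw [hQ]
    simp only [mul_add, mul_smul_comm, map_add, map_smul, ht.bcc, ht.bcd, ht.bdd, smul_zero,
      add_zero]
  by_cases hE : ∃ v, v ≠ 0 ∧ Q v ∈ nullQuadrics γ
  · obtain ⟨v, hv, hvN⟩ := hE
    rw [hQ] at hvN
    obtain ⟨c', d', hs, e, he, hm⟩ := exists_factorization c d (p := v 0) (q := v 1) (r := v 2)
      (fun h0 => hv (by
        ext i
        fin_cases i
        exacts [h0.1, h0.2.1, h0.2.2]))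
    have hmem : ∀ {x : MvPolynomial (Fin 4) k}, e • x ∈ nullQuadrics γ → x ∈ nullQuadrics γ :=
      fun hx => (Submodule.smul_mem_iff _ he).1 hx
    have ht' := ht.of_span_eq hs
    rcases hm with hm | hm <;> rw [hm] at hvN
    · exact ht'.hasExpectedDimensions_of_product (hmem hvN) h18
    · exact ht'.swap.hasExpectedDimensions_of_square (hmem hvN)
  push Not at hE
  -- The values against `a`, `c`, `d`; those against `b` vanish automatically. Without null binary
  -- quadrics L is injective, hence bijective, so any prescribed values can be corrected.
  let L : (Fin 3 → k) →ₗ[k] (Fin 3 → k) := LinearMap.pi fun i =>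
    γ ∘ₗ LinearMap.mulLeft k (![a, c, d] i) ∘ₗ Q
  have hL : ∀ v i, L v i = γ ((![a, c, d] : Fin 3 → _) i * Q v) := fun v i => rfl
  have hinj : Function.Injective L := by
    rw [injective_iff_map_eq_zero]
    intro v hv
    by_contra hv0
    refine hE v hv0 (h.mem_nullQuadrics (hQ2 v) ?_ (hQb v) ?_ ?_)
    · exact congrFun hv 0
    · exact congrFun hv 1
    · exact congrFun hv 2
  have hsurj := LinearMap.injective_iff_surjective.1 hinj
  have hex : ∀ u ∈ forms k 1, γ (b * (a * u)) = 0 ∨ u = b → ∃ v, a * u + Q v ∈ nullQuadrics γ := by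
    intro u hu hub
    obtain ⟨v, hv⟩ := hsurj fun i => -γ ((![a, c, d] : Fin 3 → _) i * (a * u))
    refine ⟨v, h.mem_nullQuadrics (add_mem (mul_mem_forms ha hu) (hQ2 v)) ?_ ?_ ?_ ?_⟩
    · rw [mul_add, map_add, add_comm, add_eq_zero_iff_eq_neg]
      exact congrFun hv 0
    · rw [mul_add, map_add, hQb, add_zero]
      rcases hub with hub | rfl
      · exact hub
      · rw [mul_left_comm]
        exact ht.abb
    · rw [mul_add, map_add, add_comm, add_eq_zero_iff_eq_neg]
      exact congrFun hv 1
    · rw [mul_add, map_add, add_comm, add_eq_zero_iff_eq_neg]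
      exact congrFun hv 2
  obtain ⟨n, hn⟩ := hex b hb (Or.inr rfl)
  obtain ⟨m, hm⟩ := hex c hc (Or.inl (by rw [mul_left_comm]; exact ht.abc))
  obtain ⟨m', hm'⟩ := hex d hd (Or.inl (by rw [mul_left_comm]; exact ht.abd))
  -- The normalisation γ(a·a·b) = 1 prevents `a * b` from being null.
  have hn0 : n ≠ 0 := by
    rintro rfl
    rw [map_zero, add_zero] at hn
    have := apply_right hn ha
    rw [ht.aab] at this
    exact one_ne_zero this
  -- The four equations are the coefficients of αX₂n + βX₃n + κ(X₃m − X₂m') in the binary cubic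
  -- monomials.
  by_cases hind : ∀ α β κ : k, α * n 0 = κ * m' 0 → α * n 1 + β * n 0 + κ * (m 0 - m' 1) = 0 →
    α * n 2 + β * n 1 + κ * (m 1 - m' 2) = 0 → β * n 2 + κ * m 2 = 0 → α = 0 ∧ β = 0 ∧ κ = 0
  · let q : (Fin 3 → k) → MvPolynomial (Fin 4) k := fun v =>
      v 0 • (X 2 * X 2) + v 1 • (X 2 * X 3) + v 2 • (X 3 * X 3)
    have hq : ∀ v, q v ∈ varSpan k {2, 3} ^ 2 := fun v => by
      have hX2 : (X 2 : MvPolynomial (Fin 4) k) ∈ varSpan k {2, 3} :=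
        Submodule.subset_span ⟨2, by simp, rfl⟩
      have hX3 : (X 3 : MvPolynomial (Fin 4) k) ∈ varSpan k {2, 3} :=
        Submodule.subset_span ⟨3, by simp, rfl⟩
      rw [pow_two]
      exact add_mem (add_mem (Submodule.smul_mem _ _ (Submodule.mul_mem_mul hX2 hX2))
        (Submodule.smul_mem _ _ (Submodule.mul_mem_mul hX2 hX3)))
        (Submodule.smul_mem _ _ (Submodule.mul_mem_mul hX3 hX3))
    have hφ : ∀ v, frameHom a b c d (q v) = Q v := fun v => by
      simp [q, frameHom, hQ]
    refine h.hasExpectedDimensions (hasExpectedDimensions_tangent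
      ⟨Or.inr rfl, h.nondegenerateOn_comp ht.nondeg, fun i hi => h.mem_nullQuadrics_comp γ ?_⟩
      (hq n) (hq m) (hq m') (h.mem_nullQuadrics_comp γ ?_) (h.mem_nullQuadrics_comp γ ?_)
      (h.mem_nullQuadrics_comp γ ?_) (fun α β κ h0 => ?_)
      (by rwa [h.finrank_forms_mul_nullQuadrics]))
    · fin_cases i
      · exact absurd rfl hi
      · simpa [frameHom] using ht.mul_self_mem
      · simpa [frameHom] using ht.mul_third_mem
      · simpa [frameHom] using ht.mul_fourth_mem
    · rw [map_add, hφ]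
      simpa [frameHom] using hn
    · rw [map_add, hφ]
      simpa [frameHom] using hm
    · rw [map_add, hφ]
      simpa [frameHom] using hm'
    · have h' := congrArg (kronecker k) h0
      simp only [q, kronecker, map_add, map_sub, map_smul, map_mul, aeval_X, map_zero,
        Matrix.cons_val, mul_add, mul_smul_comm, ← pow_add, smul_add, smul_sub, smul_smul,
        Nat.reduceAdd] at h'
      have e := fun i (_ : i ∈ [75, 175, 275, 375]) => congrArg (Polynomial.coeff · i) h'
      simp only [Polynomial.coeff_add, Polynomial.coeff_sub, Polynomial.coeff_smul,
        Polynomial.coeff_X_pow, Polynomial.coeff_zero, smul_eq_mul, mul_ite, mul_one, mul_zero,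
        List.forall_mem_cons, Nat.reduceEqDiff, if_true, if_false, add_zero, zero_add, sub_zero,
        zero_sub] at e
      obtain ⟨e1, e2, e3, e4, -⟩ := e
      exact hind α β κ (by linear_combination e1) (by linear_combination e2)
        (by linear_combination e3) (by linear_combination e4)
  · push Not at hind
    obtain ⟨α, β, κ, e1, e2, e3, e4, h0⟩ := hind
    -- Otherwise (αX₂ + βX₃)n = 0 with a nonzero linear factor, so n would vanish.
    have hκ : κ ≠ 0 := by
      rintro rfl
      refine hn0 ?_
      simp only [zero_mul, add_zero] at e1 e2 e3 e4
      have hαβ : α ≠ 0 ∨ β ≠ 0 := by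
        by_contra! hc
        exact h0 hc.1 hc.2 rfl
      ext i
      rcases hαβ with hα | hβ
      · have f0 := (mul_eq_zero.1 e1).resolve_left hα
        rw [f0, mul_zero, add_zero] at e2
        have f1 := (mul_eq_zero.1 e2).resolve_left hα
        rw [f1, mul_zero, add_zero] at e3
        have f2 := (mul_eq_zero.1 e3).resolve_left hα
        fin_cases i
        exacts [f0, f1, f2]
      · have f2 := (mul_eq_zero.1 e4).resolve_left hβ
        rw [f2, mul_zero, zero_add] at e3
        have f1 := (mul_eq_zero.1 e3).resolve_left hβ
        rw [f1, mul_zero, zero_add] at e2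
        have f0 := (mul_eq_zero.1 e2).resolve_left hβ
        fin_cases i
        exacts [f0, f1, f2]
    have g1 : m' 0 = α / κ * n 0 := by
      field_simp
      linear_combination -e1
    have g2 : m' 1 = α / κ * n 1 + (m 0 + β / κ * n 0) := by
      field_simp
      linear_combination -e2
    have g3 : m' 2 = α / κ * n 2 + (m 1 + β / κ * n 1) := by
      field_simp
      linear_combination -e3
    have g4 : m 2 = -(β / κ * n 2) := by
      field_simp
      linear_combination e4
    -- After division by κ the relation says that m + (β/κ)n and m' − (α/κ)n are c and d times the
    -- same linear form.
    refine ht.hasExpectedDimensions_of_relation hn hm hm'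
      (Submodule.mem_span_pair.2 ⟨m 0 + β / κ * n 0, m 1 + β / κ * n 1, rfl⟩) (α / κ) (β / κ) ?_ ?_
    · rw [hQ, hQ, g4]
      simp only [smul_eq_C_mul, map_neg, map_mul, map_add]
      ring
    · rw [hQ, hQ, g1, g2, g3]
      simp only [smul_eq_C_mul, map_mul, map_add]
      ring

end IsTangentFrame

/-- The only value of γ on b·S₂ that can be nonzero on products of frame members is γ(b·a·a), so
nondegeneracy allows the normalisation required by `IsTangentFrame`. -/
theorem IsFrame.hasExpectedDimensions_of_tangent [IsAlgClosed k] [CharZero k]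
    (h : IsFrame a b c d) (hγ : NondegenerateOn γ (forms k 1)) (hbb : b * b ∈ nullQuadrics γ)
    (hbc : b * c ∈ nullQuadrics γ) (hbd : b * d ∈ nullQuadrics γ)
    (h18 : Module.finrank k ↥(forms k 1 * nullQuadrics γ) ≤ 18) : HasExpectedDimensions γ := by
  obtain ⟨ha, hb, hc, hd⟩ := h.mem
  obtain ⟨δ, hδ⟩ : ∃ δ, γ (a * (a * b)) = δ := ⟨_, rfl⟩
  have abb := apply_right hbb ha
  have abc := apply_right hbc ha
  have abd := apply_right hbd ha
  have bbb := apply_left hbb hb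
  have bbc := apply_left hbb hc
  have bbd := apply_left hbb hd
  have bcc := apply_left hbc hc
  have bcd := apply_left hbc hd
  have bdd := apply_left hbd hd
  have hδ0 : δ ≠ 0 := by
    rintro rfl
    have hb0 : b = 0 := by
      refine h.eq_zero_of_apply hγ hb ?_ ?_ ?_ ?_ ?_ ?_ ?_ ?_ ?_ ?_ <;>
      · simp only [mul_assoc, mul_comm, mul_left_comm, abb, abc, abd, bbb, bbc, bbd, bcc, bcd,
          bdd, hδ]
    have := h.eq_zero_of_sum_eq_zero (p := 0) (q := 1) (r := 0) (s := 0) (by simp [hb0])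
    exact one_ne_zero this.2.1
  have hsm : ∀ (r : k) {v}, v ∈ forms k 1 → r • v ∈ forms k 1 := fun r _ hv =>
    Submodule.smul_mem _ r hv
  refine IsTangentFrame.hasExpectedDimensions (a := a) (b := δ⁻¹ • b)
    (c := c - (γ (a * (a * c)) / δ) • b) (d := d - (γ (a * (a * d)) / δ) • b)
    ⟨hγ, ?_, ?_, ?_, ?_, ?_, ?_, ?_⟩ h18
  · refine h.of_mem ha (hsm _ hb) (sub_mem hc (hsm _ hb)) (sub_mem hd (hsm _ hb))
      (Submodule.subset_span (by simp)) (mem_span_four 0 δ 0 0 ?_)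
      (mem_span_four 0 (γ (a * (a * c))) 1 0 ?_) (mem_span_four 0 (γ (a * (a * d))) 0 1 ?_)
    · simp [smul_smul, hδ0]
    · simp [smul_smul, div_eq_mul_inv]
    · simp [smul_smul, div_eq_mul_inv]
  · rw [smul_mul_assoc, mul_smul_comm]
    exact Submodule.smul_mem _ _ (Submodule.smul_mem _ _ hbb)
  · rw [smul_mul_assoc, mul_sub, mul_smul_comm]
    exact Submodule.smul_mem _ _ (sub_mem hbc (Submodule.smul_mem _ _ hbb))
  · rw [smul_mul_assoc, mul_sub, mul_smul_comm]
    exact Submodule.smul_mem _ _ (sub_mem hbd (Submodule.smul_mem _ _ hbb))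
  · simp only [mul_smul_comm, map_smul, hδ, smul_eq_mul]
    exact inv_mul_cancel₀ hδ0
  · simp only [mul_sub, mul_smul_comm, map_sub, map_smul, hδ, smul_eq_mul]
    field_simp
    ring
  · simp only [mul_sub, mul_smul_comm, map_sub, map_smul, hδ, smul_eq_mul]
    field_simp
    ring

end Tangent

/-! ### Assembling the cases -/

section Classification

variable {k : Type*} [Field k] {γ : MvPolynomial (Fin 4) k →ₗ[k] k}

theorem isFrame_of_span_eq_top {a b c d : forms k 1} (h : Submodule.span k {a, b, c, d} = ⊤) :
    IsFrame a.1 b.1 c.1 d.1 := by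
  have := map_subtype_span h
  rwa [Set.image_insert_eq, Set.image_insert_eq, Set.image_pair] at this

theorem mem_nullQuadrics_of_forall {u v : forms k 1} (H : ∀ w : forms k 1, γ (u * v * w) = 0) :
    (u * v : MvPolynomial (Fin 4) k) ∈ nullQuadrics γ := by
  refine mem_nullQuadrics.2 ⟨mul_mem_forms u.2 v.2, fun w hw => ?_⟩
  rw [mul_comm]
  exact H ⟨w, hw⟩

/-- The classification of the cubics whose apolar ideal is not generated by quadrics. -/
theorem hasExpectedDimensions_of_finrank_le [IsAlgClosed k] [CharZero k]
    (hγ : NondegenerateOn γ (forms k 1))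
    (h18 : Module.finrank k ↥(forms k 1 * nullQuadrics γ) ≤ 18) : HasExpectedDimensions γ := by
  have hV : Module.finrank k (forms k 1) = 4 := finrank_forms 1
  have f2 : FiniteDimensional k ↥(forms k 1 ^ 2) := by rw [forms_one_pow]; infer_instance
  have f3 : FiniteDimensional k ↥(forms k 1 ^ 3) := by rw [forms_one_pow]; infer_instance
  obtain ⟨M, hM, hM'⟩ := exists_selfAdjoint hγ (by
    rw [forms_one_pow, finrank_forms]
    have e : (3 + 3).choose 3 = 20 := by decide
    rw [e]
    exact Nat.add_le_add_right h18 2)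
  rcases split_or_squareZero M hM hM' with ⟨V₁, V₂, h1, h2, hc, ho⟩ | ⟨N, hN0, hN2, hN⟩
  · have hmul : ∀ {u v}, u ∈ V₁ → v ∈ V₂ → (u * v : MvPolynomial (Fin 4) k) ∈ nullQuadrics γ :=
      fun hu hv => mem_nullQuadrics_of_forall fun w => ho _ hu _ hv w
    have hmul' : ∀ {u v}, u ∈ V₂ → v ∈ V₁ → (u * v : MvPolynomial (Fin 4) k) ∈ nullQuadrics γ :=
      fun hu hv => by rw [mul_comm]; exact hmul hv hu
    obtain ⟨a, b, c, d, hs, hm⟩ := exists_adapted_of_isCompl_four hV h1 h2 hc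
    have hf := isFrame_of_span_eq_top hs
    rcases hm with ⟨ha, hb, hc, hd⟩ | ⟨ha, hb, hc, hd⟩ | ⟨ha, hb, hc, hd⟩
    · exact hf.hasExpectedDimensions_of_pairs hγ (hmul ha hc) (hmul ha hd) (hmul hb hc) (hmul hb hd)
    · exact hf.hasExpectedDimensions_of_isolated hγ (hmul ha hb) (hmul ha hc) (hmul ha hd) h18
    · exact hf.hasExpectedDimensions_of_isolated hγ (hmul' ha hb) (hmul' ha hc) (hmul' ha hd) h18
  -- Self-adjointness moves `N` onto `v`, so the range of `N` annihilates its kernel.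
  · have hker : ∀ u v, N v = 0 → (N u * v : MvPolynomial (Fin 4) k) ∈ nullQuadrics γ := by
      intro u v hv
      refine mem_nullQuadrics_of_forall fun w => ?_
      rw [hN, hv, ZeroMemClass.coe_zero, mul_zero, zero_mul, map_zero]
    rcases span_eq_top_of_sq_eq_zero_four hV hN0 hN2 with ⟨u, v, w, hv, hw, hs⟩ | ⟨u, v, hs⟩
    · exact (isFrame_of_span_eq_top hs).hasExpectedDimensions_of_tangent hγ (hker u _ (hN2 u))
        (hker u v hv) (hker u w hw) h18
    · have hf := isFrame_of_span_eq_top hs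
      -- In rank two only products of `N u`, `N v` among themselves are known to be null. A third
      -- factor for one of them is sought among the quadrics in u, v apolar to both.
      obtain ⟨x', y', hxy, hΛ⟩ := exists_apolar_product (u : MvPolynomial (Fin 4) k) v
        (γ ∘ₗ LinearMap.mulLeft k (N u).1) (γ ∘ₗ LinearMap.mulLeft k (N v).1)
      have hspan : Submodule.span k {(u : MvPolynomial (Fin 4) k), v.1} ≤ forms k 1 := by
        rw [Submodule.span_le]
        rintro x (rfl | rfl)
        exacts [u.2, v.2]
      have hx' : x' ∈ Submodule.span k {(u : MvPolynomial (Fin 4) k), v.1} :=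
        hxy ▸ Submodule.subset_span (by simp)
      have hy' : y' ∈ Submodule.span k {(u : MvPolynomial (Fin 4) k), v.1} :=
        hxy ▸ Submodule.subset_span (by simp)
      obtain ⟨x, rfl⟩ : ∃ x : forms k 1, x.1 = x' := ⟨⟨x', hspan hx'⟩, rfl⟩
      obtain ⟨y, rfl⟩ : ∃ y : forms k 1, y.1 = y' := ⟨⟨y', hspan hy'⟩, rfl⟩
      have hxy' : Submodule.span k {x, y} = Submodule.span k {u, v} := by
        refine Submodule.map_injective_of_injective (forms k 1).subtype_injective ?_
        rw [Submodule.map_span, Submodule.map_span, Set.image_pair, Set.image_pair]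
        exact hxy
      have hNxy : Submodule.span k {(N x).1, (N y).1} = Submodule.span k {(N u).1, (N v).1} := by
        have := congrArg (Submodule.map ((forms k 1).subtype ∘ₗ N)) hxy'
        rwa [Submodule.map_span, Submodule.map_span, Set.image_pair, Set.image_pair] at this
      have hf' : IsFrame x.1 y.1 (N x).1 (N y).1 := by
        rw [isFrame_iff_sup, hxy, hNxy, ← isFrame_iff_sup]
        exact hf
      -- By self-adjointness γ(N(z)z'w) = γ(N(w)zz'), and N(w) is a combination of `N u` and `N v`.
      have key : ∀ z z' : forms k 1, γ (N u * (z * z')) = 0 → γ (N v * (z * z')) = 0 →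
          (N z * z' : MvPolynomial (Fin 4) k) ∈ nullQuadrics γ := by
        intro z z' hu hv
        have h0 : (⊤ : Submodule k (forms k 1)) ≤
            LinearMap.ker (γ ∘ₗ LinearMap.mulRight k (z.1 * z'.1) ∘ₗ (forms k 1).subtype ∘ₗ N) := by
          rw [← hs, Submodule.span_le]
          have hN2' : ∀ w, γ ((N (N w)).1 * (z.1 * z'.1)) = 0 := fun w => by
            rw [hN2, ZeroMemClass.coe_zero, zero_mul, map_zero]
          rintro w (rfl | rfl | rfl | rfl)
          exacts [hu, hv, hN2' _, hN2' _]
        refine mem_nullQuadrics_of_forall fun w => ?_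
        have h1 : γ ((N w).1 * (z * z' : MvPolynomial (Fin 4) k)) = 0 :=
          h0 (Submodule.mem_top (x := w))
        rw [mul_right_comm, hN, ← h1]
        congr 1
        ring
      rcases hΛ with ⟨e1, e2⟩ | ⟨e1, e2⟩
      · have hf'' : IsFrame x.1 (N x).1 (N y).1 y.1 :=
          hf'.of_mem x.2 (N x).2 (N y).2 y.2 (Submodule.subset_span (by simp))
            (Submodule.subset_span (by simp)) (Submodule.subset_span (by simp))
            (Submodule.subset_span (by simp))
        exact hf''.hasExpectedDimensions_of_tangent hγ (hker x _ (hN2 x)) (hker x _ (hN2 y))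
          (key x y e1 e2) h18
      · have hf'' : IsFrame x.1 (N y).1 (N x).1 y.1 :=
          hf'.of_mem x.2 (N y).2 (N x).2 y.2 (Submodule.subset_span (by simp))
            (Submodule.subset_span (by simp)) (Submodule.subset_span (by simp))
            (Submodule.subset_span (by simp))
        exact hf''.hasExpectedDimensions_of_tangent hγ (hker y _ (hN2 y)) (hker y _ (hN2 x))
          (key y y e1 e2) h18

end Classification

/-! ### Hilbert functions of quotients by graded ideals -/

section HilbertFunction

variable {k : Type*} [Field k]

theorem homogeneousComponent_mem_forms (n : ℕ) (p : MvPolynomial (Fin 4) k) :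
    homogeneousComponent n p ∈ forms k n :=
  homogeneousComponent_mem n p

theorem sub_homogeneousComponent_mem {n : ℕ} {p : MvPolynomial (Fin 4) k}
    (hp : p ∈ idealOfVars (Fin 4) k ^ n) :
    p - homogeneousComponent n p ∈ idealOfVars (Fin 4) k ^ (n + 1) := by
  rw [mem_pow_idealOfVars_iff'] at hp ⊢
  intro x hx
  rw [coeff_sub, coeff_homogeneousComponent]
  split_ifs with h
  · exact sub_self _
  · rw [hp x (by omega), sub_zero]

theorem homogeneousComponent_eq_zero_of_mem {n m : ℕ} (h : n < m) {p : MvPolynomial (Fin 4) k}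
    (hp : p ∈ idealOfVars (Fin 4) k ^ m) : homogeneousComponent n p = 0 := by
  rw [mem_pow_idealOfVars_iff] at hp
  refine homogeneousComponent_eq_zero' _ _ fun d hd => ?_
  have := hp d hd
  omega

theorem forms_le_pow_idealOfVars {n : ℕ} {p : MvPolynomial (Fin 4) k} (hp : p ∈ forms k n) :
    p ∈ idealOfVars (Fin 4) k ^ n := by
  rw [mem_pow_idealOfVars_iff]
  intro x hx
  have := (mem_homogeneousSubmodule n p).1 hp (mem_support_iff.1 hx)
  rw [← this, Finsupp.degree_eq_weight_one]
  exact le_rfl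

theorem homogeneousComponent_eq_self_of_mem {n : ℕ} {p : MvPolynomial (Fin 4) k}
    (hp : p ∈ forms k n) : homogeneousComponent n p = p :=
  homogeneousComponent_eq_self ((mem_homogeneousSubmodule n p).1 hp)

/-- Forms of degree i map onto the quotient of consecutive powers of the ideal. When taking the
component of degree i preserves J, the kernel consists of the forms of degree i in J. -/
theorem quotientHilbertFunction_add_finrank {J : Ideal (MvPolynomial (Fin 4) k)} {i : ℕ}
    (hJ : ∀ f ∈ J, homogeneousComponent i f ∈ J) :
    quotientHilbertFunction J i + Module.finrank k ↥(J.restrictScalars k ⊓ forms k i) =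
      Module.finrank k (forms k i) := by
  have hM : ∀ n, Ideal.span (Set.range fun i : Fin 4 => Ideal.Quotient.mk J (X i)) ^ n =
      (idealOfVars (Fin 4) k ^ n).map (Ideal.Quotient.mk J) := by
    intro n
    rw [Ideal.map_pow, idealOfVars, Ideal.map_span, ← Set.range_comp]
    rfl
  rw [quotientHilbertFunction, idealHilbertFunction]
  set M := Ideal.span (Set.range fun i : Fin 4 => Ideal.Quotient.mk J (X i)) with hMdef
  have hmem : ∀ {n} {x}, x ∈ M ^ n ↔ ∃ p ∈ idealOfVars (Fin 4) k ^ n,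
      Ideal.Quotient.mk J p = x := by
    intro n x
    rw [hM]
    exact Ideal.mem_map_iff_of_surjective _ Ideal.Quotient.mk_surjective
  let φ : forms k i →ₗ[k] ↥(M ^ i) :=
    LinearMap.codRestrict ((M ^ i).restrictScalars k)
      ((Ideal.Quotient.mkₐ k J).toLinearMap.domRestrict (forms k i))
      fun x => hmem.2 ⟨x, forms_le_pow_idealOfVars x.2, rfl⟩
  let ψ := ((M ^ (i + 1)).submoduleOf (M ^ i)).mkQ.restrictScalars k ∘ₗ φ
  have hsurj : Function.Surjective ψ := by
    intro y
    obtain ⟨⟨x, hx⟩, rfl⟩ := Submodule.mkQ_surjective _ y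
    obtain ⟨p, hp, rfl⟩ := hmem.1 hx
    refine ⟨⟨homogeneousComponent i p, homogeneousComponent_mem_forms i p⟩, ?_⟩
    refine (Submodule.Quotient.eq _).2 ?_
    change Ideal.Quotient.mk J _ - Ideal.Quotient.mk J p ∈ M ^ (i + 1)
    refine hmem.2 ⟨homogeneousComponent i p - p, ?_, map_sub _ _ _⟩
    rw [← neg_sub]
    exact neg_mem (sub_homogeneousComponent_mem hp)
  have hker : (LinearMap.ker ψ).map (forms k i).subtype = J.restrictScalars k ⊓ forms k i := by
    ext x
    constructor
    · rintro ⟨⟨y, hy⟩, hy0, rfl⟩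
      refine ⟨?_, hy⟩
      have h1 := (Submodule.Quotient.mk_eq_zero _).1 (show Submodule.Quotient.mk (φ ⟨y, hy⟩) = 0
        from hy0)
      change Ideal.Quotient.mk J y ∈ M ^ (i + 1) at h1
      obtain ⟨p, hp, hpy⟩ := hmem.1 h1
      have h2 : y - p ∈ J := Ideal.Quotient.eq.1 hpy.symm
      have h3 := hJ _ h2
      rw [map_sub, homogeneousComponent_eq_self_of_mem hy,
        homogeneousComponent_eq_zero_of_mem (Nat.lt_succ_self i) hp, sub_zero] at h3
      exact h3
    · rintro ⟨hxJ, hx⟩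
      refine ⟨⟨x, hx⟩, ?_, rfl⟩
      refine (Submodule.Quotient.mk_eq_zero _).2 ?_
      have h0 : φ ⟨x, hx⟩ = 0 := Subtype.ext (Ideal.Quotient.eq_zero_iff_mem.2 hxJ)
      rw [h0]
      exact zero_mem _
  have h1 := LinearMap.finrank_range_add_finrank_ker ψ
  rw [LinearMap.range_eq_top.2 hsurj, finrank_top,
    ← finrank_map_of_injective _ (Submodule.subtype_injective (forms k i)), hker] at h1
  exact h1

end HilbertFunction

/-! ### The apolarity pairing -/

section Apolarity

variable {k : Type*} [Field k]

theorem apolarAction_mem_forms {n : ℕ} {v h : MvPolynomial (Fin 4) k} (hv : v ∈ forms k 1)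
    (hh : h ∈ forms k (n + 1)) : apolarAction k v h ∈ forms k n := by
  rw [forms_one_eq_span] at hv
  induction hv using Submodule.span_induction with
  | mem x hx =>
    obtain ⟨i, rfl⟩ := hx
    rw [apolarAction_X]
    exact ((mem_homogeneousSubmodule _ _).1 hh).pderiv
  | zero => rw [map_zero]; exact zero_mem _
  | add x y _ _ hx hy => rw [map_add]; exact add_mem hx hy
  | smul c x _ hx => rw [map_smul]; exact Submodule.smul_mem _ _ hx

theorem apolarAction_eq_zero_of_mem {v h : MvPolynomial (Fin 4) k} (hv : v ∈ forms k 1)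
    (hh : h ∈ forms k 0) : apolarAction k v h = 0 := by
  rw [show forms k 0 = 1 from homogeneousSubmodule_zero _] at hh
  obtain ⟨c, rfl⟩ := Submodule.mem_one.1 hh
  rw [forms_one_eq_span] at hv
  induction hv using Submodule.span_induction with
  | mem x hx =>
    obtain ⟨i, rfl⟩ := hx
    rw [apolarAction_X]
    exact Derivation.map_algebraMap _ _
  | zero => rw [map_zero]; rfl
  | add x y _ _ hx hy => rw [map_add, LinearMap.add_apply, hx, hy, add_zero]
  | smul c x _ hx => rw [map_smul, LinearMap.smul_apply, hx, smul_zero]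

theorem apolarAction_mem_forms_of_add {d n : ℕ} {f h : MvPolynomial (Fin 4) k}
    (hf : f ∈ forms k d) (hh : h ∈ forms k (n + d)) : apolarAction k f h ∈ forms k n := by
  induction d generalizing f n with
  | zero =>
    rw [show forms k 0 = 1 from homogeneousSubmodule_zero _] at hf
    obtain ⟨c, rfl⟩ := Submodule.mem_one.1 hf
    rw [AlgHom.commutes, Module.algebraMap_end_apply]
    exact Submodule.smul_mem _ _ hh
  | succ d ih =>
    rw [add_comm, ← forms_mul] at hf
    induction hf using Submodule.mul_induction_on' with
    | mem_mul_mem v hv w hw =>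
      rw [map_mul, Module.End.mul_apply]
      exact apolarAction_mem_forms hv (ih hw (by rwa [show n + 1 + d = n + (d + 1) by omega]))
    | add x _ y _ hx hy => rw [map_add]; exact add_mem hx hy

theorem apolarAction_eq_zero_of_lt {d n : ℕ} (hd : n < d) {f h : MvPolynomial (Fin 4) k}
    (hf : f ∈ forms k d) (hh : h ∈ forms k n) : apolarAction k f h = 0 := by
  rw [show d = (d - n - 1) + (1 + n) by omega, ← forms_mul] at hf
  induction hf using Submodule.mul_induction_on' with
  | mem_mul_mem u hu w hw =>
    rw [← forms_mul] at hw
    rw [map_mul, Module.End.mul_apply]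
    have : apolarAction k w h = 0 := by
      induction hw using Submodule.mul_induction_on' with
      | mem_mul_mem v hv w hw =>
        rw [map_mul, Module.End.mul_apply]
        exact apolarAction_eq_zero_of_mem hv
          (apolarAction_mem_forms_of_add hw (by rwa [zero_add]))
      | add x _ y _ hx hy => rw [map_add, LinearMap.add_apply, hx, hy, add_zero]
    rw [this, map_zero]
  | add x _ y _ hx hy => rw [map_add, LinearMap.add_apply, hx, hy, add_zero]

/-- The apolarity pairing is perfect. -/
theorem eq_zero_of_forall_apolarAction [CharZero k] {n : ℕ} {h : MvPolynomial (Fin 4) k}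
    (hh : h ∈ forms k n) (H : ∀ p ∈ forms k n, constantCoeff (apolarAction k p h) = 0) :
    h = 0 := by
  induction n generalizing h with
  | zero =>
    have h1 := H 1 (by rw [show forms k 0 = 1 from homogeneousSubmodule_zero _]
                       exact Submodule.mem_one.2 ⟨1, map_one _⟩)
    rw [show forms k 0 = 1 from homogeneousSubmodule_zero _] at hh
    obtain ⟨c, rfl⟩ := Submodule.mem_one.1 hh
    rw [map_one, Module.End.one_apply, algebraMap_eq, constantCoeff_C] at h1
    rw [h1, map_zero]
  | succ n ih =>
    refine eq_zero_of_pderiv_eq_zero (Nat.succ_ne_zero n) hh fun i => ?_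
    rw [← apolarAction_X]
    refine ih (apolarAction_mem_forms (X_mem_forms i) hh) fun p hp => ?_
    rw [← Module.End.mul_apply, ← map_mul]
    exact H _ (mul_mem_forms hp (X_mem_forms i))

/-- The functional on forms of degree three defined by a cubic through the apolarity pairing. -/
def apolarFunctional (g : MvPolynomial (Fin 4) k) : MvPolynomial (Fin 4) k →ₗ[k] k :=
  (lcoeff k 0) ∘ₗ LinearMap.applyₗ g ∘ₗ (apolarAction k).toLinearMap

theorem apolarFunctional_apply (g f : MvPolynomial (Fin 4) k) :
    apolarFunctional g f = constantCoeff (apolarAction k f g) := rfl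

theorem mem_apolarIdeal {g f : MvPolynomial (Fin 4) k} :
    f ∈ apolarIdeal g ↔ apolarAction k f g = 0 := Iff.rfl

variable {g : MvPolynomial (Fin 4) k}

/-- Perfectness of the pairing in complementary degrees lets the whole apolar ideal be read off from
one functional. -/
theorem mem_apolarIdeal_iff [CharZero k] {d e n : ℕ} (hg : g ∈ forms k n) (h : e + d = n)
    {f : MvPolynomial (Fin 4) k} (hf : f ∈ forms k d) :
    f ∈ apolarIdeal g ↔ ∀ p ∈ forms k e, apolarFunctional g (p * f) = 0 := by
  simp only [mem_apolarIdeal, apolarFunctional_apply, map_mul, Module.End.mul_apply]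
  constructor
  · intro h0 p _
    rw [h0, map_zero, map_zero]
  · subst h
    exact eq_zero_of_forall_apolarAction (apolarAction_mem_forms_of_add hf hg)

/-- Components of f of different degrees send g to forms of different degrees or to zero, so their
contributions cannot cancel. -/
theorem homogeneousComponent_mem_apolarIdeal {n : ℕ} (hg : g ∈ forms k n)
    {f : MvPolynomial (Fin 4) k} (hf : f ∈ apolarIdeal g) (d : ℕ) :
    homogeneousComponent d f ∈ apolarIdeal g := by
  rw [mem_apolarIdeal] at hf ⊢
  by_cases hd : d ≤ n
  · have key : ∀ e, homogeneousComponent (n - d) (apolarAction k (homogeneousComponent e f) g) =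
        if e = d then apolarAction k (homogeneousComponent d f) g else 0 := by
      intro e
      by_cases he : e ≤ n
      · have := apolarAction_mem_forms_of_add (n := n - e) (homogeneousComponent_mem_forms e f)
          (by rwa [Nat.sub_add_cancel he])
        rw [homogeneousComponent_of_mem this]
        by_cases h : e = d
        · rw [h, if_pos rfl, if_pos rfl]
        · rw [if_neg h, if_neg (by omega)]
      · rw [apolarAction_eq_zero_of_lt (by omega) (homogeneousComponent_mem_forms e f) hg, map_zero,
          if_neg (by omega)]
    have h0 := congrArg (homogeneousComponent (n - d)) hf
    rw [← sum_homogeneousComponent f, map_sum, LinearMap.sum_apply, map_sum, map_zero] at h0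
    rw [Finset.sum_congr rfl fun e _ => key e, Finset.sum_ite_eq'] at h0
    split_ifs at h0 with hmem
    · exact h0
    · rw [homogeneousComponent_eq_zero _ _ (by rw [Finset.mem_range] at hmem; omega), map_zero]
      rfl
  · exact apolarAction_eq_zero_of_lt (by omega) (homogeneousComponent_mem_forms d f) hg

end Apolarity

/-! ### Lowest-degree parts of the apolar ideal -/

section Decomposition

variable {k : Type*} [Field k]

theorem homogeneousComponent_add_add {n m : ℕ} {q c r : MvPolynomial (Fin 4) k}
    (hq : q ∈ forms k n) (hc : c ∈ forms k (n + 1)) (hr : r ∈ idealOfVars (Fin 4) k ^ (n + 2))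
    (hm : m < n + 2) :
    homogeneousComponent m (q + c + r) = (if n = m then q else 0) + if n + 1 = m then c else 0 := by
  rw [map_add, map_add, homogeneousComponent_of_mem hq, homogeneousComponent_of_mem hc,
    homogeneousComponent_eq_zero_of_mem hm hr, add_zero]
  simp only [eq_comm]

theorem exists_add_add {n : ℕ} {f : MvPolynomial (Fin 4) k} (hf : f ∈ idealOfVars (Fin 4) k ^ n) :
    ∃ r ∈ idealOfVars (Fin 4) k ^ (n + 2),
      f = homogeneousComponent n f + homogeneousComponent (n + 1) f + r := by
  refine ⟨f - homogeneousComponent n f - homogeneousComponent (n + 1) f, ?_, by ring⟩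
  have h := sub_homogeneousComponent_mem (sub_homogeneousComponent_mem hf)
  rwa [map_sub, homogeneousComponent_of_mem (homogeneousComponent_mem_forms n f),
    if_neg (by omega), sub_zero] at h

theorem mul_mem_pow_idealOfVars {a b c : ℕ} (h : c ≤ a + b) {p q : MvPolynomial (Fin 4) k}
    (hp : p ∈ idealOfVars (Fin 4) k ^ a) (hq : q ∈ idealOfVars (Fin 4) k ^ b) :
    p * q ∈ idealOfVars (Fin 4) k ^ c :=
  Ideal.pow_le_pow_right h (pow_add (idealOfVars (Fin 4) k) a b ▸ Ideal.mul_mem_mul hp hq)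

theorem forms_le_apolarIdeal {g : MvPolynomial (Fin 4) k} (hg : g ∈ forms k 3) {d : ℕ} (hd : 3 < d)
    {f : MvPolynomial (Fin 4) k} (hf : f ∈ forms k d) : f ∈ apolarIdeal g :=
  apolarAction_eq_zero_of_lt hd hf hg

theorem vectorFunction_add_finrank {g : MvPolynomial (Fin 4) k} (hg : g ∈ forms k 3)
    (hA : quotientHilbertFunction (apolarIdeal g) = vectorFunction [1, 4, 4, 1]) (i : ℕ) :
    vectorFunction [1, 4, 4, 1] i +
      Module.finrank k ↥((apolarIdeal g).restrictScalars k ⊓ forms k i) = (3 + i).choose i := by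
  rw [← hA, ← finrank_forms (k := k) i]
  exact quotientHilbertFunction_add_finrank
    fun f hf => homogeneousComponent_mem_apolarIdeal hg hf i

theorem eq_zero_of_finrank_inf_forms {I : Ideal (MvPolynomial (Fin 4) k)} {i : ℕ}
    (h : Module.finrank k ↥(I.restrictScalars k ⊓ forms k i) = 0) {f : MvPolynomial (Fin 4) k}
    (hf : f ∈ I) (hfi : f ∈ forms k i) : f = 0 := by
  have := finiteDimensional_of_le_forms
    (inf_le_right : I.restrictScalars k ⊓ forms k i ≤ forms k i)
  have h0 := Submodule.finrank_eq_zero.1 h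
  exact (Submodule.mem_bot k).1 (h0 ▸ (⟨hf, hfi⟩ : f ∈ I.restrictScalars k ⊓ forms k i))

theorem mul_le_apolarIdeal_sq {g : MvPolynomial (Fin 4) k}
    {U W : Submodule k (MvPolynomial (Fin 4) k)}
    (hU : U ≤ (apolarIdeal g).restrictScalars k) (hW : W ≤ (apolarIdeal g).restrictScalars k) :
    U * W ≤ (apolarIdeal g ^ 2).restrictScalars k := by
  rw [Submodule.mul_le, sq]
  exact fun u hu w hw => Ideal.mul_mem_mul (hU hu) (hW hw)

theorem IsMinimalHomogeneousGenerators.notMem_span {n : ℕ} {I : Ideal (MvPolynomial (Fin n) k)}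
    {B : Set (MvPolynomial (Fin n) k)} (hB : IsMinimalHomogeneousGenerators I B)
    {b : MvPolynomial (Fin n) k} (hb : b ∈ B) : b ∉ Ideal.span (B \ {b}) := by
  intro h
  refine (hB.2 (y := B \ {b}) ⟨fun f hf => hB.1.1 f hf.1, ?_⟩ Set.sdiff_subset hb).2 rfl
  rw [← hB.1.2]
  refine le_antisymm (Ideal.span_mono Set.sdiff_subset) (Ideal.span_le.2 fun x hx => ?_)
  by_cases hxb : x = b
  · rwa [hxb]
  · exact Ideal.subset_span ⟨hx, hxb⟩

theorem apolarIdeal_eq_zero_of_mem_forms {g : MvPolynomial (Fin 4) k} (hg : g ∈ forms k 3)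
    (hA : quotientHilbertFunction (apolarIdeal g) = vectorFunction [1, 4, 4, 1]) {i : ℕ}
    (hi : i < 2) {f : MvPolynomial (Fin 4) k} (hf : f ∈ apolarIdeal g) (hfi : f ∈ forms k i) :
    f = 0 := by
  refine eq_zero_of_finrank_inf_forms ?_ hf hfi
  have h := vectorFunction_add_finrank hg hA i
  interval_cases i <;> simpa [vectorFunction] using h

theorem apolarIdeal_le_pow_idealOfVars {g : MvPolynomial (Fin 4) k} (hg : g ∈ forms k 3)
    (hA : quotientHilbertFunction (apolarIdeal g) = vectorFunction [1, 4, 4, 1])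
    {f : MvPolynomial (Fin 4) k} (hf : f ∈ apolarIdeal g) : f ∈ idealOfVars (Fin 4) k ^ 2 := by
  have h : ∀ i < 2, homogeneousComponent i f = 0 := fun i hi =>
    apolarIdeal_eq_zero_of_mem_forms hg hA hi (homogeneousComponent_mem_apolarIdeal hg hf i)
      (homogeneousComponent_mem_forms i f)
  have h0 : f ∈ idealOfVars (Fin 4) k ^ 0 := by simp
  have h1 := sub_homogeneousComponent_mem h0
  rw [h 0 zero_lt_two, sub_zero] at h1
  have h2 := sub_homogeneousComponent_mem h1
  rwa [h (0 + 1) one_lt_two, sub_zero] at h2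

end Decomposition

/-! ### Generators of the apolar ideal of a cubic, and its square -/

section Cubic

variable {k : Type*} [Field k] [CharZero k] {g : MvPolynomial (Fin 4) k}

theorem apolarIdeal_inf_forms_two (hg : g ∈ forms k 3) :
    (apolarIdeal g).restrictScalars k ⊓ forms k 2 = nullQuadrics (apolarFunctional g) := by
  ext f
  rw [mem_nullQuadrics]
  constructor
  · rintro ⟨hf, hf2⟩
    exact ⟨hf2, (mem_apolarIdeal_iff hg rfl hf2).1 hf⟩
  · rintro ⟨hf2, hf⟩
    exact ⟨(mem_apolarIdeal_iff hg rfl hf2).2 hf, hf2⟩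

theorem apolarIdeal_inf_forms_three (hg : g ∈ forms k 3) :
    (apolarIdeal g).restrictScalars k ⊓ forms k 3 = nullCubics (apolarFunctional g) := by
  ext f
  constructor
  · rintro ⟨hf, hf3⟩
    refine ⟨hf3, ?_⟩
    change apolarFunctional g f = 0
    rw [← one_mul f]
    exact (mem_apolarIdeal_iff hg rfl hf3).1 hf 1 (isHomogeneous_one _ _)
  · rintro ⟨hf3, hf⟩
    refine ⟨(mem_apolarIdeal_iff hg rfl hf3).2 fun p hp => ?_, hf3⟩
    rw [show forms k 0 = 1 from homogeneousSubmodule_zero _] at hp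
    obtain ⟨c, rfl⟩ := Submodule.mem_one.1 hp
    rw [← Algebra.smul_def, map_smul, show apolarFunctional g f = 0 from hf, smul_zero]

theorem nondegenerateOn_apolarFunctional (hg : g ∈ forms k 3)
    (hA : quotientHilbertFunction (apolarIdeal g) = vectorFunction [1, 4, 4, 1]) :
    NondegenerateOn (apolarFunctional g) (forms k 1) := by
  intro v hv h
  refine apolarIdeal_eq_zero_of_mem_forms hg hA one_lt_two ?_ hv
  refine (mem_apolarIdeal_iff (e := 2) hg rfl hv).2 fun p hp => ?_
  rw [mul_comm]
  exact h p (by rwa [forms_one_pow])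

theorem finrank_nullCubics_apolarFunctional (hg : g ∈ forms k 3)
    (hA : quotientHilbertFunction (apolarIdeal g) = vectorFunction [1, 4, 4, 1]) :
    Module.finrank k ↥(nullCubics (apolarFunctional g)) = 19 := by
  have h := vectorFunction_add_finrank hg hA 3
  rw [apolarIdeal_inf_forms_three hg, show Nat.choose (3 + 3) 3 = 20 from rfl,
    show vectorFunction [1, 4, 4, 1] 3 = 1 from rfl] at h
  omega

theorem homogeneousComponent_two_mem (hg : g ∈ forms k 3) {f : MvPolynomial (Fin 4) k}
    (hf : f ∈ apolarIdeal g) : homogeneousComponent 2 f ∈ nullQuadrics (apolarFunctional g) := by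
  rw [← apolarIdeal_inf_forms_two hg]
  exact ⟨homogeneousComponent_mem_apolarIdeal hg hf 2, homogeneousComponent_mem_forms 2 f⟩

theorem homogeneousComponent_three_mem (hg : g ∈ forms k 3) {f : MvPolynomial (Fin 4) k}
    (hf : f ∈ apolarIdeal g) : homogeneousComponent 3 f ∈ nullCubics (apolarFunctional g) := by
  rw [← apolarIdeal_inf_forms_three hg]
  exact ⟨homogeneousComponent_mem_apolarIdeal hg hf 3, homogeneousComponent_mem_forms 3 f⟩

theorem exists_add_add_of_mem_apolarIdeal (hg : g ∈ forms k 3)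
    (hA : quotientHilbertFunction (apolarIdeal g) = vectorFunction [1, 4, 4, 1])
    {f : MvPolynomial (Fin 4) k} (hf : f ∈ apolarIdeal g) :
    ∃ q ∈ nullQuadrics (apolarFunctional g), ∃ c ∈ nullCubics (apolarFunctional g),
      ∃ r ∈ idealOfVars (Fin 4) k ^ 4, f = q + c + r := by
  obtain ⟨r, hr, h⟩ := exists_add_add (apolarIdeal_le_pow_idealOfVars hg hA hf)
  exact ⟨_, homogeneousComponent_two_mem hg hf, _, homogeneousComponent_three_mem hg hf, r, hr, h⟩

theorem exists_add_add_of_mem_apolarIdeal_sq (hg : g ∈ forms k 3)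
    (hA : quotientHilbertFunction (apolarIdeal g) = vectorFunction [1, 4, 4, 1])
    {f : MvPolynomial (Fin 4) k} (hf : f ∈ apolarIdeal g ^ 2) :
    ∃ u ∈ nullQuadrics (apolarFunctional g) * nullQuadrics (apolarFunctional g),
      ∃ v ∈ nullQuadrics (apolarFunctional g) * nullCubics (apolarFunctional g),
      ∃ r ∈ idealOfVars (Fin 4) k ^ 6, f = u + v + r := by
  rw [sq] at hf
  induction hf using Submodule.mul_induction_on' with
  | mem_mul_mem x hx y hy =>
    obtain ⟨q, hq, c, hc, r, hr, rfl⟩ := exists_add_add_of_mem_apolarIdeal hg hA hx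
    obtain ⟨q', hq', c', hc', r', hr', rfl⟩ := exists_add_add_of_mem_apolarIdeal hg hA hy
    have hy2 := apolarIdeal_le_pow_idealOfVars hg hA hy
    have hq2 := forms_le_pow_idealOfVars (nullQuadrics_le _ hq)
    have hc3 := forms_le_pow_idealOfVars (nullCubics_le _ hc)
    have hc3' := forms_le_pow_idealOfVars (nullCubics_le _ hc')
    refine ⟨q * q', Submodule.mul_mem_mul hq hq', q * c' + q' * c,
      add_mem (Submodule.mul_mem_mul hq hc') (Submodule.mul_mem_mul hq' hc),
      q * r' + (c * c' + c * r') + r * (q' + c' + r'), ?_, by ring⟩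
    refine add_mem (add_mem ?_ (add_mem ?_ ?_)) ?_
    · exact mul_mem_pow_idealOfVars (by norm_num) hq2 hr'
    · exact mul_mem_pow_idealOfVars (by norm_num) hc3 hc3'
    · exact mul_mem_pow_idealOfVars (by norm_num) hc3 hr'
    · exact mul_mem_pow_idealOfVars (by norm_num) hr hy2
  | add x _ y _ hx hy =>
    obtain ⟨u, hu, v, hv, r, hr, rfl⟩ := hx
    obtain ⟨u', hu', v', hv', r', hr', rfl⟩ := hy
    exact ⟨u + u', add_mem hu hu', v + v', add_mem hv hv', r + r', add_mem hr hr', by ring⟩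

theorem nullQuadrics_le_apolarIdeal (hg : g ∈ forms k 3) :
    nullQuadrics (apolarFunctional g) ≤ (apolarIdeal g).restrictScalars k :=
  apolarIdeal_inf_forms_two hg ▸ inf_le_left

theorem nullCubics_le_apolarIdeal (hg : g ∈ forms k 3) :
    nullCubics (apolarFunctional g) ≤ (apolarIdeal g).restrictScalars k :=
  apolarIdeal_inf_forms_three hg ▸ inf_le_left

theorem forms_le_apolarIdeal_sq (hg : g ∈ forms k 3)
    (h6 : forms k 6 ≤ nullCubics (apolarFunctional g) * nullCubics (apolarFunctional g) ⊔
      nullQuadrics (apolarFunctional g) * forms k 4) {d : ℕ} (hd : 6 ≤ d) :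
    forms k d ≤ (apolarIdeal g ^ 2).restrictScalars k := by
  rw [← Nat.add_sub_cancel' hd, ← forms_mul, Submodule.mul_le]
  intro p hp q _
  refine Ideal.mul_mem_right _ _ ((h6.trans (sup_le ?_ ?_) :
    _ ≤ (apolarIdeal g ^ 2).restrictScalars k) hp)
  · exact mul_le_apolarIdeal_sq (nullCubics_le_apolarIdeal hg) (nullCubics_le_apolarIdeal hg)
  · exact mul_le_apolarIdeal_sq (nullQuadrics_le_apolarIdeal hg)
      fun f hf => forms_le_apolarIdeal hg (by norm_num) hf

/-- An element of g^⊥ is a null quadric plus a null cubic plus terms of order at least 4, so the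
square starts with N₂N₂ and N₂N₃; from degree 6 on it contains all forms. The numbers 35 and 56 are
dim S₄ and dim S₅. -/
theorem quotientHilbertFunction_apolarIdeal_sq (hg : g ∈ forms k 3)
    (hA : quotientHilbertFunction (apolarIdeal g) = vectorFunction [1, 4, 4, 1])
    (h6 : forms k 6 ≤ nullCubics (apolarFunctional g) * nullCubics (apolarFunctional g) ⊔
      nullQuadrics (apolarFunctional g) * forms k 4) {a b : ℕ}
    (ha : a + Module.finrank k
      ↥(nullQuadrics (apolarFunctional g) * nullQuadrics (apolarFunctional g)) = 35)
    (hb : b + Module.finrank k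
      ↥(nullQuadrics (apolarFunctional g) * nullCubics (apolarFunctional g)) = 56) :
    quotientHilbertFunction (apolarIdeal g ^ 2) = vectorFunction [1, 4, 10, 20, a, b] := by
  set N₂ := nullQuadrics (apolarFunctional g)
  set N₃ := nullCubics (apolarFunctional g)
  set J := apolarIdeal g ^ 2
  have hN2 : N₂ ≤ (apolarIdeal g).restrictScalars k := nullQuadrics_le_apolarIdeal hg
  have hN3 : N₃ ≤ (apolarIdeal g).restrictScalars k := nullCubics_le_apolarIdeal hg
  have h44 : N₂ * N₂ ≤ forms k 4 :=
    (mul_le_mul' (nullQuadrics_le _) (nullQuadrics_le _)).trans (forms_mul 2 2).le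
  have h55 : N₂ * N₃ ≤ forms k 5 :=
    (mul_le_mul' (nullQuadrics_le _) (nullCubics_le _)).trans (forms_mul 2 3).le
  have hlow : ∀ f ∈ J, ∀ i < 4, homogeneousComponent i f = 0 := by
    intro f hf i hi
    obtain ⟨u, hu, v, hv, r, hr, rfl⟩ := exists_add_add_of_mem_apolarIdeal_sq hg hA hf
    rw [homogeneousComponent_add_add (h44 hu) (h55 hv) hr (by omega), if_neg (by omega),
      if_neg (by omega), add_zero]
  have hfour : ∀ f ∈ J, homogeneousComponent 4 f ∈ N₂ * N₂ := by
    intro f hf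
    obtain ⟨u, hu, v, hv, r, hr, rfl⟩ := exists_add_add_of_mem_apolarIdeal_sq hg hA hf
    rwa [homogeneousComponent_add_add (h44 hu) (h55 hv) hr (by omega), if_pos rfl,
      if_neg (by omega), add_zero]
  have hfive : ∀ f ∈ J, homogeneousComponent 5 f ∈ N₂ * N₃ := by
    intro f hf
    obtain ⟨u, hu, v, hv, r, hr, rfl⟩ := exists_add_add_of_mem_apolarIdeal_sq hg hA hf
    rwa [homogeneousComponent_add_add (h44 hu) (h55 hv) hr (by omega), if_neg (by omega),
      if_pos rfl, zero_add]
  have hJ : ∀ i, ∀ f ∈ J, homogeneousComponent i f ∈ J := by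
    intro i f hf
    rcases lt_or_ge i 4 with hi | hi
    · rw [hlow f hf i hi]; exact zero_mem _
    rcases lt_or_ge i 6 with hi' | hi'
    · interval_cases i
      · exact mul_le_apolarIdeal_sq hN2 hN2 (hfour f hf)
      · exact mul_le_apolarIdeal_sq hN2 hN3 (hfive f hf)
    · exact forms_le_apolarIdeal_sq hg h6 hi' (homogeneousComponent_mem_forms i f)
  funext i
  have key := quotientHilbertFunction_add_finrank (hJ i)
  rw [finrank_forms] at key
  rcases lt_or_ge i 4 with hi | hi
  · have h0 : J.restrictScalars k ⊓ forms k i = ⊥ := by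
      rw [eq_bot_iff]
      rintro f ⟨hf, hfi⟩
      rw [Submodule.mem_bot, ← homogeneousComponent_eq_self_of_mem hfi]
      exact hlow f hf i hi
    rw [h0, finrank_bot, add_zero] at key
    rw [key]
    interval_cases i <;> rfl
  rcases lt_or_ge i 6 with hi' | hi'
  · interval_cases i
    · have h0 : J.restrictScalars k ⊓ forms k 4 = N₂ * N₂ := by
        refine le_antisymm ?_ (le_inf (mul_le_apolarIdeal_sq hN2 hN2) h44)
        rintro f ⟨hf, hfi⟩
        rw [← homogeneousComponent_eq_self_of_mem hfi]
        exact hfour f hf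
      rw [h0, show Nat.choose (3 + 4) 4 = 35 from rfl, ← ha] at key
      exact Nat.add_right_cancel key
    · have h0 : J.restrictScalars k ⊓ forms k 5 = N₂ * N₃ := by
        refine le_antisymm ?_ (le_inf (mul_le_apolarIdeal_sq hN2 hN3) h55)
        rintro f ⟨hf, hfi⟩
        rw [← homogeneousComponent_eq_self_of_mem hfi]
        exact hfive f hf
      rw [h0, show Nat.choose (3 + 5) 5 = 56 from rfl, ← hb] at key
      exact Nat.add_right_cancel key
  · rw [inf_eq_right.2 (forms_le_apolarIdeal_sq hg h6 hi'), finrank_forms] at key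
    rw [Nat.add_eq_right.1 key]
    exact (List.getD_eq_default _ 0 hi').symm

variable {B : Set (MvPolynomial (Fin 4) k)}

/-- When a member x of g^⊥ is multiplied by a polynomial, its quadratic part is rescaled. The cubic
part is rescaled too, and changes further only by a linear form times that quadratic part, an
element of S₁N₂. -/
theorem homogeneousComponent_mem_span_generators (hg : g ∈ forms k 3)
    (hA : quotientHilbertFunction (apolarIdeal g) = vectorFunction [1, 4, 4, 1])
    (hB : IsMinimalHomogeneousGenerators (apolarIdeal g) B)
    {x : MvPolynomial (Fin 4) k} (hx : x ∈ apolarIdeal g) :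
    homogeneousComponent 2 x ∈ Submodule.span k {f ∈ B | f.IsHomogeneous 2} ∧
    homogeneousComponent 3 x ∈ forms k 1 * nullQuadrics (apolarFunctional g) ⊔
      Submodule.span k {f ∈ B | f.IsHomogeneous 3} := by
  rw [← hB.1.2] at hx
  induction hx using Submodule.span_induction with
  | mem b hb =>
    obtain ⟨d, hd⟩ := hB.1.1 b hb
    rw [homogeneousComponent_of_mem hd, homogeneousComponent_of_mem hd]
    constructor
    · split_ifs with h
      · exact Submodule.subset_span ⟨hb, h ▸ hd⟩
      · exact zero_mem _
    · split_ifs with h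
      · exact Submodule.mem_sup_right (Submodule.subset_span ⟨hb, h ▸ hd⟩)
      · exact zero_mem _
  | zero => simp only [map_zero]; exact ⟨zero_mem _, zero_mem _⟩
  | add x y _ _ hx hy =>
    simp only [map_add]
    exact ⟨add_mem hx.1 hy.1, add_mem hx.2 hy.2⟩
  | smul a x hxs hx =>
    have hxI : x ∈ apolarIdeal g := hB.1.2 ▸ hxs
    have hq := homogeneousComponent_two_mem hg hxI
    have hc := nullCubics_le _ (homogeneousComponent_three_mem hg hxI)
    have hxm := apolarIdeal_le_pow_idealOfVars hg hA hxI
    obtain ⟨r, hr, hxe⟩ := exists_add_add hxm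
    obtain ⟨s, hs, hae⟩ := exists_add_add (n := 0) (f := a) (by simp)
    have ha1 := homogeneousComponent_mem_forms (0 + 1) a
    rw [homogeneousComponent_zero] at hae
    set q := homogeneousComponent 2 x
    set c := homogeneousComponent 3 x
    set t := homogeneousComponent (0 + 1) a
    set e := coeff 0 a
    have he : a • x = e • q + (e • c + t * q) +
        (C e * r + (t * c + t * r) + s * x) := by
      rw [smul_eq_mul, smul_eq_C_mul, smul_eq_C_mul]
      calc a * x = C e * x + t * x + s * x := by rw [← add_mul, ← add_mul, ← hae]
        _ = C e * (q + c + r) + t * (q + c + r) + s * x := by rw [← hxe]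
        _ = _ := by ring
    have hrem : C e * r + (t * c + t * r) + s * x ∈ idealOfVars (Fin 4) k ^ (2 + 2) := by
      have ht := forms_le_pow_idealOfVars ha1
      refine add_mem (add_mem (Ideal.mul_mem_left _ _ hr) (add_mem ?_ ?_)) ?_
      · exact mul_mem_pow_idealOfVars (by norm_num) ht (forms_le_pow_idealOfVars hc)
      · exact mul_mem_pow_idealOfVars (by norm_num) ht hr
      · exact mul_mem_pow_idealOfVars (by norm_num) hs hxm
    have htq : t * q ∈ forms k 1 * nullQuadrics (apolarFunctional g) :=
      Submodule.mul_mem_mul ha1 hq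
    have h3 : e • c + t * q ∈ forms k (2 + 1) :=
      add_mem (Submodule.smul_mem _ _ hc) (nullCubics_le _ (forms_one_mul_nullQuadrics_le _ htq))
    have h2 : e • q ∈ forms k 2 := Submodule.smul_mem _ _ (nullQuadrics_le _ hq)
    rw [he, homogeneousComponent_add_add h2 h3 hrem (by norm_num),
      homogeneousComponent_add_add h2 h3 hrem (by norm_num), if_pos rfl, if_neg (by norm_num),
      if_neg (by norm_num), if_pos rfl, add_zero, zero_add]
    exact ⟨Submodule.smul_mem _ _ hx.1,
      add_mem (Submodule.smul_mem _ _ hx.2) (Submodule.mem_sup_left htq)⟩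

theorem nullCubics_eq_sup_span_generators (hg : g ∈ forms k 3)
    (hA : quotientHilbertFunction (apolarIdeal g) = vectorFunction [1, 4, 4, 1])
    (hB : IsMinimalHomogeneousGenerators (apolarIdeal g) B) :
    nullCubics (apolarFunctional g) = forms k 1 * nullQuadrics (apolarFunctional g) ⊔
      Submodule.span k {f ∈ B | f.IsHomogeneous 3} := by
  refine le_antisymm (fun f hf => ?_)
    (sup_le (forms_one_mul_nullQuadrics_le _) (Submodule.span_le.2 ?_))
  · rw [← homogeneousComponent_eq_self_of_mem (nullCubics_le _ hf)]
    exact (homogeneousComponent_mem_span_generators hg hA hB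
      (nullCubics_le_apolarIdeal hg hf)).2
  · rintro f ⟨hf, hf3⟩
    rw [← apolarIdeal_inf_forms_three hg]
    exact ⟨hB.1.2 ▸ Ideal.subset_span hf, hf3⟩

/-- A relation modulo S₁N₂ would put the cubic generator b in the ideal of the others: N₂ is spanned
by the quadratic generators, none of which is b, so S₁N₂ already lies in that ideal. -/
theorem linearIndependent_cubic_generators (hg : g ∈ forms k 3)
    (hA : quotientHilbertFunction (apolarIdeal g) = vectorFunction [1, 4, 4, 1])
    (hB : IsMinimalHomogeneousGenerators (apolarIdeal g) B) :
    LinearIndependent k fun b : {f ∈ B | f.IsHomogeneous 3} =>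
      (forms k 1 * nullQuadrics (apolarFunctional g)).mkQ b := by
  rw [linearIndependent_iff_notMem_span]
  rintro ⟨b, hbB, hb3⟩ h
  refine hB.notMem_span hbB ?_
  -- The zero polynomial is homogeneous of every degree and is excluded before degrees can
  -- distinguish generators.
  by_cases hb0 : b = 0
  · rw [hb0]; exact zero_mem _
  have himage : (fun b : {f ∈ B | f.IsHomogeneous 3} =>
      (forms k 1 * nullQuadrics (apolarFunctional g)).mkQ b) '' (Set.univ \ {⟨b, hbB, hb3⟩}) ⊆
      (forms k 1 * nullQuadrics (apolarFunctional g)).mkQ '' (B \ {b}) := by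
    rintro _ ⟨⟨f, hf, _⟩, hfb, rfl⟩
    exact ⟨f, ⟨hf, fun h => hfb.2 (Subtype.ext h)⟩, rfl⟩
  have h1 := Submodule.span_mono himage h
  rw [← Submodule.map_span] at h1
  obtain ⟨y, hy, hyb⟩ := h1
  have hspan : Submodule.span k (B \ {b}) ≤ (Ideal.span (B \ {b})).restrictScalars k :=
    Submodule.span_le.2 fun f hf => Ideal.subset_span hf
  have hquad : nullQuadrics (apolarFunctional g) ≤ (Ideal.span (B \ {b})).restrictScalars k := by
    intro f hf
    have h2 := (homogeneousComponent_mem_span_generators hg hA hB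
      (nullQuadrics_le_apolarIdeal hg hf)).1
    rw [homogeneousComponent_eq_self_of_mem (nullQuadrics_le _ hf)] at h2
    refine hspan (Submodule.span_mono ?_ h2)
    rintro c ⟨hc, hc2⟩
    refine ⟨hc, fun hcb => hb0 ?_⟩
    rw [Set.mem_singleton_iff.1 hcb] at hc2
    by_contra hne
    exact absurd (hc2.inj_right hb3 hne) (by norm_num)
  have hW : forms k 1 * nullQuadrics (apolarFunctional g) ≤
      (Ideal.span (B \ {b})).restrictScalars k :=
    Submodule.mul_le.2 fun p _ q hq => Ideal.mul_mem_left _ _ (hquad hq)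
  have hsub := hW ((Submodule.Quotient.eq _).1 hyb)
  have := sub_mem (hspan hy) hsub
  rwa [sub_sub_cancel] at this

theorem numGenerators_add_finrank (hg : g ∈ forms k 3)
    (hA : quotientHilbertFunction (apolarIdeal g) = vectorFunction [1, 4, 4, 1])
    (hB : IsMinimalHomogeneousGenerators (apolarIdeal g) B) :
    numGenerators B 3 +
      Module.finrank k ↥(forms k 1 * nullQuadrics (apolarFunctional g)) = 19 := by
  have hind := linearIndependent_cubic_generators hg hA hB
  have hN := nullCubics_eq_sup_span_generators hg hA hB
  have hle := forms_one_mul_nullQuadrics_le (apolarFunctional g)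
  have hfd := finiteDimensional_of_le_forms (nullCubics_le (apolarFunctional g))
  rw [← finrank_nullCubics_apolarFunctional hg hA]
  set W := forms k 1 * nullQuadrics (apolarFunctional g)
  set N := nullCubics (apolarFunctional g)
  have hmap : N.map W.mkQ = Submodule.span k
      (Set.range fun b : {f ∈ B | f.IsHomogeneous 3} => W.mkQ b) := by
    rw [hN, Submodule.map_sup, Submodule.mkQ_map_self, bot_sup_eq, Submodule.map_span,
      Set.image_eq_range]
  -- The comparison is made between cardinals, so finiteness of `B` needs no argument.
  have hcard : Module.finrank k (N.map W.mkQ) = numGenerators B 3 := by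
    rw [hmap, Module.finrank, rank_span hind, Cardinal.mk_range_eq _ hind.injective]
    rfl
  rw [← hcard, ← LinearMap.finrank_range_add_finrank_ker (W.mkQ.domRestrict N),
    LinearMap.range_domRestrict, LinearMap.ker_domRestrict, Submodule.ker_mkQ]
  congr 1
  exact (Submodule.comapSubtypeEquivOfLe hle).finrank_eq.symm

end Cubic

theorem proposition5p9 {k : Type*} [Field k] [IsAlgClosed k] [CharZero k]
    (g : MvPolynomial (Fin 4) k) (hg : g.IsHomogeneous 3)
    (hA : quotientHilbertFunction (apolarIdeal g) = vectorFunction [1, 4, 4, 1])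
    (B : Set (MvPolynomial (Fin 4) k))
    (hB : IsMinimalHomogeneousGenerators (apolarIdeal g) B)
    (hβ : 1 ≤ numGenerators B 3) :
    Xor
      (numGenerators B 3 = 1 ∧
        quotientHilbertFunction (apolarIdeal g ^ 2) = vectorFunction [1, 4, 10, 20, 14, 1])
      (numGenerators B 3 = 3 ∧
        quotientHilbertFunction (apolarIdeal g ^ 2) = vectorFunction [1, 4, 10, 20, 16, 4]) := by
  -- The equality β + dim S₁N₂ = 19 turns β ≥ 1 into the bound 18, and the dimensions 18 and 16 into
  -- β = 1 and β = 3.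
  have hβW := numGenerators_add_finrank hg hA hB
  obtain ⟨hdim, h6⟩ := hasExpectedDimensions_of_finrank_le
    (nondegenerateOn_apolarFunctional hg hA) (by omega)
  rcases hdim with ⟨h1, h2, h3⟩ | ⟨h1, h2, h3⟩
  · refine Or.inl ⟨⟨by omega, quotientHilbertFunction_apolarIdeal_sq hg hA h6 ?_ ?_⟩, ?_⟩
    · rw [h2]
    · rw [h3]
    · rintro ⟨h, -⟩
      omega
  · refine Or.inr ⟨⟨by omega, quotientHilbertFunction_apolarIdeal_sq hg hA h6 ?_ ?_⟩, ?_⟩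
    · rw [h2]
    · rw [h3]
    · rintro ⟨h, -⟩
      omega

end
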